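/- Let $k \ge 1$, let $M$ be a smooth (Hausdorff, second countable, not necessarily compact or connected) manifold without boundary of dimension $n+1\ge 1$, and let $i : Z \to M$ be the inclusion of a closed embedded smooth hypersurface (possibly empty or disconnected). Let $I_Z \subseteq C^\infty(M)$ be the ideal of smooth functions vanishing on $Z$. A $(k-1)$-jet at $Z$ is a section over $Z$ of the sheaf $C^\infty/\mathcal I_Z^{k}$, equivalently an element of $C^\infty(M)/I_Z^k$. A $b^k$-manifold is a triple $(M,Z,j_Z)$ where $j_Z$ is a $(k-1)$-jet at $Z$ that is represented by a local defining function $y$ of $Z$ (that is, $y$ is smooth, $Z$ is the zero set of $y$ in a neighbourhood of $Z$, and $dy$ vanishes nowhere on $Z$). If $M$ and $Z$ are oriented one may also require $y$ to be compatible with the orientations; this is not needed for the result. A $b^k$-vector field is a smooth vector field $v$ on $M$ that is tangent to $Z$ along $Z$ and satisfies $\mathcal L_v f \in I_Z^k$ for every $f \in j_Z$. The $b^k$-vector fields are the sections of a vector bundle ${}^{b^k}TM$, which over $M\setminus Z$ is $TM$. The space ${}^{b^k}\Omega^p(M)$ of $b^k$-forms of degree $p$ is the space of smooth sections of $\wedge^p({}^{b^k}TM)^*$;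 equivalently, it is the space of smooth $p$-forms $\omega$ on $M\setminus Z$ such that $\omega(v_1,\dots,v_p)$ extends to a smooth function on $M$ for all $b^k$-vector fields $v_1,\dots,v_p$. The exterior derivative on $M \setminus Z$ makes ${}^{b^k}\Omega^*(M)$ a complex with ${}^{b^k}\Omega^0(M)=C^\infty(M)$, and its cohomology is denoted ${}^{b^k}H^*(M)$. Then for every $p\ge 0$ there is an isomorphism of real vector spaces $$ {}^{b^k}H^p(M) \;\cong\; H^p(M) \oplus \bigl(H^{p-1}(Z)\bigr)^k ,$$ where $H^*$ denotes the de Rham cohomology of smooth forms and $H^{-1}(Z)=0$. (The isomorphism is not claimed to be canonical.) -/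

import Mathlib

open scoped Manifold ContDiff

noncomputable section

namespace BkGeometry

section Forms

/-- A (not necessarily continuous) field of alternating `p`-forms on the tangent spaces of a
manifold `M` without boundary modelled on `E`. In Mathlib the tangent space `TangentSpace 𝓘(ℝ, E) x`
is `E` by definition, through the preferred chart at `x`; the value at `x` is an alternating form
on that space. -/
@[ext]
structure FormField (E M : Type*) [NormedAddCommGroup E] [NormedSpace ℝ E] (p : ℕ) where
  /-- the form at a point -/
  toFun : M → E [⋀^Fin p]→L[ℝ] ℝ

namespace FormField

variable {E M : Type*} [NormedAddCommGroup E] [NormedSpace ℝ E] {p : ℕ}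

instance : CoeFun (FormField E M p) (fun _ => M → E [⋀^Fin p]→L[ℝ] ℝ) := ⟨FormField.toFun⟩

/-- Fields of forms are functions with values in a fixed vector space; this defines their
pointwise addition and scalar multiplication. -/
def equivFun : FormField E M p ≃ (M → E [⋀^Fin p]→L[ℝ] ℝ) :=
  ⟨FormField.toFun, FormField.mk, fun _ => rfl, fun _ => rfl⟩

instance : AddCommGroup (FormField E M p) := equivFun.addCommGroup

instance : Module ℝ (FormField E M p) := equivFun.module ℝ

lemma zero_apply (x : M) : (0 : FormField E M p) x = 0 := rfl

lemma add_apply (α β : FormField E M p) (x : M) : (α + β) x = α x + β x := rfl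

lemma smul_apply (c : ℝ) (α : FormField E M p) (x : M) : (c • α) x = c • α x := rfl

end FormField

variable {E M : Type*} [NormedAddCommGroup E] [NormedSpace ℝ E]
  [TopologicalSpace M] [ChartedSpace E M]

/-- The expression of a field of `p`-forms in the preferred chart `φ` at `x`, that is, its pullback
under `φ⁻¹` (only the values on the target of `φ` matter). -/
def inChart {p : ℕ} (α : FormField E M p) (x : M) : E → E [⋀^Fin p]→L[ℝ] ℝ := fun e =>
  (α ((extChartAt 𝓘(ℝ, E) x).symm e)).compContinuousLinearMap
    (mfderiv 𝓘(ℝ, E) 𝓘(ℝ, E) (extChartAt 𝓘(ℝ, E) x).symm e)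

/-- The exterior derivative: computed at each point `x` in the preferred chart `φ` at `x`
and pulled back by `φ`. For forms that are smooth near `x` any other chart gives the same value. -/
def extDerivField {p : ℕ} (α : FormField E M p) : FormField E M (p + 1) where
  toFun x := (extDeriv (inChart α x) (extChartAt 𝓘(ℝ, E) x x)).compContinuousLinearMap
    (mfderiv 𝓘(ℝ, E) 𝓘(ℝ, E) (extChartAt 𝓘(ℝ, E) x) x)

lemma inChart_add {p : ℕ} (α η : FormField E M p) (x : M) :
    inChart (α + η) x = inChart α x + inChart η x := by
  rfl

lemma inChart_smul {p : ℕ} (c : ℝ) (α : FormField E M p) (x : M) :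
    inChart (c • α) x = c • inChart α x := by
  rfl

lemma inChart_zero {p : ℕ} (x : M) : inChart (0 : FormField E M p) x = 0 := by
  rfl

/-- `Ω^p(U)`: smooth `p`-forms on the open set `U ⊆ M`. So that a form on `U` is determined by its
values on `U`, it is normalised to be zero at the points outside `U`. -/
def smoothForms (U : TopologicalSpace.Opens M) (p : ℕ) : Submodule ℝ (FormField E M p) where
  carrier := {α | (∀ x ∈ U, ContDiffAt ℝ ∞ (inChart α x) (extChartAt 𝓘(ℝ, E) x x)) ∧
    ∀ x ∉ U, α x = 0}
  zero_mem' := ⟨fun x _ => by rw [inChart_zero]; exact contDiffAt_const, fun _ _ => rfl⟩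
  add_mem' := fun {α η} hα hη => ⟨fun x hx => by
    rw [inChart_add]; exact (hα.1 x hx).add (hη.1 x hx), fun x hx => by
    rw [FormField.add_apply, hα.2 x hx, hη.2 x hx, add_zero]⟩
  smul_mem' := fun c {α} hα => ⟨fun x hx => by
    rw [inChart_smul]; exact contDiffAt_const.smul (hα.1 x hx), fun x hx => by
    rw [FormField.smul_apply, hα.2 x hx, smul_zero]⟩

open Classical in
/-- The exterior derivative of smooth forms on `U`, extended by zero outside `U`. -/
def d (U : TopologicalSpace.Opens M) (p : ℕ) :
    smoothForms (E := E) U p →ₗ[ℝ] FormField E M (p + 1) where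
  toFun α := ⟨fun x => if x ∈ U then extDerivField α.1 x else 0⟩
  map_add' := fun α η => by
    ext1; funext x
    rw [FormField.add_apply]
    by_cases hx : x ∈ U
    · have h1 := (α.2.1 x hx).differentiableAt (by simp)
      have h2 := (η.2.1 x hx).differentiableAt (by simp)
      simp only [hx, if_true, extDerivField, Submodule.coe_add, inChart_add]
      rw [extDeriv_add h1 h2]
      rfl
    · simp [hx]
  map_smul' := fun c α => by
    ext1; funext x
    rw [FormField.smul_apply]
    by_cases hx : x ∈ U
    · simp only [hx, if_true, extDerivField, Submodule.coe_smul, inChart_smul, RingHom.id_apply]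
      rw [extDeriv_smul]
      rfl
    · simp [hx]

section Cohomology

variable (U : TopologicalSpace.Opens M) (C : ∀ p : ℕ, Submodule ℝ (FormField E M p))

/-- The closed forms in `C^p`, for a complex `(C^*, d)` of smooth forms on `U`. -/
def closedForms (p : ℕ) : Submodule ℝ (FormField E M p) :=
  C p ⊓ (LinearMap.ker (d U p)).map (smoothForms U p).subtype

/-- The forms in `C^p` that are of the form `dβ` with `β ∈ C^{p-1}` (only `0` when `p = 0`). -/
def exactForms : ∀ p : ℕ, Submodule ℝ (FormField E M p)
  | 0 => ⊥
  | p + 1 => C (p + 1) ⊓ ((C p).comap (smoothForms U p).subtype).map (d U p)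

/-- The `p`-th cohomology space, closed forms modulo exact forms, of a complex `(C^*, d)` of smooth
forms on `U`. -/
abbrev Cohomology (p : ℕ) : Type _ :=
  closedForms U C p ⧸ (exactForms U C p).submoduleOf (closedForms U C p)

end Cohomology

variable (E M) in
/-- The de Rham cohomology `H^p(M)` of smooth forms on `M`. -/
abbrev DeRhamCohomology (p : ℕ) : Type _ :=
  Cohomology (⊤ : TopologicalSpace.Opens M) (smoothForms (E := E) ⊤) p

end Forms

section BkManifold

/-- The ideal `I_Z` of the smooth functions on `M` that vanish on the image of `incl : Z → M`. -/
def vanishingIdeal {E M Z : Type*} [NormedAddCommGroup E] [NormedSpace ℝ E]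
    [TopologicalSpace M] [ChartedSpace E M] (incl : Z → M) :
    Ideal C^∞⟮𝓘(ℝ, E), M; ℝ⟯ where
  carrier := {f | ∀ z, f (incl z) = 0}
  zero_mem' := fun _ => rfl
  add_mem' := fun {f g} hf hg z => by
    change f (incl z) + g (incl z) = 0
    rw [hf z, hg z, add_zero]
  smul_mem' := fun c {f} hf z => by
    change c (incl z) * f (incl z) = 0
    rw [hf z, mul_zero]

/-- `y` is (after restriction to a neighbourhood of `Z`) a local defining function for the
hypersurface `Z`: near `Z` its zero set is `Z`, and `dy` vanishes nowhere on `Z`. -/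
def IsLocalDefiningFunction {E M Z : Type*} [NormedAddCommGroup E] [NormedSpace ℝ E]
    [TopologicalSpace M] [ChartedSpace E M] (incl : Z → M) (y : C^∞⟮𝓘(ℝ, E), M; ℝ⟯) : Prop :=
  (∃ W : Set M, IsOpen W ∧ Set.range incl ⊆ W ∧ ∀ x ∈ W, y x = 0 ↔ x ∈ Set.range incl) ∧
    ∀ z, mfderiv 𝓘(ℝ, E) 𝓘(ℝ, ℝ) y (incl z) ≠ 0

/-- A `b^k`-manifold structure on the pair `(M, Z)`: a closed embedding of `Z` in `M` as a
hypersurface, with a `(k-1)`-jet at `Z` that is represented by a local defining function for `Z`.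

A `(k-1)`-jet at `Z` is a section over `Z` of the sheaf `C^∞ / I_Z^k`. Since sheaves of modules
over smooth functions have partitions of unity, the space of these sections is the quotient of
`C^∞(M)` by the `k`-th power of the ideal `I_Z`.

Orientations of `M` and `Z` are not part of the data: nothing below depends on them, and
a `b^k`-manifold with compatible orientations is in particular one in the sense used here. -/
structure BkManifold (k : ℕ) (E F M Z : Type*)
    [NormedAddCommGroup E] [NormedSpace ℝ E] [NormedAddCommGroup F] [NormedSpace ℝ F]
    [TopologicalSpace M] [ChartedSpace E M] [TopologicalSpace Z] [ChartedSpace F Z] where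
  /-- the inclusion of the hypersurface -/
  incl : Z → M
  isSmoothEmbedding : Manifold.IsSmoothEmbedding 𝓘(ℝ, F) 𝓘(ℝ, E) ∞ incl
  isClosed_range : IsClosed (Set.range incl)
  /-- the jet data `j_Z` -/
  jet : C^∞⟮𝓘(ℝ, E), M; ℝ⟯ ⧸ (vanishingIdeal incl ^ k : Ideal C^∞⟮𝓘(ℝ, E), M; ℝ⟯)
  exists_rep : ∃ y : C^∞⟮𝓘(ℝ, E), M; ℝ⟯,
    IsLocalDefiningFunction incl y ∧ Ideal.Quotient.mk _ y = jet

namespace BkManifold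

variable {k : ℕ} {E F M Z : Type*}
  [NormedAddCommGroup E] [NormedSpace ℝ E] [NormedAddCommGroup F] [NormedSpace ℝ F]
  [TopologicalSpace M] [ChartedSpace E M] [IsManifold 𝓘(ℝ, E) ∞ M]
  [TopologicalSpace Z] [ChartedSpace F Z]

/-- A `b^k`-vector field: a smooth vector field `v` on `M` that is tangent to `Z` along `Z`, with
`L_v f ∈ I_Z^k` for every `f ∈ j_Z`. -/
def IsBkVectorField (B : BkManifold k E F M Z)
    (v : Cₛ^∞⟮𝓘(ℝ, E); E, (TangentSpace 𝓘(ℝ, E) : M → Type _)⟯) : Prop :=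
  (∀ z, v (B.incl z) ∈ (mfderiv 𝓘(ℝ, F) 𝓘(ℝ, E) B.incl z).range) ∧
    ∀ f : C^∞⟮𝓘(ℝ, E), M; ℝ⟯, Ideal.Quotient.mk _ f = B.jet →
      ∃ g ∈ (vanishingIdeal B.incl ^ k : Ideal C^∞⟮𝓘(ℝ, E), M; ℝ⟯),
        ∀ x, g x = mfderiv 𝓘(ℝ, E) 𝓘(ℝ, ℝ) f x (v x)

/-- The open set `M ∖ Z`. -/
def compl (B : BkManifold k E F M Z) : TopologicalSpace.Opens M :=
  ⟨(Set.range B.incl)ᶜ, B.isClosed_range.isOpen_compl⟩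

/-- The `b^k`-forms of degree `p`, that is, the smooth sections over `M` of the `p`-th exterior
power of the dual of the `b^k`-tangent bundle (the bundle whose sections are the `b^k`-vector
fields). Over the dense open set `M ∖ Z` the `b^k`-tangent bundle is the tangent bundle, so such a
section is an ordinary smooth form on `M ∖ Z`; and a form on `M ∖ Z` extends to a smooth section
over `M` exactly when its pairing with any `p` smooth sections of the `b^k`-tangent bundle,
i.e. with any `p` `b^k`-vector fields, extends to a smooth function on `M`. For `p = 0` these are
the smooth functions on `M`. -/
def bkForms (B : BkManifold k E F M Z) (p : ℕ) :
    Submodule ℝ (FormField E M p) where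
  carrier := {α | α ∈ smoothForms B.compl p ∧
    ∀ v : Fin p → Cₛ^∞⟮𝓘(ℝ, E); E, (TangentSpace 𝓘(ℝ, E) : M → Type _)⟯,
    (∀ j, B.IsBkVectorField (v j)) →
      ∃ g : C^∞⟮𝓘(ℝ, E), M; ℝ⟯, ∀ x ∈ B.compl, α x (fun j => v j x) = g x}
  zero_mem' := ⟨Submodule.zero_mem _, fun _ _ => ⟨0, fun _ _ => rfl⟩⟩
  add_mem' := fun {α η} hα hη => ⟨Submodule.add_mem _ hα.1 hη.1, fun v hv => by
    obtain ⟨g, hg⟩ := hα.2 v hv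
    obtain ⟨h, hh⟩ := hη.2 v hv
    refine ⟨g + h, fun x hx => ?_⟩
    change α x _ + η x _ = g x + h x
    rw [hg x hx, hh x hx]⟩
  smul_mem' := fun c {α} hα => ⟨Submodule.smul_mem _ c hα.1, fun v hv => by
    obtain ⟨g, hg⟩ := hα.2 v hv
    refine ⟨c • g, fun x hx => ?_⟩
    change c • α x _ = c • g x
    rw [hg x hx]⟩

/-- The `b^k`-cohomology: the cohomology of the complex of `b^k`-forms. The differential of a
`b^k`-form is the extension over `Z` of the exterior derivative of its restriction to `M ∖ Z`. -/
abbrev BkCohomology (B : BkManifold k E F M Z) (p : ℕ) : Type _ :=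
  Cohomology B.compl B.bkForms p

end BkManifold

end BkManifold

end BkGeometry

end

/-!
# Cohomology of `b^k`-forms

Let `y` be a defining function of `Z` in the class of the jet, and let `X` be a vector field on `M`
with `dy(X) = 1` near `Z` (`exists_collar`). The proof interpolates between the smooth forms on `M`
and the `b^k`-forms by the order of the pole.

For `j ≥ 0`, let `F_j` be the complex of the smooth forms `σ` on `M ∖ Z` such that `y^j σ` and
`dy ∧ σ` extend smoothly over `Z` (`Collar.filt`). Then

* `F_k` is the complex of `b^k`-forms (`Collar.filt_eq_bkForms`). A vector field `v` is a
  `b^k`-vector field if and only if the function `dy(v)` belongs to `I_Z^k`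
  (`Collar.isBkVectorField_iff`). So `y^k X` and the fields `u - dy(u) X` are `b^k`-vector fields,
  and a `b^k`-form may be evaluated on them; conversely, a form in `F_k` is near `Z` the sum of the
  smooth form `ι_X (dy ∧ σ)` and of `y^{-k} dy ∧ ι_X (y^k σ)`.
* `F_0` consists of the restrictions to `M ∖ Z` of the smooth forms on `M`, and `M ∖ Z` is dense,
  so `F_0` computes the cohomology of `M` (`nonempty_deRham_equiv_of_restrict`).
* `F_{j+1}` is the direct sum of `F_j` and of the polar forms, which near `Z` are
  `y^{-(j+1)} dy ∧ π^* α` with `α` a form on `Z` and `π` a retraction of a neighbourhood of `Z`.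
  Away from `Z` the form `y^{-(j+1)} dy` is the differential of a function of `y`. With a cutoff
  applied to this function, the polar forms are defined on all of `M ∖ Z` and anticommute with the
  exterior derivative (`Tube.polar`, `Tube.d_polar`). The form `α` is the residue of
  `σ`, the restriction to `Z` of `ι_X (y^{j+1} σ)`. If `σ` lies in `F_{j+1}` and `α` is its residue,
  then `y^{j+1} σ - dy ∧ π^* α` extends to a smooth form that vanishes on `Z`, hence is divisible
  by `y` (`Tube.exists_sub_polar_mem_filt`); a polar form in `F_j` has residue zero, which gives
  uniqueness (`Tube.eq_zero_of_polar_mem_filt`).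

The last point and linear algebra (`nonempty_cohomology_equiv_prod`) show that the step from `F_j`
to `F_{j+1}` adds a copy of `H^{p-1}(Z)` to the cohomology in degree `p`: the splitting exists on
the level of forms, where it is compatible with `d` on both summands. In degree `0` all the `F_j`
coincide (`Collar.filt_degree_zero`).

Two facts of analysis are needed. The retraction sends `x` to the endpoint at time `1` of the
integral curve of `-y(x) X`, along which `y` decreases at the constant rate `y(x)`
(`exists_smooth_retraction`). It depends smoothly on `x` because integral curves solve an equation
in a Banach space of curves to which the implicit function theorem applies (`exists_smooth_flow`).
Division by `y` is Hadamard's lemma (`exists_eq_mul_function`, `extendsAt_of_fnSmul`), in which the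
integral along a segment depends smoothly on its endpoint for the same reason: superposition
operators on spaces of continuous functions are smooth (`contDiff_superpose`).
-/

set_option linter.unusedSectionVars false

open scoped Manifold ContDiff

noncomputable section

namespace BkGeometry

open Filter Topology Set

/-! ### Exterior products with a covector -/

section LinearAlgebra
variable {E E' : Type*} [NormedAddCommGroup E] [NormedSpace ℝ E]
  [NormedAddCommGroup E'] [NormedSpace ℝ E'] {p : ℕ}

/-- The exterior product `θ ∧ α` of a covector `θ` and an alternating form `α`. -/
def wedge (θ : E →L[ℝ] ℝ) (α : E [⋀^Fin p]→L[ℝ] ℝ) : E [⋀^Fin (p + 1)]→L[ℝ] ℝ :=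
  .alternatizeUncurryFin (θ.smulRight α)

lemma wedge_apply (θ : E →L[ℝ] ℝ) (α : E [⋀^Fin p]→L[ℝ] ℝ) (v : Fin (p + 1) → E) :
    wedge θ α v = ∑ i : Fin (p + 1), (-1) ^ (i : ℕ) * (θ (v i) * α (i.removeNth v)) := by
  simp [wedge, ContinuousAlternatingMap.alternatizeUncurryFin_apply]

lemma wedge_add (θ : E →L[ℝ] ℝ) (α β : E [⋀^Fin p]→L[ℝ] ℝ) :
    wedge θ (α + β) = wedge θ α + wedge θ β := by
  ext v
  simp [wedge_apply, mul_add, Finset.sum_add_distrib]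

lemma wedge_smul (θ : E →L[ℝ] ℝ) (c : ℝ) (α : E [⋀^Fin p]→L[ℝ] ℝ) :
    wedge θ (c • α) = c • wedge θ α := by
  ext v
  simp only [wedge_apply, ContinuousAlternatingMap.smul_apply, smul_eq_mul, Finset.mul_sum]
  exact Finset.sum_congr rfl fun i _ => by ring

lemma smul_wedge (θ : E →L[ℝ] ℝ) (c : ℝ) (α : E [⋀^Fin p]→L[ℝ] ℝ) :
    wedge (c • θ) α = c • wedge θ α := by
  ext v
  simp only [wedge_apply, ContinuousAlternatingMap.smul_apply, smul_apply,
    smul_eq_mul, Finset.mul_sum]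
  exact Finset.sum_congr rfl fun i _ => by ring

lemma wedge_zero (θ : E →L[ℝ] ℝ) : wedge θ (0 : E [⋀^Fin p]→L[ℝ] ℝ) = 0 := by
  ext v; simp [wedge_apply]

lemma zero_wedge (α : E [⋀^Fin p]→L[ℝ] ℝ) : wedge 0 α = 0 := by
  ext v; simp [wedge_apply]

lemma wedge_wedge_self (θ : E →L[ℝ] ℝ) (α : E [⋀^Fin p]→L[ℝ] ℝ) :
    wedge θ (wedge θ α) = 0 := by
  have h := ContinuousAlternatingMap.alternatizeUncurryFin_alternatizeUncurryFinCLM_comp_of_symmetric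
    (𝕜 := ℝ) (f := θ.smulRight (θ.smulRight α)) (fun x y => by
      ext v; simp [mul_left_comm])
  rw [← h]
  unfold wedge
  congr 1
  ext x v
  simp [ContinuousAlternatingMap.alternatizeUncurryFin_apply, Finset.mul_sum]

lemma wedge_compContinuousLinearMap (θ : E →L[ℝ] ℝ) (α : E [⋀^Fin p]→L[ℝ] ℝ) (f : E' →L[ℝ] E) :
    (wedge θ α).compContinuousLinearMap f = wedge (θ ∘L f) (α.compContinuousLinearMap f) := by
  ext v
  simp only [ContinuousAlternatingMap.compContinuousLinearMap_apply, wedge_apply,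
    Function.comp_def, ContinuousLinearMap.comp_apply]
  rfl

/-- The contraction `ι_X` (here `curryLeft`) is an antiderivation: `ι_X (θ ∧ α) = θ(X) α - θ ∧ ι_X
α`. -/
lemma curryLeft_wedge (θ : E →L[ℝ] ℝ) (α : E [⋀^Fin (p + 1)]→L[ℝ] ℝ) (X : E) :
    (wedge θ α).curryLeft X = θ X • α - wedge θ (α.curryLeft X) := by
  ext v
  simp only [ContinuousAlternatingMap.curryLeft_apply_apply, wedge_apply,
    ContinuousAlternatingMap.sub_apply, ContinuousAlternatingMap.smul_apply, smul_eq_mul]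
  rw [Fin.sum_univ_succ, sub_eq_add_neg, ← Finset.sum_neg_distrib]
  congr 1
  · simp
  · refine Finset.sum_congr rfl fun i _ => ?_
    have : (i.succ.removeNth (Matrix.vecCons X v) : Fin (p + 1) → E)
        = Matrix.vecCons X (i.removeNth v) := by
      funext j
      refine Fin.cases ?_ (fun j => ?_) j
      · simp [Fin.removeNth]
      · simp [Fin.removeNth]
    rw [this]
    simp [pow_succ]

/-- The antiderivation rule for `ι_X` in degree zero, where `ι_X α` does not exist. -/
lemma curryLeft_wedge_of_degree_zero (θ : E →L[ℝ] ℝ) (α : E [⋀^Fin 0]→L[ℝ] ℝ) (X : E) :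
    (wedge θ α).curryLeft X = θ X • α := by
  ext v
  simp only [ContinuousAlternatingMap.curryLeft_apply_apply, wedge_apply,
    ContinuousAlternatingMap.smul_apply, smul_eq_mul]
  simp

/-- The projection onto the kernel of `θ` along `X` (when `θ X = 1`). -/
def kerProj (θ : E →L[ℝ] ℝ) (X : E) : E →L[ℝ] E := .id ℝ E - θ.smulRight X

lemma kerProj_apply (θ : E →L[ℝ] ℝ) (X v : E) : kerProj θ X v = v - θ v • X := rfl

lemma apply_kerProj {θ : E →L[ℝ] ℝ} {X : E} (h : θ X = 1) (v : E) : θ (kerProj θ X v) = 0 := by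
  simp [kerProj_apply, h]

/-- A form annihilated by contraction with `X` factors through the projection along `X`. -/
lemma compContinuousLinearMap_kerProj (θ : E →L[ℝ] ℝ) (X : E) (η : E [⋀^Fin p]→L[ℝ] ℝ)
    (h : ∀ (v : Fin p → E) (i : Fin p), v i = X → η v = 0) :
    η.compContinuousLinearMap (kerProj θ X) = η := by
  ext v
  have key : ∀ s : Finset (Fin p),
      η (s.piecewise (fun i => kerProj θ X (v i)) v) = η v := by
    intro s
    induction s using Finset.induction_on with
    | empty => simp
    | insert a s ha ih =>
      rw [Finset.piecewise_insert, kerProj_apply, sub_eq_add_neg, ← neg_smul, η.map_update_add,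
        η.map_update_smul, h (Function.update _ a X) a (by simp), smul_zero, add_zero, ← ih]
      congr 1
      have : v a = s.piecewise (fun i => kerProj θ X (v i)) v a := by simp [ha]
      rw [this, Function.update_eq_self]
  simpa [Function.comp_def] using key Finset.univ

/-- The splitting of a form into its parts without and with the covector `θ`. -/
lemma eq_kerProj_add_wedge {θ : E →L[ℝ] ℝ} {X : E} (h : θ X = 1) (σ : E [⋀^Fin (p + 1)]→L[ℝ] ℝ) :
    σ = σ.compContinuousLinearMap (kerProj θ X) +
      wedge θ ((σ.curryLeft X).compContinuousLinearMap (kerProj θ X)) := by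
  have hc : ∀ (v : Fin p → E) (i : Fin p), v i = X → σ.curryLeft X v = 0 := by
    intro v i hi
    rw [ContinuousAlternatingMap.curryLeft_apply_apply]
    refine σ.map_eq_zero_of_eq _ (i := 0) (j := i.succ) ?_ (Fin.succ_ne_zero i).symm
    simp [hi]
  rw [compContinuousLinearMap_kerProj θ X _ hc]
  have h1 : ((wedge θ σ).curryLeft X).compContinuousLinearMap (kerProj θ X) =
      (wedge θ σ).curryLeft X := by
    refine compContinuousLinearMap_kerProj θ X _ (fun v i hi => ?_)
    rw [ContinuousAlternatingMap.curryLeft_apply_apply]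
    refine (wedge θ σ).map_eq_zero_of_eq _ (i := 0) (j := i.succ) ?_ (Fin.succ_ne_zero i).symm
    simp [hi]
  have h2 : θ ∘L kerProj θ X = 0 := by
    ext v; exact apply_kerProj h v
  rw [curryLeft_wedge, h, one_smul] at h1
  have h3 : (σ - wedge θ (σ.curryLeft X)).compContinuousLinearMap (kerProj θ X) =
      σ.compContinuousLinearMap (kerProj θ X) - (wedge θ (σ.curryLeft X)).compContinuousLinearMap
        (kerProj θ X) := rfl
  rw [h3, wedge_compContinuousLinearMap, h2, zero_wedge, sub_zero] at h1
  rw [h1]; abel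

end LinearAlgebra

/-! ### Smooth forms on vector spaces -/

section Flat
variable {E E' : Type*} [NormedAddCommGroup E] [NormedSpace ℝ E]
  [NormedAddCommGroup E'] [NormedSpace ℝ E'] {p : ℕ} {n : ℕ∞ω}

lemma contDiffAt_form_apply {σ : E → E' [⋀^Fin p]→L[ℝ] ℝ} {v : Fin p → E → E'} {e : E}
    (hσ : ContDiffAt ℝ n σ e) (hv : ∀ i, ContDiffAt ℝ n (v i) e) :
    ContDiffAt ℝ n (fun e => σ e (fun i => v i e)) e := by
  let f := ContinuousAlternatingMap.toContinuousMultilinearMapCLM (𝕜 := ℝ) (E := E') (F := ℝ)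
    (ι := Fin p) ℝ
  have h1 : AnalyticAt ℝ (fun q : (E' [⋀^Fin p]→L[ℝ] ℝ) × (Fin p → E') => f q.1 q.2)
    (σ e, fun i => v i e) := f.analyticAt_uncurry_of_multilinear
  exact (h1.contDiffAt (n := n)).comp e (f := fun e => (σ e, fun i => v i e))
    (hσ.prodMk (contDiffAt_pi.2 hv))

/-- In finite dimension, forms embed linearly in functions through finitely many evaluations, with
a linear left inverse; smoothness can therefore be tested on evaluations. -/
lemma exists_leftInverse_eval [FiniteDimensional ℝ E'] (p : ℕ) :
    ∃ (ι : Type) (_ : Fintype ι) (v : ι → Fin p → E')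
      (L : (ι → ℝ) →L[ℝ] (E' [⋀^Fin p]→L[ℝ] ℝ)), ∀ α, L (fun i => α (v i)) = α := by
  let b := Module.finBasis ℝ E'
  let ι := Fin p → Fin (Module.finrank ℝ E')
  let v : ι → Fin p → E' := fun s j => b (s j)
  let T : (E' [⋀^Fin p]→L[ℝ] ℝ) →ₗ[ℝ] (ι → ℝ) :=
    { toFun := fun α s => α (v s)
      map_add' := fun _ _ => rfl
      map_smul' := fun _ _ => rfl }
  have hT : LinearMap.ker T = ⊥ := by
    rw [LinearMap.ker_eq_bot']
    intro α hα
    have : α.toAlternatingMap = 0 := by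
      refine Module.Basis.ext_alternating b fun s _ => ?_
      exact congrFun hα s
    ext w
    exact congrArg (fun β : E' [⋀^Fin p]→ₗ[ℝ] ℝ => β w) this
  obtain ⟨S, hS⟩ := T.exists_leftInverse_of_injective hT
  exact ⟨ι, inferInstance, v, LinearMap.toContinuousLinearMap S,
    fun α => LinearMap.congr_fun hS α⟩

/-- In finite dimension, smoothness of a form may be tested on its values on constant vectors. -/
lemma contDiffAt_form_iff [FiniteDimensional ℝ E'] {σ : E → E' [⋀^Fin p]→L[ℝ] ℝ} {e : E} :
    ContDiffAt ℝ n σ e ↔ ∀ v : Fin p → E', ContDiffAt ℝ n (fun e => σ e v) e := by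
  refine ⟨fun h v => contDiffAt_form_apply h fun _ => contDiffAt_const, fun h => ?_⟩
  obtain ⟨ι, _, v, L, hL⟩ := exists_leftInverse_eval (E' := E') p
  have h1 : ContDiffAt ℝ n (fun e => L (fun i => σ e (v i))) e :=
    L.contDiff.contDiffAt.comp e (contDiffAt_pi.2 fun i => h (v i))
  simpa only [hL] using h1

lemma contDiffAt_wedge [FiniteDimensional ℝ E'] {θ : E → E' →L[ℝ] ℝ} {σ : E → E' [⋀^Fin p]→L[ℝ] ℝ}
    {e : E} (hθ : ContDiffAt ℝ n θ e) (hσ : ContDiffAt ℝ n σ e) :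
    ContDiffAt ℝ n (fun e => wedge (θ e) (σ e)) e := by
  rw [contDiffAt_form_iff]
  intro v
  simp only [wedge_apply]
  refine ContDiffAt.sum fun i _ => contDiffAt_const.mul ((hθ.clm_apply contDiffAt_const).mul ?_)
  exact contDiffAt_form_apply hσ fun _ => contDiffAt_const

lemma contDiffAt_comp_clm [FiniteDimensional ℝ E'] {E'' : Type*} [NormedAddCommGroup E'']
    [NormedSpace ℝ E''] {σ : E → E'' [⋀^Fin p]→L[ℝ] ℝ} {A : E → E' →L[ℝ] E''}
    {e : E} (hσ : ContDiffAt ℝ n σ e) (hA : ContDiffAt ℝ n A e) :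
    ContDiffAt ℝ n (fun e => (σ e).compContinuousLinearMap (A e)) e := by
  rw [contDiffAt_form_iff]
  intro v
  exact contDiffAt_form_apply (v := fun i e => A e (v i)) hσ
    fun i => hA.clm_apply contDiffAt_const

/-- Leibniz rule: `d(fσ) = df ∧ σ + f dσ`. -/
lemma extDeriv_function_smul {f : E → ℝ} {σ : E → E [⋀^Fin p]→L[ℝ] ℝ} {e : E}
    (hf : DifferentiableAt ℝ f e) (hσ : DifferentiableAt ℝ σ e) :
    extDeriv (fun e => f e • σ e) e = wedge (fderiv ℝ f e) (σ e) + f e • extDeriv σ e := by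
  unfold extDeriv wedge
  rw [fderiv_fun_smul hf hσ, ContinuousAlternatingMap.alternatizeUncurryFin_add,
    ContinuousAlternatingMap.alternatizeUncurryFin_smul]
  exact add_comm _ _

lemma two_le_infty : minSmoothness ℝ 2 ≤ (∞ : ℕ∞ω) := by
  simp only [minSmoothness_of_isRCLikeNormedField]
  exact WithTop.coe_le_coe.2 (le_top : (2 : ℕ∞) ≤ ⊤)

lemma contDiffAt_extDeriv {σ : E → E [⋀^Fin p]→L[ℝ] ℝ} {e : E} (hσ : ContDiffAt ℝ ∞ σ e) :
    ContDiffAt ℝ ∞ (extDeriv σ) e := by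
  have h := (ContinuousAlternatingMap.alternatizeUncurryFinCLM (n := p) ℝ E ℝ).contDiff.contDiffAt
    |>.comp e (hσ.fderiv_right (m := ∞) (by simp))
  exact h.congr_of_eventuallyEq (Filter.Eventually.of_forall fun e =>
    (ContinuousAlternatingMap.alternatizeUncurryFinCLM_apply _).symm)

lemma eventually_differentiableAt {F : Type*} [NormedAddCommGroup F] [NormedSpace ℝ F]
    {f : E → F} {e : E} (hf : ContDiffAt ℝ ∞ f e) : ∀ᶠ e' in nhds e, DifferentiableAt ℝ f e' := by
  have h1 : ContDiffAt ℝ 1 f e := hf.of_le (by simp)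
  filter_upwards [h1.eventually (by simp)] with e' he'
  exact he'.differentiableAt (by simp)

/-- `d(df ∧ σ) = -df ∧ dσ`, since `df ∧ σ = d(fσ) - f dσ`. -/
lemma extDeriv_fderiv_wedge {f : E → ℝ} {σ : E → E [⋀^Fin p]→L[ℝ] ℝ} {e : E}
    (hf : ContDiffAt ℝ ∞ f e) (hσ : ContDiffAt ℝ ∞ σ e) :
    extDeriv (fun e => wedge (fderiv ℝ f e) (σ e)) e = -wedge (fderiv ℝ f e) (extDeriv σ e) := by
  have h1 : (fun e => wedge (fderiv ℝ f e) (σ e)) =ᶠ[nhds e]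
      (extDeriv (fun e => f e • σ e) + (-1 : ℝ) • fun e => f e • extDeriv σ e) := by
    filter_upwards [eventually_differentiableAt hf, eventually_differentiableAt hσ] with x hx hx'
    simp only [Pi.add_apply, Pi.smul_apply]
    rw [extDeriv_function_smul hx hx']
    simp
  have hd := contDiffAt_extDeriv hσ
  have hfσ : ContDiffAt ℝ ∞ (fun e => f e • σ e) e := hf.smul hσ
  have hfd : ContDiffAt ℝ ∞ (fun e => f e • extDeriv σ e) e := hf.smul hd
  rw [h1.extDeriv_eq, extDeriv_add ((contDiffAt_extDeriv hfσ).differentiableAt (by simp))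
    ((hfd.differentiableAt (by simp)).const_smul (-1 : ℝ)), extDeriv_smul,
    extDeriv_extDeriv_apply hfσ two_le_infty,
    extDeriv_function_smul (hf.differentiableAt (by simp)) (hd.differentiableAt (by simp)),
    extDeriv_extDeriv_apply hσ two_le_infty]
  simp
end Flat

/-! ### Smoothness and pullback of forms on manifolds -/

section ManifoldForms
variable {E M : Type*} [NormedAddCommGroup E] [NormedSpace ℝ E] [TopologicalSpace M]
  [ChartedSpace E M] {E' N : Type*} [NormedAddCommGroup E'] [NormedSpace ℝ E'] [TopologicalSpace N]
  [ChartedSpace E' N] {p : ℕ}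

/-- Smoothness of a field of forms at a point. -/
def SmoothAt (α : FormField E M p) (x : M) : Prop :=
  ContDiffAt ℝ ∞ (inChart α x) (extChartAt 𝓘(ℝ, E) x x)

/-- The pullback of a field of forms under a map. -/
def pullback (f : N → M) (α : FormField E M p) : FormField E' N p where
  toFun x := (α (f x)).compContinuousLinearMap (mfderiv 𝓘(ℝ, E') 𝓘(ℝ, E) f x)

lemma extDerivField_apply (α : FormField E M p) (x : M) : extDerivField α x =
    (extDeriv (inChart α x) (extChartAt 𝓘(ℝ, E) x x)).compContinuousLinearMap
      (mfderiv 𝓘(ℝ, E) 𝓘(ℝ, E) (extChartAt 𝓘(ℝ, E) x) x) := rfl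

lemma pullback_apply (f : N → M) (α : FormField E M p) (x : N) :
    (pullback f α : FormField E' N p) x =
      (α (f x)).compContinuousLinearMap (mfderiv 𝓘(ℝ, E') 𝓘(ℝ, E) f x) := rfl

lemma pullback_id (α : FormField E M p) : pullback id α = α := by
  ext1; funext x
  rw [pullback_apply, mfderiv_id]
  ext v
  rfl

lemma pullback_add (f : N → M) (α β : FormField E M p) :
    (pullback f (α + β) : FormField E' N p) = pullback f α + pullback f β := rfl

lemma pullback_smul (f : N → M) (c : ℝ) (α : FormField E M p) :
    (pullback f (c • α) : FormField E' N p) = c • pullback f α := rfl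

section
variable [IsManifold 𝓘(ℝ, E) ∞ M]

lemma mdifferentiableAt_chart {x0 x : M} (hx : x ∈ (extChartAt 𝓘(ℝ, E) x0).source) :
    MDifferentiableAt 𝓘(ℝ, E) 𝓘(ℝ, E) (extChartAt 𝓘(ℝ, E) x0) x := by
  have : IsManifold 𝓘(ℝ, E) 1 M := .of_le (n := ∞) (by simp)
  exact mdifferentiableAt_extChartAt (by simpa using hx)

lemma contMDiffAt_chart {x0 x : M} (hx : x ∈ (extChartAt 𝓘(ℝ, E) x0).source) :
    ContMDiffAt 𝓘(ℝ, E) 𝓘(ℝ, E) ∞ (extChartAt 𝓘(ℝ, E) x0) x :=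
  contMDiffAt_extChartAt' (by simpa using hx)

lemma contMDiffAt_chart_symm {x0 : M} {e : E} (he : e ∈ (extChartAt 𝓘(ℝ, E) x0).target) :
    ContMDiffAt 𝓘(ℝ, E) 𝓘(ℝ, E) ∞ (extChartAt 𝓘(ℝ, E) x0).symm e :=
  (contMDiffOn_extChartAt_symm x0).contMDiffAt ((isOpen_extChartAt_target x0).mem_nhds he)

lemma mdifferentiableAt_chart_symm {x0 : M} {e : E} (he : e ∈ (extChartAt 𝓘(ℝ, E) x0).target) :
    MDifferentiableAt 𝓘(ℝ, E) 𝓘(ℝ, E) (extChartAt 𝓘(ℝ, E) x0).symm e :=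
  (contMDiffAt_chart_symm he).mdifferentiableAt (by simp)

lemma mfderiv_chart_comp_symm {x0 : M} {e : E} (he : e ∈ (extChartAt 𝓘(ℝ, E) x0).target) (v : E) :
    (mfderiv 𝓘(ℝ, E) 𝓘(ℝ, E) (extChartAt 𝓘(ℝ, E) x0) ((extChartAt 𝓘(ℝ, E) x0).symm e) : E →L[ℝ] E)
      ((mfderiv 𝓘(ℝ, E) 𝓘(ℝ, E) (extChartAt 𝓘(ℝ, E) x0).symm e : E →L[ℝ] E) v) = v := by
  have h := mfderiv_comp e (mdifferentiableAt_chart ((extChartAt 𝓘(ℝ, E) x0).map_target he))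
    (mdifferentiableAt_chart_symm he)
  have h2 : (extChartAt 𝓘(ℝ, E) x0) ∘ (extChartAt 𝓘(ℝ, E) x0).symm =ᶠ[𝓝 e] id := by
    filter_upwards [(isOpen_extChartAt_target x0).mem_nhds he] with e' he'
    exact (extChartAt 𝓘(ℝ, E) x0).right_inv he'
  rw [h2.mfderiv_eq, mfderiv_id] at h
  exact (DFunLike.congr_fun h v).symm

lemma mfderiv_symm_comp_chart {x0 x : M} (hx : x ∈ (extChartAt 𝓘(ℝ, E) x0).source) (v : E) :
    (mfderiv 𝓘(ℝ, E) 𝓘(ℝ, E) (extChartAt 𝓘(ℝ, E) x0).symm (extChartAt 𝓘(ℝ, E) x0 x) : E →L[ℝ] E)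
      ((mfderiv 𝓘(ℝ, E) 𝓘(ℝ, E) (extChartAt 𝓘(ℝ, E) x0) x : E →L[ℝ] E) v) = v := by
  have h := mfderiv_comp x (mdifferentiableAt_chart_symm ((extChartAt 𝓘(ℝ, E) x0).map_source hx))
    (mdifferentiableAt_chart hx)
  have h2 : (extChartAt 𝓘(ℝ, E) x0).symm ∘ (extChartAt 𝓘(ℝ, E) x0) =ᶠ[𝓝 x] id := by
    filter_upwards [(isOpen_extChartAt_source x0).mem_nhds hx] with e' he'
    exact (extChartAt 𝓘(ℝ, E) x0).left_inv he'
  rw [h2.mfderiv_eq, mfderiv_id] at h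
  exact (DFunLike.congr_fun h v).symm

end

section Transition
variable [IsManifold 𝓘(ℝ, E) ∞ M] [IsManifold 𝓘(ℝ, E') ∞ N]

lemma contMDiffAt_inCharts {f : N → M} {x0 : N} {y0 : M} {e : E'}
    (he : e ∈ (extChartAt 𝓘(ℝ, E') x0).target)
    (hf : ContMDiffAt 𝓘(ℝ, E') 𝓘(ℝ, E) ∞ f ((extChartAt 𝓘(ℝ, E') x0).symm e))
    (hfe : f ((extChartAt 𝓘(ℝ, E') x0).symm e) ∈ (extChartAt 𝓘(ℝ, E) y0).source) :
    ContDiffAt ℝ ∞ (fun e => extChartAt 𝓘(ℝ, E) y0 (f ((extChartAt 𝓘(ℝ, E') x0).symm e))) e := by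
  rw [← contMDiffAt_iff_contDiffAt]
  exact (contMDiffAt_chart hfe).comp e (hf.comp e (contMDiffAt_chart_symm he))

/-- In charts, the pullback of a field of forms is given by the expression of the map. -/
lemma inChart_pullback {f : N → M} (α : FormField E M p) {x0 : N} {y0 : M} {e : E'}
    (he : e ∈ (extChartAt 𝓘(ℝ, E') x0).target)
    (hf : MDifferentiableAt 𝓘(ℝ, E') 𝓘(ℝ, E) f ((extChartAt 𝓘(ℝ, E') x0).symm e))
    (hfe : f ((extChartAt 𝓘(ℝ, E') x0).symm e) ∈ (extChartAt 𝓘(ℝ, E) y0).source) :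
    inChart (pullback f α : FormField E' N p) x0 e =
      (inChart α y0
        (extChartAt 𝓘(ℝ, E) y0 (f ((extChartAt 𝓘(ℝ, E') x0).symm e)))).compContinuousLinearMap
        (fderiv ℝ (fun e => extChartAt 𝓘(ℝ, E) y0 (f ((extChartAt 𝓘(ℝ, E') x0).symm e))) e) := by
  have h1 := mfderiv_comp e (hf) (mdifferentiableAt_chart_symm he)
  have h2 := mfderiv_comp (I := 𝓘(ℝ, E')) (I' := 𝓘(ℝ, E)) (I'' := 𝓘(ℝ, E)) e
    (g := extChartAt 𝓘(ℝ, E) y0) (f := f ∘ (extChartAt 𝓘(ℝ, E') x0).symm)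
    (mdifferentiableAt_chart hfe) (hf.comp e (mdifferentiableAt_chart_symm he))
  have h3 : fderiv ℝ (fun e => extChartAt 𝓘(ℝ, E) y0 (f ((extChartAt 𝓘(ℝ, E') x0).symm e))) e =
    mfderiv 𝓘(ℝ, E') 𝓘(ℝ, E) (extChartAt 𝓘(ℝ, E) y0 ∘ (f ∘ (extChartAt 𝓘(ℝ, E') x0).symm)) e :=
    mfderiv_eq_fderiv.symm
  rw [h3, h2]
  have h4 := mfderiv_symm_comp_chart hfe
  have h5 := (extChartAt 𝓘(ℝ, E) y0).left_inv hfe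
  simp only [inChart, pullback_apply]
  rw [h5]
  ext v
  refine congrArg (α (f ((extChartAt 𝓘(ℝ, E') x0).symm e))) (funext fun i => ?_)
  refine Eq.trans ?_ (h4 _).symm
  exact (DFunLike.congr_fun h1 (v i)).symm

lemma eventually_mem_chart_target {x x0 : M} (hx : x ∈ (extChartAt 𝓘(ℝ, E) x0).source)
    {P : M → Prop} (hP : ∀ᶠ y in 𝓝 x, P y) :
    ∀ᶠ e in 𝓝 (extChartAt 𝓘(ℝ, E) x0 x), e ∈ (extChartAt 𝓘(ℝ, E) x0).target ∧
      P ((extChartAt 𝓘(ℝ, E) x0).symm e) := by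
  have h := continuousAt_extChartAt_symm' (I := 𝓘(ℝ, E)) hx
  rw [ContinuousAt, (extChartAt 𝓘(ℝ, E) x0).left_inv hx] at h
  filter_upwards [(isOpen_extChartAt_target x0).mem_nhds ((extChartAt 𝓘(ℝ, E) x0).map_source hx),
    h.eventually hP] with e he he'
  exact ⟨he, he'⟩

lemma eventually_mdifferentiableAt {F : Type*} [NormedAddCommGroup F] [NormedSpace ℝ F]
    {P : Type*} [TopologicalSpace P] [ChartedSpace F P] [IsManifold 𝓘(ℝ, F) ∞ P] {f : N → P} {x : N}
    (hf : ContMDiffAt 𝓘(ℝ, E') 𝓘(ℝ, F) ∞ f x) :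
    ∀ᶠ y in 𝓝 x, MDifferentiableAt 𝓘(ℝ, E') 𝓘(ℝ, F) f y := by
  have : IsManifold 𝓘(ℝ, E') 1 N := .of_le (n := ∞) (by simp)
  have : IsManifold 𝓘(ℝ, F) 1 P := .of_le (n := ∞) (by simp)
  have h1 : ContMDiffAt 𝓘(ℝ, E') 𝓘(ℝ, F) 1 f x := hf.of_le (by simp)
  have h2 := (contMDiffAt_iff_contMDiffAt_nhds (by simp)).1 h1
  filter_upwards [h2] with y hy
  exact hy.mdifferentiableAt (by simp)

lemma eventually_inChart_pullback {f : N → M} (α : FormField E M p) {x x0 : N} {y0 : M}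
    (hx : x ∈ (extChartAt 𝓘(ℝ, E') x0).source)
    (hf : ContMDiffAt 𝓘(ℝ, E') 𝓘(ℝ, E) ∞ f x)
    (hfx : f x ∈ (extChartAt 𝓘(ℝ, E) y0).source) :
    inChart (pullback f α : FormField E' N p) x0 =ᶠ[𝓝 (extChartAt 𝓘(ℝ, E') x0 x)] fun e =>
      (inChart α y0
        (extChartAt 𝓘(ℝ, E) y0 (f ((extChartAt 𝓘(ℝ, E') x0).symm e)))).compContinuousLinearMap
        (fderiv ℝ (fun e => extChartAt 𝓘(ℝ, E) y0 (f ((extChartAt 𝓘(ℝ, E') x0).symm e))) e) := by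
  filter_upwards [eventually_mem_chart_target hx ((eventually_mdifferentiableAt hf).and
    (hf.continuousAt.preimage_mem_nhds (extChartAt_source_mem_nhds' hfx)))] with e he
  exact inChart_pullback α he.1 he.2.1 he.2.2

/-- Smoothness of a pullback, in any pair of charts. With `f = id` this expresses that smoothness of
a form does not depend on the chart. -/
lemma contDiffAt_inChart_pullback [FiniteDimensional ℝ E'] {f : N → M} {α : FormField E M p}
    {x x0 : N} {y0 : M} (hx : x ∈ (extChartAt 𝓘(ℝ, E') x0).source)
    (hf : ContMDiffAt 𝓘(ℝ, E') 𝓘(ℝ, E) ∞ f x)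
    (hfx : f x ∈ (extChartAt 𝓘(ℝ, E) y0).source)
    (hα : ContDiffAt ℝ ∞ (inChart α y0) (extChartAt 𝓘(ℝ, E) y0 (f x))) :
    ContDiffAt ℝ ∞ (inChart (pullback f α : FormField E' N p) x0) (extChartAt 𝓘(ℝ, E') x0 x) := by
  refine ContDiffAt.congr_of_eventuallyEq ?_ (eventually_inChart_pullback α hx hf hfx)
  have hl := (extChartAt 𝓘(ℝ, E') x0).left_inv hx
  have hτ := contMDiffAt_inCharts (f := f) (y0 := y0) ((extChartAt 𝓘(ℝ, E') x0).map_source hx)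
    (by rwa [hl]) (by rwa [hl])
  refine contDiffAt_comp_clm ?_ (hτ.fderiv_right (by simp))
  exact ContDiffAt.comp (g := inChart α y0) _ (by rwa [hl]) hτ

end Transition

section Smooth
variable [IsManifold 𝓘(ℝ, E) ∞ M] [IsManifold 𝓘(ℝ, E') ∞ N] [FiniteDimensional ℝ E]
  [FiniteDimensional ℝ E']

/-- Smoothness of a field of forms may be tested in any chart. -/
lemma smoothAt_iff {α : FormField E M p} {x x0 : M} (hx : x ∈ (extChartAt 𝓘(ℝ, E) x0).source) :
    SmoothAt α x ↔ ContDiffAt ℝ ∞ (inChart α x0) (extChartAt 𝓘(ℝ, E) x0 x) := by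
  constructor
  · intro h
    have := contDiffAt_inChart_pullback (f := id) (α := α) hx contMDiffAt_id
      (mem_extChartAt_source x) h
    rwa [pullback_id] at this
  · intro h
    have := contDiffAt_inChart_pullback (f := id) (α := α) (mem_extChartAt_source (I := 𝓘(ℝ, E)) x)
      contMDiffAt_id hx h
    rwa [pullback_id] at this

lemma SmoothAt.pullback {f : N → M} {α : FormField E M p} {x : N}
    (hf : ContMDiffAt 𝓘(ℝ, E') 𝓘(ℝ, E) ∞ f x) (hα : SmoothAt α (f x)) :
    SmoothAt (pullback f α : FormField E' N p) x :=
  contDiffAt_inChart_pullback (mem_extChartAt_source x) hf (mem_extChartAt_source (f x)) hα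

/-- The exterior derivative of a pullback, with `dα` computed in an arbitrary chart at `y0`. With `f
= id` this expresses that the exterior derivative does not depend on the chart. -/
lemma extDerivField_pullback_aux {f : N → M} {α : FormField E M p} {x : N} {y0 : M}
    (hf : ContMDiffAt 𝓘(ℝ, E') 𝓘(ℝ, E) ∞ f x)
    (hfx : f x ∈ (extChartAt 𝓘(ℝ, E) y0).source) (hα : SmoothAt α (f x)) :
    extDerivField (pullback f α : FormField E' N p) x =
      ((extDeriv (inChart α y0) (extChartAt 𝓘(ℝ, E) y0 (f x))).compContinuousLinearMap
        (mfderiv 𝓘(ℝ, E) 𝓘(ℝ, E) (extChartAt 𝓘(ℝ, E) y0) (f x) : E →L[ℝ] E)).compContinuousLinearMap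
        (mfderiv 𝓘(ℝ, E') 𝓘(ℝ, E) f x) := by
  have hx := mem_extChartAt_source (I := 𝓘(ℝ, E')) x
  have hl := (extChartAt 𝓘(ℝ, E') x).left_inv hx
  have ht := (extChartAt 𝓘(ℝ, E') x).map_source hx
  have hτ := contMDiffAt_inCharts (f := f) (y0 := y0) ht (by rwa [hl]) (by rwa [hl])
  have hd : DifferentiableAt ℝ (inChart α y0)
      (extChartAt 𝓘(ℝ, E) y0 (f ((extChartAt 𝓘(ℝ, E') x).symm (extChartAt 𝓘(ℝ, E') x x)))) := by
    rw [hl]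
    exact ((smoothAt_iff hfx).1 hα).differentiableAt (by simp)
  have h1 := (eventually_inChart_pullback α hx hf hfx).extDeriv_eq
  rw [extDeriv_pullback (f := fun e => extChartAt 𝓘(ℝ, E) y0
    (f ((extChartAt 𝓘(ℝ, E') x).symm e))) hd hτ two_le_infty, hl] at h1
  have h2 := mfderiv_comp (I := 𝓘(ℝ, E')) (I' := 𝓘(ℝ, E')) (I'' := 𝓘(ℝ, E)) x
    (g := fun e => extChartAt 𝓘(ℝ, E) y0 (f ((extChartAt 𝓘(ℝ, E') x).symm e)))
    (f := extChartAt 𝓘(ℝ, E') x)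
    ((contMDiffAt_iff_contDiffAt.2 hτ).mdifferentiableAt (by simp)) (mdifferentiableAt_chart hx)
  have h3 := mfderiv_comp x (mdifferentiableAt_chart hfx) (hf.mdifferentiableAt (by simp))
  have h4 : ((fun e => extChartAt 𝓘(ℝ, E) y0 (f ((extChartAt 𝓘(ℝ, E') x).symm e))) ∘
      extChartAt 𝓘(ℝ, E') x) =ᶠ[𝓝 x] extChartAt 𝓘(ℝ, E) y0 ∘ f := by
    filter_upwards [extChartAt_source_mem_nhds (I := 𝓘(ℝ, E')) x] with x' hx'
    simp only [Function.comp_def]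
    rw [(extChartAt 𝓘(ℝ, E') x).left_inv hx']
  rw [h4.mfderiv_eq, h3, mfderiv_eq_fderiv] at h2
  rw [extDerivField_apply, h1]
  ext v
  refine congrArg (extDeriv (inChart α y0) (extChartAt 𝓘(ℝ, E) y0 (f x))) (funext fun i => ?_)
  exact (DFunLike.congr_fun h2 (v i)).symm

/-- The exterior derivative commutes with pullbacks. -/
lemma extDerivField_pullback {f : N → M} {α : FormField E M p} {x : N}
    (hf : ContMDiffAt 𝓘(ℝ, E') 𝓘(ℝ, E) ∞ f x) (hα : SmoothAt α (f x)) :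
    extDerivField (pullback f α : FormField E' N p) x = pullback f (extDerivField α) x :=
  extDerivField_pullback_aux hf (mem_extChartAt_source (f x)) hα

lemma extDerivField_eq_inChart {α : FormField E M p} {x x0 : M}
    (hx : x ∈ (extChartAt 𝓘(ℝ, E) x0).source) (hα : SmoothAt α x) :
    extDerivField α x = (extDeriv (inChart α x0) (extChartAt 𝓘(ℝ, E) x0 x)).compContinuousLinearMap
      (mfderiv 𝓘(ℝ, E) 𝓘(ℝ, E) (extChartAt 𝓘(ℝ, E) x0) x) := by
  have h := extDerivField_pullback_aux (f := id) contMDiffAt_id hx hα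
  rw [pullback_id, mfderiv_id] at h
  exact h

lemma inChart_extDerivField {α : FormField E M p} {x0 : M} {e : E}
    (he : e ∈ (extChartAt 𝓘(ℝ, E) x0).target)
    (hα : SmoothAt α ((extChartAt 𝓘(ℝ, E) x0).symm e)) :
    inChart (extDerivField α) x0 e = extDeriv (inChart α x0) e := by
  unfold inChart
  rw [extDerivField_eq_inChart ((extChartAt 𝓘(ℝ, E) x0).map_target he) hα]
  have h := mfderiv_chart_comp_symm he
  rw [(extChartAt 𝓘(ℝ, E) x0).right_inv he]
  ext v
  exact congrArg (extDeriv (inChart α x0) e) (funext fun i => h (v i))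

lemma eventually_inChart_extDerivField {α : FormField E M p} {x : M}
    (hα : ∀ᶠ y in 𝓝 x, SmoothAt α y) :
    inChart (extDerivField α) x =ᶠ[𝓝 (extChartAt 𝓘(ℝ, E) x x)] extDeriv (inChart α x) := by
  filter_upwards [eventually_mem_chart_target (mem_extChartAt_source x) hα] with e he
  exact inChart_extDerivField he.1 he.2

lemma SmoothAt.extDerivField {α : FormField E M p} {x : M} (hα : ∀ᶠ y in 𝓝 x, SmoothAt α y) :
    SmoothAt (extDerivField α) x :=
  (contDiffAt_extDeriv hα.self_of_nhds).congr_of_eventuallyEq (eventually_inChart_extDerivField hα)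

end Smooth
end ManifoldForms

/-! ### Products, exterior products and contractions of fields of forms -/

section Operations
variable {E M : Type*} [NormedAddCommGroup E] [NormedSpace ℝ E] [TopologicalSpace M]
  [ChartedSpace E M] {p : ℕ}

/-- The product of a function and a field of forms. -/
def fnSmul (f : M → ℝ) (α : FormField E M p) : FormField E M p where
  toFun x := f x • α x

variable (E) in
/-- The differential of a function at a point, as a covector. -/
def diffAt (f : M → ℝ) (x : M) : E →L[ℝ] ℝ := mfderiv 𝓘(ℝ, E) 𝓘(ℝ, ℝ) f x

/-- The exterior product `df ∧ α`. -/
def dWedge (f : M → ℝ) (α : FormField E M p) : FormField E M (p + 1) where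
  toFun x := wedge (diffAt E f x) (α x)

/-- The contraction of a field of forms with a vector field. -/
def contract (X : M → E) (α : FormField E M (p + 1)) : FormField E M p where
  toFun x := (α x).curryLeft (X x)

lemma fnSmul_apply (f : M → ℝ) (α : FormField E M p) (x : M) : fnSmul f α x = f x • α x := rfl

lemma dWedge_apply (f : M → ℝ) (α : FormField E M p) (x : M) :
    dWedge f α x = wedge (diffAt E f x) (α x) := rfl

lemma contract_apply (X : M → E) (α : FormField E M (p + 1)) (x : M) :
    contract X α x = (α x).curryLeft (X x) := rfl

lemma dWedge_add (f : M → ℝ) (α β : FormField E M p) :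
    dWedge f (α + β) = dWedge f α + dWedge f β := by
  ext1; funext x
  exact wedge_add _ _ _

lemma dWedge_smul (f : M → ℝ) (c : ℝ) (α : FormField E M p) :
    dWedge f (c • α) = c • dWedge f α := by
  ext1; funext x
  exact wedge_smul _ _ _

lemma fnSmul_add (f : M → ℝ) (α β : FormField E M p) :
    fnSmul f (α + β) = fnSmul f α + fnSmul f β := by
  ext1; funext x
  exact smul_add (f x) (α x) (β x)

lemma fnSmul_smul (f : M → ℝ) (c : ℝ) (α : FormField E M p) :
    fnSmul f (c • α) = c • fnSmul f α := by
  ext1; funext x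
  exact smul_comm (f x) c (α x)

lemma dWedge_of_eventually_zero {f : M → ℝ} {x : M} (hf : ∀ᶠ x' in 𝓝 x, f x' = 0)
    (α : FormField E M p) : dWedge f α x = 0 := by
  have h : diffAt E f x = 0 := by
    have h2 : f =ᶠ[𝓝 x] fun _ => 0 := hf
    exact h2.mfderiv_eq.trans mfderiv_const
  rw [dWedge_apply, h, zero_wedge]

/-- The derivative of the preferred chart at `x0`, as an endomorphism of the model space. -/
def chartDeriv (x0 x : M) : E →L[ℝ] E := mfderiv 𝓘(ℝ, E) 𝓘(ℝ, E) (extChartAt 𝓘(ℝ, E) x0) x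

/-- The derivative of the inverse of the preferred chart at `x0`, as an endomorphism of the model
space. -/
def symmDeriv (x0 : M) (e : E) : E →L[ℝ] E :=
  mfderiv 𝓘(ℝ, E) 𝓘(ℝ, E) (extChartAt 𝓘(ℝ, E) x0).symm e

/-- The expression of a vector field in a chart. -/
def vecInChart (X : M → E) (x0 : M) (e : E) : E :=
  chartDeriv x0 ((extChartAt 𝓘(ℝ, E) x0).symm e) (X ((extChartAt 𝓘(ℝ, E) x0).symm e))

variable [IsManifold 𝓘(ℝ, E) ∞ M]

lemma contDiffAt_fnInChart {F : Type*} [NormedAddCommGroup F] [NormedSpace ℝ F]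
    {f : M → F} {x x0 : M} (hx : x ∈ (extChartAt 𝓘(ℝ, E) x0).source)
    (hf : ContMDiffAt 𝓘(ℝ, E) 𝓘(ℝ, F) ∞ f x) :
    ContDiffAt ℝ ∞ (fun e => f ((extChartAt 𝓘(ℝ, E) x0).symm e)) (extChartAt 𝓘(ℝ, E) x0 x) := by
  rw [← contMDiffAt_iff_contDiffAt]
  refine ContMDiffAt.comp (g := f) _ ?_
    (contMDiffAt_chart_symm ((extChartAt 𝓘(ℝ, E) x0).map_source hx))
  rwa [(extChartAt 𝓘(ℝ, E) x0).left_inv hx]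

lemma contMDiffAt_of_fnInChart {F : Type*} [NormedAddCommGroup F] [NormedSpace ℝ F]
    {f : M → F} {x x0 : M} (hx : x ∈ (extChartAt 𝓘(ℝ, E) x0).source)
    (hf : ContDiffAt ℝ ∞ (fun e => f ((extChartAt 𝓘(ℝ, E) x0).symm e)) (extChartAt 𝓘(ℝ, E) x0 x)) :
    ContMDiffAt 𝓘(ℝ, E) 𝓘(ℝ, F) ∞ f x := by
  refine ((contMDiffAt_iff_contDiffAt.2 hf).comp x (contMDiffAt_chart hx)).congr_of_eventuallyEq ?_
  filter_upwards [extChartAt_source_mem_nhds' hx] with y hy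
  simp only [Function.comp_def]
  rw [(extChartAt 𝓘(ℝ, E) x0).left_inv hy]

lemma diffAt_comp_chart_symm {f : M → ℝ} {x0 : M} {e : E}
    (he : e ∈ (extChartAt 𝓘(ℝ, E) x0).target)
    (hf : MDifferentiableAt 𝓘(ℝ, E) 𝓘(ℝ, ℝ) f ((extChartAt 𝓘(ℝ, E) x0).symm e)) :
    diffAt E f ((extChartAt 𝓘(ℝ, E) x0).symm e) ∘L symmDeriv x0 e =
      fderiv ℝ (fun e => f ((extChartAt 𝓘(ℝ, E) x0).symm e)) e := by
  have h1 := mfderiv_comp (I'' := 𝓘(ℝ, ℝ)) e (g := f) hf (mdifferentiableAt_chart_symm he)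
  rw [mfderiv_eq_fderiv] at h1
  exact h1.symm

lemma inChart_dWedge {f : M → ℝ} (α : FormField E M p) {x0 : M} {e : E}
    (he : e ∈ (extChartAt 𝓘(ℝ, E) x0).target)
    (hf : MDifferentiableAt 𝓘(ℝ, E) 𝓘(ℝ, ℝ) f ((extChartAt 𝓘(ℝ, E) x0).symm e)) :
    inChart (dWedge f α) x0 e =
      wedge (fderiv ℝ (fun e => f ((extChartAt 𝓘(ℝ, E) x0).symm e)) e) (inChart α x0 e) := by
  rw [← diffAt_comp_chart_symm he hf]
  exact wedge_compContinuousLinearMap _ _ _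

lemma eventually_inChart_dWedge {f : M → ℝ} (α : FormField E M p) {x : M}
    (hf : ContMDiffAt 𝓘(ℝ, E) 𝓘(ℝ, ℝ) ∞ f x) :
    inChart (dWedge f α) x =ᶠ[𝓝 (extChartAt 𝓘(ℝ, E) x x)] fun e =>
      wedge (fderiv ℝ (fun e => f ((extChartAt 𝓘(ℝ, E) x).symm e)) e) (inChart α x e) := by
  filter_upwards [eventually_mem_chart_target (mem_extChartAt_source x)
    (eventually_mdifferentiableAt hf)] with e he
  exact inChart_dWedge α he.1 he.2

lemma inChart_contract (X : M → E) (α : FormField E M (p + 1)) {x0 : M} {e : E}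
    (he : e ∈ (extChartAt 𝓘(ℝ, E) x0).target) :
    inChart (contract X α) x0 e = (inChart α x0 e).curryLeft (vecInChart X x0 e) := by
  have h := mfderiv_symm_comp_chart ((extChartAt 𝓘(ℝ, E) x0).map_target he)
    (X ((extChartAt 𝓘(ℝ, E) x0).symm e))
  rw [(extChartAt 𝓘(ℝ, E) x0).right_inv he] at h
  ext v
  refine congrArg (α ((extChartAt 𝓘(ℝ, E) x0).symm e)) (funext fun i => ?_)
  refine Fin.cases ?_ (fun j => rfl) i
  exact h.symm

lemma inChart_congr {α β : FormField E M p} {x x0 : M} (hx : x ∈ (extChartAt 𝓘(ℝ, E) x0).source)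
    (h : ∀ᶠ y in 𝓝 x, α y = β y) :
    inChart α x0 =ᶠ[𝓝 (extChartAt 𝓘(ℝ, E) x0 x)] inChart β x0 := by
  filter_upwards [eventually_mem_chart_target hx h] with e he
  simp only [inChart]
  rw [he.2]

lemma SmoothAt.congr {α β : FormField E M p} {x : M} (hα : SmoothAt α x)
    (h : ∀ᶠ y in 𝓝 x, α y = β y) : SmoothAt β x :=
  ContDiffAt.congr_of_eventuallyEq hα (inChart_congr (mem_extChartAt_source x) h).symm

lemma extDerivField_congr {α β : FormField E M p} {x : M} (h : ∀ᶠ y in 𝓝 x, α y = β y) :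
    extDerivField α x = extDerivField β x := by
  rw [extDerivField_apply, extDerivField_apply,
    (inChart_congr (mem_extChartAt_source x) h).extDeriv_eq]

lemma smoothAt_zero (x : M) : SmoothAt (0 : FormField E M p) x :=
  contDiffAt_const (c := (0 : E [⋀^Fin p]→L[ℝ] ℝ))

lemma SmoothAt.add {α β : FormField E M p} {x : M} (hα : SmoothAt α x) (hβ : SmoothAt β x) :
    SmoothAt (α + β) x := ContDiffAt.add hα hβ

lemma SmoothAt.smul {α : FormField E M p} {x : M} (c : ℝ) (hα : SmoothAt α x) :
    SmoothAt (c • α) x :=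
  (contDiffAt_const (c := c)).smul (g := inChart α x) hα

lemma SmoothAt.sub {α β : FormField E M p} {x : M} (hα : SmoothAt α x) (hβ : SmoothAt β x) :
    SmoothAt (α - β) x := ContDiffAt.sub hα hβ

lemma extDerivField_smul {α : FormField E M p} {x : M} (c : ℝ) :
    extDerivField (c • α) x = c • extDerivField α x := by
  rw [extDerivField_apply, inChart_smul, extDeriv_smul]
  rfl

lemma SmoothAt.fnSmul {f : M → ℝ} {α : FormField E M p} {x : M}
    (hf : ContMDiffAt 𝓘(ℝ, E) 𝓘(ℝ, ℝ) ∞ f x) (hα : SmoothAt α x) : SmoothAt (fnSmul f α) x :=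
  (contDiffAt_fnInChart (mem_extChartAt_source x) hf).smul hα

lemma SmoothAt.dWedge [FiniteDimensional ℝ E] {f : M → ℝ} {α : FormField E M p} {x : M}
    (hf : ContMDiffAt 𝓘(ℝ, E) 𝓘(ℝ, ℝ) ∞ f x) (hα : SmoothAt α x) : SmoothAt (dWedge f α) x := by
  refine ContDiffAt.congr_of_eventuallyEq ?_ (eventually_inChart_dWedge α hf)
  exact contDiffAt_wedge
    ((contDiffAt_fnInChart (mem_extChartAt_source x) hf).fderiv_right (by simp)) hα

/-- Leibniz rule: `d(fα) = df ∧ α + f dα`. -/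
lemma extDerivField_fnSmul {f : M → ℝ} {α : FormField E M p} {x : M}
    (hf : ContMDiffAt 𝓘(ℝ, E) 𝓘(ℝ, ℝ) ∞ f x) (hα : SmoothAt α x) :
    extDerivField (fnSmul f α) x = dWedge f α x + f x • extDerivField α x := by
  have hs := mem_extChartAt_source (I := 𝓘(ℝ, E)) x
  have h1 : extDeriv (inChart (BkGeometry.fnSmul f α) x) (extChartAt 𝓘(ℝ, E) x x) = _ :=
    extDeriv_function_smul (f := fun e => f ((extChartAt 𝓘(ℝ, E) x).symm e))
    ((contDiffAt_fnInChart hs hf).differentiableAt (by simp)) (hα.differentiableAt (by simp))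
  have h2 := inChart_dWedge (f := f) α (mem_extChartAt_target (I := 𝓘(ℝ, E)) x) (x0 := x)
    (by rw [extChartAt_to_inv]; exact hf.mdifferentiableAt (by simp))
  rw [← h2] at h1
  rw [extDerivField_apply, h1, extChartAt_to_inv]
  have h3 := mfderiv_symm_comp_chart hs
  ext v
  refine congrArg₂ (fun a b : ℝ => a + b) ?_ rfl
  simp only [inChart]
  rw [extChartAt_to_inv]
  refine congrArg (BkGeometry.dWedge f α x) (funext fun i => ?_)
  exact h3 (v i)

/-- `d(df ∧ α) = -df ∧ dα`. -/
lemma extDerivField_dWedge [FiniteDimensional ℝ E] {f : M → ℝ} {α : FormField E M p} {x : M}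
    (hf : ContMDiffAt 𝓘(ℝ, E) 𝓘(ℝ, ℝ) ∞ f x) (hα : SmoothAt α x) :
    extDerivField (dWedge f α) x = -dWedge f (extDerivField α) x := by
  have hs := mem_extChartAt_source (I := 𝓘(ℝ, E)) x
  have h1 := (eventually_inChart_dWedge α hf).extDeriv_eq
  rw [extDeriv_fderiv_wedge (contDiffAt_fnInChart hs hf) hα] at h1
  have h2 := diffAt_comp_chart_symm (f := f) (mem_extChartAt_target (I := 𝓘(ℝ, E)) x)
    (by rw [extChartAt_to_inv]; exact hf.mdifferentiableAt (by simp))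
  rw [← h2] at h1
  rw [extDerivField_apply, h1, extChartAt_to_inv]
  have h3 := mfderiv_symm_comp_chart hs
  rw [dWedge_apply, extDerivField_apply]
  have h4 : (-wedge (diffAt E f x ∘L symmDeriv x (extChartAt 𝓘(ℝ, E) x x)) (extDeriv (inChart α x)
      (extChartAt 𝓘(ℝ, E) x x))).compContinuousLinearMap (chartDeriv x x) =
      -((wedge (diffAt E f x ∘L symmDeriv x (extChartAt 𝓘(ℝ, E) x x)) (extDeriv (inChart α x)
      (extChartAt 𝓘(ℝ, E) x x))).compContinuousLinearMap (chartDeriv x x)) := rfl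
  refine h4.trans (congrArg _ ?_)
  rw [wedge_compContinuousLinearMap]
  congr 1
  ext v
  exact congrArg (diffAt E f x) (h3 v)

/-- Smoothness of a section of the tangent bundle gives smoothness of its expression in a chart. -/
lemma contDiffAt_vecInChart {X : ∀ x : M, TangentSpace 𝓘(ℝ, E) x} {x x0 : M}
    (hx : x ∈ (extChartAt 𝓘(ℝ, E) x0).source)
    (hX : ContMDiffAt 𝓘(ℝ, E) (𝓘(ℝ, E).prod 𝓘(ℝ, E)) ∞
      (fun y => (⟨y, X y⟩ : TangentBundle 𝓘(ℝ, E) M)) x) :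
    ContDiffAt ℝ ∞ (vecInChart X x0) (extChartAt 𝓘(ℝ, E) x0 x) := by
  have : IsManifold 𝓘(ℝ, E) 1 M := .of_le (n := ∞) (by simp)
  have hx' : x ∈ (trivializationAt E (TangentSpace 𝓘(ℝ, E)) x0).baseSet := by simpa using hx
  have h1 := ((trivializationAt E (TangentSpace 𝓘(ℝ, E)) x0).contMDiffAt_section_iff (IB := 𝓘(ℝ, E))
    hx').1 hX
  refine (contDiffAt_fnInChart hx h1).congr_of_eventuallyEq ?_
  filter_upwards [(isOpen_extChartAt_target x0).mem_nhds
    ((extChartAt 𝓘(ℝ, E) x0).map_source hx)] with e he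
  have hs : (extChartAt 𝓘(ℝ, E) x0).symm e ∈ (chartAt E x0).source := by
    simpa using (extChartAt 𝓘(ℝ, E) x0).map_target he
  have h2 := TangentBundle.continuousLinearMapAt_trivializationAt (I := 𝓘(ℝ, E)) (x₀ := x0)
    (x := (extChartAt 𝓘(ℝ, E) x0).symm e) hs
  have h3 := DFunLike.congr_fun h2 (X ((extChartAt 𝓘(ℝ, E) x0).symm e))
  refine h3.symm.trans ?_
  rw [Bundle.Trivialization.continuousLinearMapAt_apply,
    Bundle.Trivialization.linearMapAt_apply, if_pos (by simpa using hs)]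

lemma SmoothAt.contract [FiniteDimensional ℝ E] {X : ∀ x : M, TangentSpace 𝓘(ℝ, E) x}
    {α : FormField E M (p + 1)} {x : M}
    (hX : ContMDiffAt 𝓘(ℝ, E) (𝓘(ℝ, E).prod 𝓘(ℝ, E)) ∞
      (fun y => (⟨y, X y⟩ : TangentBundle 𝓘(ℝ, E) M)) x) (hα : SmoothAt α x) :
    SmoothAt (contract X α) x := by
  have h1 := contDiffAt_vecInChart (mem_extChartAt_source (I := 𝓘(ℝ, E)) x) hX
  have h2 : inChart (BkGeometry.contract X α) x =ᶠ[𝓝 (extChartAt 𝓘(ℝ, E) x x)]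
      fun e => (inChart α x e).curryLeft (vecInChart X x e) := by
    filter_upwards [(isOpen_extChartAt_target x).mem_nhds (mem_extChartAt_target (I := 𝓘(ℝ, E)) x)]
      with e he
    exact inChart_contract X α he
  refine ContDiffAt.congr_of_eventuallyEq ?_ h2
  rw [contDiffAt_form_iff]
  intro v
  simp only [ContinuousAlternatingMap.curryLeft_apply_apply]
  exact contDiffAt_form_apply (v := fun i e => Matrix.vecCons (vecInChart X x e) v i) hα fun i => by
    refine Fin.cases ?_ (fun j => ?_) i
    · exact h1
    · exact contDiffAt_const

/-- The value of a smooth form on smooth vector fields is smooth. -/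
lemma SmoothAt.apply {v : Fin p → ∀ x : M, TangentSpace 𝓘(ℝ, E) x} {α : FormField E M p} {x : M}
    (hv : ∀ i, ContMDiffAt 𝓘(ℝ, E) (𝓘(ℝ, E).prod 𝓘(ℝ, E)) ∞
      (fun y => (⟨y, v i y⟩ : TangentBundle 𝓘(ℝ, E) M)) x) (hα : SmoothAt α x) :
    ContMDiffAt 𝓘(ℝ, E) 𝓘(ℝ, ℝ) ∞ (fun y => α y (fun i => v i y)) x := by
  have hs := mem_extChartAt_source (I := 𝓘(ℝ, E)) x
  refine contMDiffAt_of_fnInChart hs ?_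
  refine (contDiffAt_form_apply (v := fun i => vecInChart (v i) x) hα
    (fun i => contDiffAt_vecInChart hs (hv i))).congr_of_eventuallyEq ?_
  filter_upwards [(isOpen_extChartAt_target x).mem_nhds (mem_extChartAt_target (I := 𝓘(ℝ, E)) x)]
    with e he
  refine congrArg (α ((extChartAt 𝓘(ℝ, E) x).symm e)) (funext fun i => ?_)
  have h := mfderiv_symm_comp_chart ((extChartAt 𝓘(ℝ, E) x).map_target he)
    (v i ((extChartAt 𝓘(ℝ, E) x).symm e))
  rw [(extChartAt 𝓘(ℝ, E) x).right_inv he] at h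
  exact h.symm

/-- The derivative of a smooth function along a smooth vector field is smooth. -/
lemma contMDiffAt_diffAt {f : M → ℝ} {X : ∀ x : M, TangentSpace 𝓘(ℝ, E) x} {x : M}
    (hf : ContMDiffAt 𝓘(ℝ, E) 𝓘(ℝ, ℝ) ∞ f x)
    (hX : ContMDiffAt 𝓘(ℝ, E) (𝓘(ℝ, E).prod 𝓘(ℝ, E)) ∞
      (fun y => (⟨y, X y⟩ : TangentBundle 𝓘(ℝ, E) M)) x) :
    ContMDiffAt 𝓘(ℝ, E) 𝓘(ℝ, ℝ) ∞ (fun y => diffAt E f y (X y)) x := by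
  have hs := mem_extChartAt_source (I := 𝓘(ℝ, E)) x
  refine contMDiffAt_of_fnInChart hs ?_
  refine (((contDiffAt_fnInChart hs hf).fderiv_right (m := ∞) (by simp)).clm_apply
    (contDiffAt_vecInChart hs hX)).congr_of_eventuallyEq ?_
  filter_upwards [eventually_mem_chart_target hs (eventually_mdifferentiableAt hf)] with e he
  rw [← diffAt_comp_chart_symm he.1 he.2]
  have h := mfderiv_symm_comp_chart ((extChartAt 𝓘(ℝ, E) x).map_target he.1)
    (X ((extChartAt 𝓘(ℝ, E) x).symm e))
  rw [(extChartAt 𝓘(ℝ, E) x).right_inv he.1] at h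
  exact congrArg (diffAt E f ((extChartAt 𝓘(ℝ, E) x).symm e)) h.symm

end Operations

/-! ### Superposition operators on spaces of continuous functions -/

section Superposition
universe u
variable {K : Type*} [TopologicalSpace K] [CompactSpace K]
variable {E : Type u} [NormedAddCommGroup E] [NormedSpace ℝ E]

/-- The superposition operator `γ ↦ V ∘ γ` on spaces of continuous functions. -/
def superpose {F : Type*} [NormedAddCommGroup F] (K : Type*) [TopologicalSpace K]
    (V : C(E, F)) (γ : C(K, E)) : C(K, F) := V.comp γ

/-- Pointwise application `C(K, E →L F) × C(K, E) → C(K, F)`. -/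
def pointwiseApply (K : Type*) [TopologicalSpace K] [CompactSpace K] (E F : Type*)
    [NormedAddCommGroup E] [NormedSpace ℝ E] [NormedAddCommGroup F] [NormedSpace ℝ F] :
    C(K, E →L[ℝ] F) →L[ℝ] C(K, E) →L[ℝ] C(K, F) :=
  LinearMap.mkContinuous₂
    (LinearMap.mk₂ ℝ (fun (A : C(K, E →L[ℝ] F)) (h : C(K, E)) =>
      (⟨fun k => A k (h k), A.continuous.clm_apply h.continuous⟩ : C(K, F)))
      (fun A B h => by ext k; simp) (fun c A h => by ext k; simp)
      (fun A h h' => by ext k; simp) (fun c A h => by ext k; simp)) 1 (fun A h => by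
    rw [one_mul, ContinuousMap.norm_le _ (by positivity)]
    intro k
    exact ((A k).le_opNorm (h k)).trans
      (mul_le_mul (A.norm_coe_le_norm k) (h.norm_coe_le_norm k) (by positivity) (by positivity)))

/-- The derivative of `γ ↦ V ∘ γ` at `γ` is the pointwise application of `V' ∘ γ`. The estimate is
uniform because `γ ↦ V' ∘ γ` is continuous for the supremum norm. -/
lemma hasFDerivAt_superpose {F : Type*} [NormedAddCommGroup F] [NormedSpace ℝ F] {V : C(E, F)}
    {V' : C(E, E →L[ℝ] F)} (hV : ∀ e, HasFDerivAt V (V' e) e) (γ : C(K, E)) :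
    HasFDerivAt (superpose K V) (pointwiseApply K E F (superpose K V' γ)) γ := by
  rw [hasFDerivAt_iff_isLittleO_nhds_zero, Asymptotics.isLittleO_iff]
  intro ε hε
  have hc : ContinuousAt (superpose K V') γ := (ContinuousMap.continuous_postcomp V').continuousAt
  obtain ⟨δ, hδ, h⟩ := Metric.continuousAt_iff.1 hc ε hε
  filter_upwards [Metric.ball_mem_nhds (0 : C(K, E)) hδ] with η hη
  rw [ContinuousMap.norm_le _ (by positivity)]
  intro k
  have key := (convex_segment (𝕜 := ℝ) (γ k)
    (γ k + η k)).norm_image_sub_le_of_norm_hasFDerivWithin_le' (f := V)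
    (f' := V') (φ := V' (γ k)) (C := ε) (fun e _ => (hV e).hasFDerivWithinAt)
    (fun e he => by
      rw [segment_eq_image'] at he
      obtain ⟨t, ht, rfl⟩ := he
      have hd : dist (γ + t • η) γ < δ := by
        rw [dist_eq_norm, add_sub_cancel_left, norm_smul, Real.norm_of_nonneg ht.1]
        calc t * ‖η‖ ≤ 1 * ‖η‖ := by gcongr; exact ht.2
          _ < δ := by simpa using hη
      have h1 := (h hd).le
      rw [dist_eq_norm] at h1
      have h2 := (ContinuousMap.norm_coe_le_norm (superpose K V' (γ + t • η) - superpose K V' γ)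
        k).trans h1
      simpa [superpose] using h2)
    (left_mem_segment ℝ _ _) (right_mem_segment ℝ _ _)
  rw [add_sub_cancel_left] at key
  have h3 : ε * ‖η k‖ ≤ ε * ‖η‖ := by gcongr; exact η.norm_coe_le_norm k
  exact (show ‖V (γ k + η k) - V (γ k) - (V' (γ k)) (η k)‖ ≤ _ from key).trans h3

lemma contDiff_superpose_nat (n : ℕ) : ∀ {F : Type u} [NormedAddCommGroup F] [NormedSpace ℝ F]
    (V : C(E, F)), ContDiff ℝ n V → ContDiff ℝ n (superpose K V) := by
  induction n with
  | zero =>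
    intro F _ _ V _
    exact contDiff_zero.2 (ContinuousMap.continuous_postcomp V)
  | succ n ih =>
    intro F _ _ V hV
    have h := contDiff_succ_iff_fderiv.1 (by exact_mod_cast hV : ContDiff ℝ (n + 1) V)
    let V' : C(E, E →L[ℝ] F) := ⟨fderiv ℝ V, h.2.2.continuous⟩
    have hd : ∀ γ, HasFDerivAt (superpose K V) (pointwiseApply K E F (superpose K V' γ)) γ :=
      fun γ => hasFDerivAt_superpose (fun e => (h.1 e).hasFDerivAt) γ
    have : ContDiff ℝ (n + 1) (superpose K V) := by
      refine contDiff_succ_iff_fderiv.2 ⟨fun γ => (hd γ).differentiableAt, by simp, ?_⟩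
      have e : fderiv ℝ (superpose K V) = fun γ => pointwiseApply K E F (superpose K V' γ) :=
        funext fun γ => (hd γ).fderiv
      rw [e]
      exact (pointwiseApply K E F).contDiff.comp (ih V' h.2.2)
    exact_mod_cast this

/-- The superposition operator of a smooth map is smooth: its derivative is again a superposition
operator, followed by a bounded bilinear map. -/
lemma contDiff_superpose {F : Type u} [NormedAddCommGroup F] [NormedSpace ℝ F]
    (V : C(E, F)) (hV : ContDiff ℝ ∞ V) : ContDiff ℝ ∞ (superpose K V) :=
  contDiff_infty.2 fun n => contDiff_superpose_nat n V (contDiff_infty.1 hV n)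

end Superposition

/-! ### Smooth dependence of integral curves -/

section Primitive
variable {E : Type*} [NormedAddCommGroup E] [NormedSpace ℝ E] [CompleteSpace E]

/-- The time interval of the integral curves below; it contains `[0, 1]` in its interior. -/
abbrev TimeInterval : Type := Icc (-1 : ℝ) 2

lemma timeInterval_le : (-1 : ℝ) ≤ 2 := by norm_num

/-- A continuous function on the time interval, extended by constants. -/
def extendTime (f : C(TimeInterval, E)) (t : ℝ) : E := f (projIcc (-1) 2 timeInterval_le t)

lemma continuous_extendTime (f : C(TimeInterval, E)) : Continuous (extendTime f) :=
  f.continuous.comp continuous_projIcc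

lemma extendTime_coe (f : C(TimeInterval, E)) (t : TimeInterval) : extendTime f t = f t := by
  simp [extendTime]

variable (E) in
/-- The primitive vanishing at time `0`, as an operator. -/
def primitiveCLM : C(TimeInterval, E) →L[ℝ] C(TimeInterval, E) :=
  LinearMap.mkContinuous
    { toFun := fun f => ⟨fun s => ∫ t in (0 : ℝ)..s, extendTime f t,
        (intervalIntegral.continuous_primitive
          (fun a b => (continuous_extendTime f).intervalIntegrable a b) 0).comp
          continuous_subtype_val⟩
      map_add' := fun f g => by
        ext s
        exact intervalIntegral.integral_add ((continuous_extendTime f).intervalIntegrable _ _)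
          ((continuous_extendTime g).intervalIntegrable _ _)
      map_smul' := fun c f => by
        ext s
        exact intervalIntegral.integral_smul c _ } 2 (fun f => by
    rw [ContinuousMap.norm_le _ (by positivity)]
    intro s
    have h := intervalIntegral.norm_integral_le_of_norm_le_const (a := (0 : ℝ)) (b := s)
      (f := extendTime f) (C := ‖f‖) (fun t _ => f.norm_coe_le_norm _)
    refine h.trans ?_
    rw [mul_comm, sub_zero]
    gcongr
    rw [abs_le]
    constructor <;> linarith [s.2.1, s.2.2])

end Primitive

section Implicit
variable {P C : Type*} [NormedAddCommGroup P] [NormedSpace ℝ P] [CompleteSpace P]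
  [NormedAddCommGroup C] [NormedSpace ℝ C] [CompleteSpace C]

/-- The smooth implicit function theorem, with smoothness in a neighbourhood. -/
lemma exists_smooth_implicitFunction {Ψ : P × C → C} (hΨ : ContDiff ℝ ∞ Ψ) {p0 : P} {c0 : C}
    (h0 : Ψ (p0, c0) = 0)
    (hd : fderiv ℝ Ψ (p0, c0) ∘L .inr ℝ P C = ContinuousLinearMap.id ℝ C) :
    ∃ G : P → C, G p0 = c0 ∧ ∀ᶠ p in 𝓝 p0, ContDiffAt ℝ ∞ G p ∧ Ψ (p, G p) = 0 := by
  have hne : (∞ : ℕ∞ω) ≠ 0 := by simp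
  have hi : (fderiv ℝ Ψ (p0, c0) ∘L .inr ℝ P C).IsInvertible := by
    rw [hd]; exact ⟨ContinuousLinearEquiv.refl ℝ C, rfl⟩
  have hcd : ∀ v, ContDiffAt ℝ ∞ Ψ v := fun v => hΨ.contDiffAt
  let G := (hcd (p0, c0)).implicitFunction hne hi
  have hG0 : G p0 = c0 := (hcd (p0, c0)).implicitFunction_apply_self hne hi
  have hGc : ContDiffAt ℝ ∞ G p0 := (hcd (p0, c0)).contDiffAt_implicitFunction hne hi
  have hGs : ∀ᶠ p in 𝓝 p0, Ψ (p, G p) = 0 := by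
    have := (hcd (p0, c0)).eventually_apply_implicitFunction hne hi
    simpa only [h0] using this
  have hcont : ContinuousAt (fun p => fderiv ℝ Ψ (p, G p) ∘L .inr ℝ P C) p0 := by
    have h1 : Continuous (fderiv ℝ Ψ) := hΨ.continuous_fderiv (by simp)
    have h2 : ContinuousAt (fun p => fderiv ℝ Ψ (p, G p)) p0 :=
      ContinuousAt.comp (g := fderiv ℝ Ψ) (f := fun p => (p, G p)) h1.continuousAt
        (continuousAt_id.prodMk hGc.continuousAt)
    exact h2.clm_comp continuousAt_const
  have hinv : ∀ᶠ p in 𝓝 p0, (fderiv ℝ Ψ (p, G p) ∘L .inr ℝ P C).IsInvertible := by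
    refine hcont.eventually ?_
    have h3 := ContinuousLinearEquiv.nhds (ContinuousLinearEquiv.refl ℝ C)
    have h4 : fderiv ℝ Ψ (p0, G p0) ∘L .inr ℝ P C = ContinuousLinearMap.id ℝ C := by
      rw [hG0, hd]
    change ∀ᶠ y in 𝓝 (fderiv ℝ Ψ (p0, G p0) ∘L .inr ℝ P C), y.IsInvertible
    rw [h4]
    exact h3
  have hGcont : ∀ᶠ p in 𝓝 p0, ContinuousAt G p := by
    have h1 : ContDiffAt ℝ 1 G p0 := hGc.of_le (by simp)
    filter_upwards [h1.eventually (by simp)] with p hp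
    exact hp.continuousAt
  refine ⟨G, hG0, ?_⟩
  filter_upwards [hinv, hGcont, hGs, hGs.eventually_nhds] with p hp hpc hps hps'
  refine ⟨?_, hps⟩
  refine ((hcd (p, G p)).contDiffAt_implicitFunction hne hp).congr_of_eventuallyEq ?_
  have h4 := (hcd (p, G p)).eventually_apply_eq_iff_implicitFunction hne hp
  have h5 : Tendsto (fun p => (p, G p)) (𝓝 p) (𝓝 (p, G p)) :=
    (continuousAt_id.prodMk hpc).tendsto
  filter_upwards [h5.eventually h4, hps'] with q hq hq'
  exact (hq.1 (hq'.trans hps.symm)).symm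

end Implicit

section Flow
variable {E : Type*} [NormedAddCommGroup E] [NormedSpace ℝ E] [CompleteSpace E]

/-- Smooth dependence of integral curves on the initial point and on a time scale `τ`: the curves
of `τ V` starting near `e0`, for small `τ`. -/
lemma exists_smooth_flow {V : E → E} (hV : ContDiff ℝ ∞ V) (e0 : E) :
    ∃ G : E × ℝ → C(TimeInterval, E), ContinuousAt G (e0, 0) ∧ (∀ t, G (e0, 0) t = e0) ∧
      ∀ᶠ q in 𝓝 (e0, (0 : ℝ)), ContDiffAt ℝ ∞ G q ∧ extendTime (G q) 0 = q.1 ∧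
        ∀ s ∈ Ioo (-1 : ℝ) 2, HasDerivAt (extendTime (G q)) (q.2 • V (extendTime (G q) s)) s := by
  let Vc : C(E, E) := ⟨V, hV.continuous⟩
  let cst : E →L[ℝ] C(TimeInterval, E) := ContinuousLinearMap.const ℝ TimeInterval
  -- `Ψ ((x, τ), γ) = 0` is the integral equation `γ s = x + τ ∫₀ˢ V (γ t) dt`; at `τ = 0`, its
  -- derivative in the direction of `γ` is the identity
  let Ψ : (E × ℝ) × C(TimeInterval, E) → C(TimeInterval, E) := fun u =>
    u.2 - cst u.1.1 - u.1.2 • primitiveCLM E (superpose TimeInterval Vc u.2)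
  have hN : ContDiff ℝ ∞ (fun u : (E × ℝ) × C(TimeInterval, E) => superpose TimeInterval Vc u.2) :=
    (contDiff_superpose Vc hV).comp contDiff_snd
  have hΨ : ContDiff ℝ ∞ Ψ :=
    (contDiff_snd.sub (cst.contDiff.comp (contDiff_fst.comp contDiff_fst))).sub
      ((contDiff_snd.comp contDiff_fst).smul ((primitiveCLM E).contDiff.comp hN))
  have hd : fderiv ℝ Ψ ((e0, 0), cst e0) ∘L .inr ℝ (E × ℝ) C(TimeInterval, E) =
      ContinuousLinearMap.id ℝ _ := by
    have h1 : HasFDerivAt Ψ (fderiv ℝ Ψ ((e0, 0), cst e0)) ((e0, 0), cst e0) :=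
      (hΨ.differentiable (by simp) _).hasFDerivAt
    have h2 : HasFDerivAt (fun γ : C(TimeInterval, E) => ((e0, (0 : ℝ)), γ))
        (.inr ℝ (E × ℝ) C(TimeInterval, E)) (cst e0) := hasFDerivAt_prodMk_right _ _
    have h3 := HasFDerivAt.comp (cst e0) (g := Ψ) h1 h2
    have h4 : (Ψ ∘ fun γ : C(TimeInterval, E) => ((e0, (0 : ℝ)), γ)) = fun γ => γ - cst e0 := by
      funext γ
      simp [Ψ]
    rw [h4] at h3
    exact h3.unique ((hasFDerivAt_id _).sub_const _)
  obtain ⟨G, hG0, hG⟩ := exists_smooth_implicitFunction hΨ (p0 := (e0, 0)) (c0 := cst e0)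
    (by simp [Ψ]) hd
  refine ⟨G, hG.self_of_nhds.1.continuousAt, fun t => by rw [hG0]; rfl, ?_⟩
  filter_upwards [hG] with q hq
  have heq : ∀ s : TimeInterval, G q s =
      q.1 + q.2 • ∫ t in (0 : ℝ)..s, V (extendTime (G q) t) := by
    intro s
    have h := congrArg (fun f : C(TimeInterval, E) => f s) hq.2
    have h' : G q s - q.1 - q.2 • ∫ t in (0 : ℝ)..s, V (extendTime (G q) t) = 0 := h
    rw [sub_sub, sub_eq_zero] at h'
    exact h'
  have hc : Continuous fun t => V (extendTime (G q) t) :=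
    hV.continuous.comp (continuous_extendTime _)
  refine ⟨hq.1, ?_, fun s hs => ?_⟩
  · have h := heq ⟨0, by norm_num, by norm_num⟩
    rw [← extendTime_coe] at h
    simpa using h
  · have h1 : HasDerivAt (fun s => q.1 + q.2 • ∫ t in (0 : ℝ)..s, V (extendTime (G q) t))
        (q.2 • V (extendTime (G q) s)) s :=
      ((hc.integral_hasStrictDerivAt 0 s).hasDerivAt.const_smul q.2).const_add q.1
    refine h1.congr_of_eventuallyEq ?_
    filter_upwards [Ioo_mem_nhds hs.1 hs.2] with s' hs'
    rw [← heq ⟨s', hs'.1.le, hs'.2.le⟩, ← extendTime_coe]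

end Flow

/-! ### Hadamard's lemma in a vector space -/

section Division
variable {E : Type*} [NormedAddCommGroup E] [NormedSpace ℝ E] [FiniteDimensional ℝ E]

/-- A function `f` that is smooth near `e0` agrees near `e0` with a smooth function `g` on the whole
space, namely the product of `f` and a bump function. The predicate `Q` keeps track of a vanishing
condition: `Q` holds on the support of the bump function, so if `Q e` implies `f e = 0`, then `g e =
0`, whether or not `e` is close to `e0`. -/
lemma exists_contDiff_eventuallyEq {F : Type*} [NormedAddCommGroup F] [NormedSpace ℝ F]
    {f : E → F} {e0 : E} {Q : E → Prop} (hf : ∀ᶠ e in 𝓝 e0, ContDiffAt ℝ ∞ f e ∧ Q e) :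
    ∃ g : E → F, ContDiff ℝ ∞ g ∧ g =ᶠ[𝓝 e0] f ∧ ∀ e, (Q e → f e = 0) → g e = 0 := by
  obtain ⟨r, hr, hball⟩ := Metric.eventually_nhds_iff_ball.1 hf
  let b : ContDiffBump e0 := ⟨r / 4, r / 2, by positivity, by linarith⟩
  have hsub : Metric.closedBall e0 (r / 2) ⊆ Metric.ball e0 r :=
    Metric.closedBall_subset_ball (by linarith)
  refine ⟨fun e => b e • f e, ?_, ?_, ?_⟩
  · rw [contDiff_iff_contDiffAt]
    intro e
    by_cases he : e ∈ Metric.ball e0 r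
    · exact b.contDiffAt.smul (hball e he).1
    · have h1 : e ∉ tsupport b := by
        rw [b.tsupport_eq]
        exact fun h2 => he (hsub h2)
      have h2 : (fun e => b e • f e) =ᶠ[𝓝 e] fun _ => 0 := by
        filter_upwards [(isClosed_tsupport b).isOpen_compl.mem_nhds h1] with e' he'
        rw [image_eq_zero_of_notMem_tsupport he', zero_smul]
      exact contDiffAt_const.congr_of_eventuallyEq h2
  · filter_upwards [b.eventuallyEq_one] with e he
    simp [he]
  · intro e he
    by_cases hb : b e = 0
    · simp [hb]
    · have h1 : e ∈ tsupport b := subset_tsupport _ hb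
      rw [b.tsupport_eq] at h1
      simp [he (hball e (hsub h1)).2]

/-- Hadamard's lemma: a smooth function vanishing on the hyperplane `L = 0` is a smooth multiple of
`L`. -/
lemma exists_eq_mul_of_vanishing {g : E → ℝ} {e0 : E} (hg : ∀ᶠ e in 𝓝 e0, ContDiffAt ℝ ∞ g e)
    {L : E →L[ℝ] ℝ} {w : E} (hw : L w = 1) (h0 : ∀ᶠ e in 𝓝 e0, L e = 0 → g e = 0) :
    ∃ h : E → ℝ, ContDiff ℝ ∞ h ∧ ∀ᶠ e in 𝓝 e0, g e = L e * h e := by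
  obtain ⟨f, hf, hfg, hf0⟩ := exists_contDiff_eventuallyEq (hg.and h0)
  have hf0' : ∀ e, L e = 0 → f e = 0 := fun e he => hf0 e fun h => h he
  -- The claim is `g e = L e * ∫₀¹ ∂_w f (e - (1 - s) (L e) w) ds`. The integrand is multiplied by
  -- `w`, and `L` is applied to the integral, so that only functions with values in `E` occur.
  have hD : ContDiff ℝ ∞ (fun e => fderiv ℝ f e w • w) :=
    ((hf.fderiv_right (m := ∞) (by simp)).clm_apply contDiff_const).smul contDiff_const
  let D : C(E, E) := ⟨fun e => fderiv ℝ f e w • w, hD.continuous⟩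
  let ρ : C(TimeInterval, E) := ⟨fun s => (1 - (s : ℝ)) • w, by fun_prop⟩
  let γ : E →L[ℝ] C(TimeInterval, E) := ContinuousLinearMap.const ℝ TimeInterval - L.smulRight ρ
  let ev : C(TimeInterval, E) →L[ℝ] E :=
    ContinuousMap.evalCLM ℝ (⟨1, by norm_num, by norm_num⟩ : TimeInterval)
  refine ⟨fun e => L (ev (primitiveCLM E (superpose TimeInterval D (γ e)))), ?_, ?_⟩
  · exact L.contDiff.comp (ev.contDiff.comp ((primitiveCLM E).contDiff.comp
      ((contDiff_superpose D hD).comp γ.contDiff)))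
  · filter_upwards [hfg] with e he
    have h1 : ∀ s ∈ uIcc (0 : ℝ) 1, HasDerivAt (fun s => f (e - ((1 - s) * L e) • w) • w)
        (L e • extendTime (superpose TimeInterval D (γ e)) s) s := by
      intro s hs
      rw [uIcc_of_le zero_le_one] at hs
      have h2 := extendTime_coe (superpose TimeInterval D (γ e))
        ⟨s, by linarith [hs.1], by linarith [hs.2]⟩
      have h3 : superpose TimeInterval D (γ e) ⟨s, by linarith [hs.1], by linarith [hs.2]⟩ =
          fderiv ℝ f (e - L e • (1 - s) • w) w • w := rfl
      simp only at h2
      rw [h2, h3]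
      have h4 : HasDerivAt (fun s : ℝ => e - ((1 - s) * L e) • w) (L e • w) s := by
        have := ((((hasDerivAt_id s).const_sub 1).mul_const (L e)).smul_const w).const_sub e
        simpa using this
      have h5 := ((hf.differentiable (by simp)
        (e - ((1 - s) * L e) • w)).hasFDerivAt.comp_hasDerivAt s h4).smul_const w
      rw [map_smul, smul_assoc] at h5
      have h9 : e - L e • (1 - s) • w = e - ((1 - s) * L e) • w := by rw [smul_smul, mul_comm]
      rw [smul_smul] at h5
      rw [smul_smul, h9]
      exact h5
    have h6 := intervalIntegral.integral_eq_sub_of_hasDerivAt h1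
      ((continuous_const.smul (continuous_extendTime _)).intervalIntegrable _ _)
    rw [intervalIntegral.integral_smul] at h6
    have h7 : f (e - ((1 - 0) * L e) • w) = 0 := hf0' _ (by simp [hw])
    rw [h7] at h6
    simp only [sub_self, zero_mul, zero_smul, sub_zero] at h6
    have h8 := congrArg L h6
    rw [map_smul, map_smul, hw, smul_eq_mul, smul_eq_mul, mul_one, he] at h8
    exact h8.symm

end Division

/-! ### Smooth extension over a closed set with dense complement -/

section Extension
variable {E M : Type*} [NormedAddCommGroup E] [NormedSpace ℝ E] [TopologicalSpace M]
  [ChartedSpace E M] [IsManifold 𝓘(ℝ, E) ∞ M] {p : ℕ} {A : Set M}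

/-- A form at `x` is recovered from its expression in the preferred chart at `x`. -/
lemma eq_inChart_self_comp (α : FormField E M p) (x : M) :
    α x = (inChart α x (extChartAt 𝓘(ℝ, E) x x)).compContinuousLinearMap (chartDeriv x x) := by
  have h3 := mfderiv_symm_comp_chart (mem_extChartAt_source (I := 𝓘(ℝ, E)) x)
  ext v
  simp only [inChart]
  rw [extChartAt_to_inv]
  refine congrArg (α x) (funext fun i => ?_)
  exact (h3 (v i)).symm

/-- Smooth forms that agree off a set with dense complement agree. -/
lemma SmoothAt.eq_of_eventually_off (hA : Dense Aᶜ) {α β : FormField E M p} {x : M}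
    (hα : SmoothAt α x) (hβ : SmoothAt β x) (h : ∀ᶠ y in 𝓝 x, y ∉ A → α y = β y) : α x = β x := by
  have hne : (𝓝[Aᶜ] x).NeBot := mem_closure_iff_nhdsWithin_neBot.1 (hA x)
  have hc : Tendsto (extChartAt 𝓘(ℝ, E) x) (𝓝[Aᶜ] x) (𝓝 (extChartAt 𝓘(ℝ, E) x x)) :=
    (continuousAt_extChartAt x).tendsto.mono_left nhdsWithin_le_nhds
  have h1 := (ContDiffAt.continuousAt hα).tendsto.comp hc
  have h2 := (ContDiffAt.continuousAt hβ).tendsto.comp hc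
  have h3 : (inChart α x ∘ extChartAt 𝓘(ℝ, E) x) =ᶠ[𝓝[Aᶜ] x]
      (inChart β x ∘ extChartAt 𝓘(ℝ, E) x) := by
    filter_upwards [self_mem_nhdsWithin, mem_nhdsWithin_of_mem_nhds h,
      mem_nhdsWithin_of_mem_nhds (extChartAt_source_mem_nhds (I := 𝓘(ℝ, E)) x)] with y hy1 hy2 hy3
    simp only [Function.comp_apply, inChart]
    rw [(extChartAt 𝓘(ℝ, E) x).left_inv hy3, hy2 hy1]
  have h4 := tendsto_nhds_unique (h1.congr' h3) h2
  rw [eq_inChart_self_comp α x, h4, ← eq_inChart_self_comp β x]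

/-- `σ` extends smoothly over `A` near `x`: near `x`, it agrees off `A` with a smooth form. -/
def ExtendsAt (A : Set M) (σ : FormField E M p) (x : M) : Prop :=
  ∃ τ : FormField E M p, ∀ᶠ y in 𝓝 x, SmoothAt τ y ∧ (y ∉ A → τ y = σ y)

/-- `σ` extends smoothly over `A` near every point. -/
def ExtendsOver (A : Set M) (σ : FormField E M p) : Prop := ∀ x, ExtendsAt A σ x

lemma ExtendsOver.congr {σ τ : FormField E M p} (hσ : ExtendsOver A σ)
    (h : ∀ x ∉ A, σ x = τ x) : ExtendsOver A τ := fun x => by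
  obtain ⟨η, hη⟩ := hσ x
  exact ⟨η, hη.mono fun y hy => ⟨hy.1, fun hyA => (hy.2 hyA).trans (h y hyA)⟩⟩

lemma ExtendsOver.of_smoothAt {σ : FormField E M p} (hσ : ∀ x, SmoothAt σ x) : ExtendsOver A σ :=
  fun _ => ⟨σ, Eventually.of_forall fun y => ⟨hσ y, fun _ => rfl⟩⟩

lemma ExtendsOver.add {σ τ : FormField E M p} (hσ : ExtendsOver A σ) (hτ : ExtendsOver A τ) :
    ExtendsOver A (σ + τ) := fun x => by
  obtain ⟨η, hη⟩ := hσ x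
  obtain ⟨ζ, hζ⟩ := hτ x
  refine ⟨η + ζ, ?_⟩
  filter_upwards [hη, hζ] with y h1 h2
  refine ⟨h1.1.add h2.1, fun hy => ?_⟩
  rw [FormField.add_apply, FormField.add_apply, h1.2 hy, h2.2 hy]

lemma ExtendsOver.smul {σ : FormField E M p} (c : ℝ) (hσ : ExtendsOver A σ) :
    ExtendsOver A (c • σ) := fun x => by
  obtain ⟨η, hη⟩ := hσ x
  refine ⟨c • η, ?_⟩
  filter_upwards [hη] with y h1
  refine ⟨h1.1.smul c, fun hy => ?_⟩
  rw [FormField.smul_apply, FormField.smul_apply, h1.2 hy]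

lemma ExtendsOver.fnSmul {f : M → ℝ} (hf : ContMDiff 𝓘(ℝ, E) 𝓘(ℝ, ℝ) ∞ f) {σ : FormField E M p}
    (hσ : ExtendsOver A σ) : ExtendsOver A (fnSmul f σ) := fun x => by
  obtain ⟨η, hη⟩ := hσ x
  refine ⟨BkGeometry.fnSmul f η, ?_⟩
  filter_upwards [hη] with y h1
  refine ⟨h1.1.fnSmul (hf y), fun hy => ?_⟩
  rw [fnSmul_apply, fnSmul_apply, h1.2 hy]

lemma ExtendsOver.dWedge [FiniteDimensional ℝ E] {f : M → ℝ}
    (hf : ContMDiff 𝓘(ℝ, E) 𝓘(ℝ, ℝ) ∞ f) {σ : FormField E M p}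
    (hσ : ExtendsOver A σ) : ExtendsOver A (dWedge f σ) := fun x => by
  obtain ⟨η, hη⟩ := hσ x
  refine ⟨BkGeometry.dWedge f η, ?_⟩
  filter_upwards [hη] with y h1
  refine ⟨h1.1.dWedge (hf y), fun hy => ?_⟩
  rw [dWedge_apply, dWedge_apply, h1.2 hy]

lemma ExtendsOver.extDerivField [FiniteDimensional ℝ E] (hA : IsClosed A) {σ : FormField E M p}
    (hσ : ExtendsOver A σ) : ExtendsOver A (extDerivField σ) := fun x => by
  obtain ⟨η, hη⟩ := hσ x
  refine ⟨BkGeometry.extDerivField η, ?_⟩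
  filter_upwards [hη.eventually_nhds] with y h1
  refine ⟨SmoothAt.extDerivField (h1.mono fun z hz => hz.1), fun hy => ?_⟩
  refine extDerivField_congr ?_
  filter_upwards [h1, hA.isOpen_compl.mem_nhds hy] with z hz hz'
  exact hz.2 hz'

/-- A smooth form off `A` that extends over `A` locally is the restriction of a smooth form. -/
lemma ExtendsOver.exists_smooth (hd : Dense Aᶜ) {σ : FormField E M p}
    (hσ : ExtendsOver A σ) :
    ∃ τ : FormField E M p, (∀ x, SmoothAt τ x) ∧ ∀ x ∉ A, τ x = σ x := by
  choose η hη using hσ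
  have key : ∀ x, ∀ᶠ y in 𝓝 x, η x y = η y y := by
    intro x
    filter_upwards [(hη x).eventually_nhds] with y hy
    refine SmoothAt.eq_of_eventually_off hd hy.self_of_nhds.1 (hη y).self_of_nhds.1 ?_
    filter_upwards [hy, hη y] with z h1 h2 hz
    rw [h1.2 hz, h2.2 hz]
  refine ⟨⟨fun x => η x x⟩, fun x => ?_, fun x hx => (hη x).self_of_nhds.2 hx⟩
  exact (hη x).self_of_nhds.1.congr (key x)

/-- A function, as a form of degree zero. -/
def zeroForm (E : Type*) [NormedAddCommGroup E] [NormedSpace ℝ E] (f : M → ℝ) :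
    FormField E M 0 where
  toFun x := ContinuousAlternatingMap.constOfIsEmpty ℝ E (Fin 0) (f x)

lemma SmoothAt.zeroForm {f : M → ℝ} {x : M} (hf : ContMDiffAt 𝓘(ℝ, E) 𝓘(ℝ, ℝ) ∞ f x) :
    SmoothAt (zeroForm E f) x := by
  have h1 : SmoothAt (⟨fun _ => ContinuousAlternatingMap.constOfIsEmpty ℝ E (Fin 0) 1⟩ :
      FormField E M 0) x :=
    contDiffAt_const (c := ContinuousAlternatingMap.constOfIsEmpty ℝ E (Fin 0) (1 : ℝ))
  refine (h1.fnSmul hf).congr (Eventually.of_forall fun y => ?_)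
  ext v
  exact mul_one _

/-- A smooth function off `A` that extends over `A` locally is the restriction of a smooth
function. -/
lemma exists_smooth_function (hd : Dense Aᶜ) {f : M → ℝ}
    (hf : ∀ x, ∃ g : M → ℝ, ∀ᶠ y in 𝓝 x, ContMDiffAt 𝓘(ℝ, E) 𝓘(ℝ, ℝ) ∞ g y ∧ (y ∉ A → g y = f y)) :
    ∃ g : C^∞⟮𝓘(ℝ, E), M; ℝ⟯, ∀ x ∉ A, g x = f x := by
  have h1 : ExtendsOver A (zeroForm E f) := fun x => by
    obtain ⟨g, hg⟩ := hf x
    refine ⟨zeroForm E g, hg.mono fun y hy => ⟨SmoothAt.zeroForm hy.1, fun hyA => ?_⟩⟩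
    ext v
    exact hy.2 hyA
  obtain ⟨τ, hτ, hτ'⟩ := h1.exists_smooth hd
  refine ⟨⟨fun x => τ x 0, fun x => ?_⟩, fun x hx => ?_⟩
  · have := SmoothAt.apply (v := fun (_ : Fin 0) x => (0 : TangentSpace 𝓘(ℝ, E) x))
      (fun i => i.elim0) (hτ x)
    refine this.congr_of_eventuallyEq (Eventually.of_forall fun y => ?_)
    exact congrArg (τ y) (Subsingleton.elim _ _)
  · change τ x 0 = f x
    rw [hτ' x hx]
    rfl

end Extension

/-! ### Existence of vector fields -/

section VectorFields

lemma normalSpace_of_manifold (E M : Type*) [NormedAddCommGroup E] [NormedSpace ℝ E]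
    [FiniteDimensional ℝ E] [TopologicalSpace M] [ChartedSpace E M] [T2Space M]
    [SigmaCompactSpace M] : NormalSpace M := by
  have : LocallyCompactSpace M := Manifold.locallyCompact_of_finiteDimensional 𝓘(ℝ, E)
  infer_instance

variable {E M : Type*} [NormedAddCommGroup E] [NormedSpace ℝ E] [TopologicalSpace M]
  [ChartedSpace E M] [IsManifold 𝓘(ℝ, E) ∞ M]

/-- The field of vectors with a constant expression `e` in the preferred chart at `x0`. -/
def constField (x0 : M) (e : E) (x : M) : TangentSpace 𝓘(ℝ, E) x :=
  symmDeriv x0 (extChartAt 𝓘(ℝ, E) x0 x) e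

lemma chartDeriv_constField {x0 x : M} (hx : x ∈ (extChartAt 𝓘(ℝ, E) x0).source) (e : E) :
    (chartDeriv x0 x : E →L[ℝ] E) (constField x0 e x) = e := by
  have h := mfderiv_chart_comp_symm ((extChartAt 𝓘(ℝ, E) x0).map_source hx) e
  rw [(extChartAt 𝓘(ℝ, E) x0).left_inv hx] at h
  exact h

lemma contMDiffAt_constField {x0 x : M} (hx : x ∈ (extChartAt 𝓘(ℝ, E) x0).source) (e : E) :
    ContMDiffAt 𝓘(ℝ, E) (𝓘(ℝ, E).prod 𝓘(ℝ, E)) ∞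
      (fun y => (⟨y, constField x0 e y⟩ : TangentBundle 𝓘(ℝ, E) M)) x := by
  have : IsManifold 𝓘(ℝ, E) 1 M := .of_le (n := ∞) (by simp)
  have hx' : x ∈ (trivializationAt E (TangentSpace 𝓘(ℝ, E)) x0).baseSet := by simpa using hx
  refine ((trivializationAt E (TangentSpace 𝓘(ℝ, E)) x0).contMDiffAt_section_iff (IB := 𝓘(ℝ, E))
    hx').2 ((contMDiffAt_const (c := e)).congr_of_eventuallyEq ?_)
  filter_upwards [extChartAt_source_mem_nhds' hx] with y hy
  have hs : y ∈ (chartAt E x0).source := by simpa using hy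
  have h2 := TangentBundle.continuousLinearMapAt_trivializationAt (I := 𝓘(ℝ, E)) (x₀ := x0)
    (x := y) hs
  have h3 := DFunLike.congr_fun h2 (constField x0 e y)
  refine Eq.trans ?_ (h3.trans (chartDeriv_constField hy e))
  rw [Bundle.Trivialization.continuousLinearMapAt_apply,
    Bundle.Trivialization.linearMapAt_apply, if_pos (by simpa using hs)]

variable [FiniteDimensional ℝ E] [T2Space M] [SigmaCompactSpace M]

/-- A vector field that is smooth near a point agrees near this point with a smooth vector field
on the whole manifold. -/
lemma exists_section_eventuallyEq {u : ∀ x : M, TangentSpace 𝓘(ℝ, E) x} {x0 : M}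
    (hu : ∀ᶠ x in 𝓝 x0, ContMDiffAt 𝓘(ℝ, E) (𝓘(ℝ, E).prod 𝓘(ℝ, E)) ∞
      (fun y => (⟨y, u y⟩ : TangentBundle 𝓘(ℝ, E) M)) x) :
    ∃ U : Cₛ^∞⟮𝓘(ℝ, E); E, (TangentSpace 𝓘(ℝ, E) : M → Type _)⟯,
      ∀ᶠ x in 𝓝 x0, U x = u x := by
  have := normalSpace_of_manifold E M
  obtain ⟨O, hO, hOo, hx0⟩ := eventually_nhds_iff.1 hu
  obtain ⟨N, hNo, hxN, hNO⟩ := normal_exists_closure_subset (isClosed_singleton (x := x0)) hOo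
    (singleton_subset_iff.2 hx0)
  obtain ⟨U, hU⟩ := exists_contMDiffSection_forall_mem_convex_of_local (n := (⊤ : ℕ∞)) 𝓘(ℝ, E)
    (TangentSpace 𝓘(ℝ, E) : M → Type _) (fun x => {v | x ∈ N → v = u x})
    (fun x v hv w hw a b ha hb hab hx => by rw [hv hx, hw hx, ← add_smul, hab, one_smul])
    (fun x => by
      by_cases hx : x ∈ closure N
      · exact ⟨O, hOo.mem_nhds (hNO hx), u, fun y hy => (hO y hy).contMDiffWithinAt,
          fun y _ _ => rfl⟩
      · refine ⟨(closure N)ᶜ, isClosed_closure.isOpen_compl.mem_nhds hx, 0,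
          fun y hy => ?_, fun y hy hyN => absurd (subset_closure hyN) hy⟩
        exact (0 : Cₛ^∞⟮𝓘(ℝ, E); E, (TangentSpace 𝓘(ℝ, E) : M → Type _)⟯).contMDiff
          |>.contMDiffAt.contMDiffWithinAt)
  exact ⟨U, mem_of_superset (hNo.mem_nhds (hxN rfl)) fun x hx => hU x hx⟩

/-- A partition of unity glues local solutions `X` of the affine condition `dy(X) = 1`. -/
lemma exists_transverse_vectorField {y : M → ℝ} (hy : ContMDiff 𝓘(ℝ, E) 𝓘(ℝ, ℝ) ∞ y) {A : Set M}
    (hA : IsClosed A) (hd : ∀ x ∈ A, diffAt E y x ≠ 0) :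
    ∃ X : Cₛ^∞⟮𝓘(ℝ, E); E, (TangentSpace 𝓘(ℝ, E) : M → Type _)⟯,
      ∀ᶠ x in 𝓝ˢ A, diffAt E y x (X x) = 1 := by
  have := normalSpace_of_manifold E M
  -- near a point of `A`, a multiple of a constant field is a solution
  have hloc : ∀ x0 ∈ A, ∃ u : ∀ x : M, TangentSpace 𝓘(ℝ, E) x, ∀ᶠ x in 𝓝 x0,
      ContMDiffAt 𝓘(ℝ, E) (𝓘(ℝ, E).prod 𝓘(ℝ, E)) ∞
        (fun z => (⟨z, u z⟩ : TangentBundle 𝓘(ℝ, E) M)) x ∧ diffAt E y x (u x) = 1 := by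
    intro x0 hx0
    obtain ⟨v, hv⟩ : ∃ v, diffAt E y x0 v ≠ 0 := by
      by_contra! h
      exact hd x0 hx0 (ContinuousLinearMap.ext h)
    have hs := mem_extChartAt_source (I := 𝓘(ℝ, E)) x0
    let a : M → ℝ := fun x => diffAt E y x (constField x0 (chartDeriv x0 x0 v) x)
    have ha : ∀ x ∈ (extChartAt 𝓘(ℝ, E) x0).source, ContMDiffAt 𝓘(ℝ, E) 𝓘(ℝ, ℝ) ∞ a x :=
      fun x hx => contMDiffAt_diffAt (hy x) (contMDiffAt_constField hx _)
    have ha0 : a x0 ≠ 0 := by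
      have := mfderiv_symm_comp_chart hs v
      have h2 : a x0 = diffAt E y x0 v := congrArg (diffAt E y x0) this
      rwa [h2]
    refine ⟨fun x => (a x)⁻¹ • constField x0 (chartDeriv x0 x0 v) x, ?_⟩
    filter_upwards [extChartAt_source_mem_nhds (I := 𝓘(ℝ, E)) x0,
      (ha x0 hs).continuousAt.eventually_ne ha0] with x hx hax
    refine ⟨ContMDiffAt.smul_section ?_ (contMDiffAt_constField hx _), ?_⟩
    · exact (contDiffAt_inv ℝ hax).contMDiffAt.comp x (ha x hx)
    · exact ((diffAt E y x).map_smul _ _).trans (inv_mul_cancel₀ hax)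
  choose! u hu using hloc
  have h1 : ∀ x0 ∈ A, ∃ O : Set M, (∀ x ∈ O, ContMDiffAt 𝓘(ℝ, E) (𝓘(ℝ, E).prod 𝓘(ℝ, E)) ∞
        (fun z => (⟨z, u x0 z⟩ : TangentBundle 𝓘(ℝ, E) M)) x ∧ diffAt E y x (u x0 x) = 1) ∧
        IsOpen O ∧ x0 ∈ O := fun x0 hx0 => eventually_nhds_iff.1 (hu x0 hx0)
  choose! O hO hOo hOx using h1
  obtain ⟨N, hNo, hAN, hNO⟩ := normal_exists_closure_subset hA
    (isOpen_biUnion fun x hx => hOo x hx) (fun x hx => mem_biUnion hx (hOx x hx))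
  obtain ⟨X, hX⟩ := exists_contMDiffSection_forall_mem_convex_of_local (n := (⊤ : ℕ∞)) 𝓘(ℝ, E)
    (TangentSpace 𝓘(ℝ, E) : M → Type _) (fun x => {v | x ∈ N → diffAt E y x v = 1})
    (fun x v hv w hw a b ha hb hab hx => by
      have h1 : diffAt E y x (a • v) = a * 1 :=
        ((diffAt E y x).map_smul a v).trans (congrArg (a * ·) (hv hx))
      have h2 : diffAt E y x (b • w) = b * 1 :=
        ((diffAt E y x).map_smul b w).trans (congrArg (b * ·) (hw hx))
      exact ((diffAt E y x).map_add (a • v) (b • w)).trans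
        ((congrArg₂ (· + ·) h1 h2).trans (by rw [mul_one, mul_one, hab])))
    (fun x => by
      by_cases hx : x ∈ closure N
      · obtain ⟨x0, hx0, hxO⟩ := mem_iUnion₂.1 (hNO hx)
        exact ⟨O x0, (hOo x0 hx0).mem_nhds hxO, u x0,
          fun y hy => (hO x0 hx0 y hy).1.contMDiffWithinAt, fun y hy _ => (hO x0 hx0 y hy).2⟩
      · refine ⟨(closure N)ᶜ, isClosed_closure.isOpen_compl.mem_nhds hx, 0,
          fun y hy => ?_, fun y hy hyN => absurd (subset_closure hyN) hy⟩
        exact (0 : Cₛ^∞⟮𝓘(ℝ, E); E, (TangentSpace 𝓘(ℝ, E) : M → Type _)⟯).contMDiff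
          |>.contMDiffAt.contMDiffWithinAt)
  exact ⟨X, mem_of_superset (hNo.mem_nhdsSet.2 hAN) fun x hx => hX x hx⟩

end VectorFields

/-! ### Division by a defining function -/

section Division
variable {E M : Type*} [NormedAddCommGroup E] [NormedSpace ℝ E] [TopologicalSpace M]
  [ChartedSpace E M] [IsManifold 𝓘(ℝ, E) ∞ M] [FiniteDimensional ℝ E]

/-- The injectivity part of the inverse function theorem, for a map with derivative the identity. -/
lemma hasStrictFDerivAt_eventually_injOn {G : E → E} {e0 : E}
    (hG : HasStrictFDerivAt G (ContinuousLinearMap.id ℝ E) e0) :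
    ∃ s ∈ 𝓝 e0, InjOn G s := by
  have h : HasStrictFDerivAt G ((ContinuousLinearEquiv.refl ℝ E : E ≃L[ℝ] E) : E →L[ℝ] E) e0 := hG
  exact ⟨_, h.toOpenPartialHomeomorph.open_source.mem_nhds h.mem_toOpenPartialHomeomorph_source,
    h.toOpenPartialHomeomorph.injOn⟩

/-- Hadamard's lemma for a curved hypersurface `y = 0` in a vector space: near `e0`, the map
`G e = e + (y e - dy_{e0} e) w` straightens the hypersurface. -/
lemma exists_eq_mul_of_vanishing_on_zeroSet {g y : E → ℝ} {e0 : E}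
    (hg : ∀ᶠ e in 𝓝 e0, ContDiffAt ℝ ∞ g e) (hy : ∀ᶠ e in 𝓝 e0, ContDiffAt ℝ ∞ y e)
    (hdy : fderiv ℝ y e0 ≠ 0) (h0 : ∀ᶠ e in 𝓝 e0, y e = 0 → g e = 0) :
    ∃ h : E → ℝ, ∀ᶠ e in 𝓝 e0, ContDiffAt ℝ ∞ h e ∧ g e = y e * h e := by
  obtain ⟨y', hy', hyy, -⟩ := exists_contDiff_eventuallyEq (Q := fun _ => True)
    (hy.mono fun e he => ⟨he, trivial⟩)
  let L : E →L[ℝ] ℝ := fderiv ℝ y e0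
  obtain ⟨v, hv⟩ : ∃ v, L v ≠ 0 := by
    by_contra! h
    exact hdy (ContinuousLinearMap.ext h)
  let w : E := (L v)⁻¹ • v
  have hw : L w = 1 := by simp [w, hv]
  let G : E → E := fun e => e + (y' e - L e) • w
  have hG : ContDiff ℝ ∞ G := contDiff_id.add ((hy'.sub L.contDiff).smul contDiff_const)
  have hG' : HasStrictFDerivAt G (ContinuousLinearMap.id ℝ E) e0 := by
    have h1 : HasStrictFDerivAt y' L e0 := by
      have := hy'.contDiffAt.hasStrictFDerivAt (x := e0) (by simp)
      rwa [hyy.fderiv_eq] at this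
    have h2 := (hasStrictFDerivAt_id e0).add ((h1.sub L.hasStrictFDerivAt).smul_const w)
    have h3 : ContinuousLinearMap.id ℝ E + (L - L).smulRight w = ContinuousLinearMap.id ℝ E := by
      ext; simp
    rw [h3] at h2
    exact h2
  have hLG : ∀ e, L (G e) = y' e := fun e => by simp [G, hw]
  -- `H` is a local inverse of `G`
  let Ψ : E × E → E := fun q => G q.2 - q.1
  obtain ⟨H, hH0, hH⟩ := exists_smooth_implicitFunction (Ψ := Ψ) (p0 := G e0) (c0 := e0)
    ((hG.comp contDiff_snd).sub contDiff_fst) (sub_self _) (by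
      have h1 : HasFDerivAt (fun e => Ψ (G e0, e)) (fderiv ℝ Ψ (G e0, e0) ∘L .inr ℝ E E) e0 :=
        ((((hG.comp contDiff_snd).sub contDiff_fst : ContDiff ℝ ∞ Ψ).differentiable
          (by simp) _).hasFDerivAt).comp e0 (hasFDerivAt_prodMk_right _ _)
      exact h1.unique (hG'.hasFDerivAt.sub_const _))
  have hHG : ∀ᶠ q in 𝓝 (G e0), G (H q) = q := hH.mono fun q hq => sub_eq_zero.1 hq.2
  have hHc : Tendsto H (𝓝 (G e0)) (𝓝 e0) := by
    have := hH.self_of_nhds.1.continuousAt.tendsto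
    rwa [hH0] at this
  have hGc : Tendsto G (𝓝 e0) (𝓝 (G e0)) := hG.continuous.continuousAt
  obtain ⟨f, hf, hgf⟩ := exists_eq_mul_of_vanishing (g := g ∘ H) (e0 := G e0) (L := L) (w := w)
    (by
      filter_upwards [hH, hHc.eventually hg] with q hq hq'
      exact hq'.comp q hq.1) hw
    (by
      filter_upwards [hHG, hHc.eventually h0, hHc.eventually hyy] with q h1 h2 h3 h4
      refine h2 ?_
      rw [← h3, ← hLG, h1, h4])
  obtain ⟨s, hs, hinj⟩ := hasStrictFDerivAt_eventually_injOn hG'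
  have hHGe : ∀ᶠ e in 𝓝 e0, H (G e) = e := by
    filter_upwards [hs, (hHc.comp hGc).eventually hs, hGc.eventually hHG] with e h1 h2 h3
    exact hinj h2 h1 h3
  refine ⟨f ∘ G, ?_⟩
  filter_upwards [hHGe, hGc.eventually hgf, hyy] with e h1 h2 h3
  refine ⟨(hf.comp hG).contDiffAt, ?_⟩
  rw [Function.comp_apply, h1, hLG, h3] at h2
  exact h2

lemma eventually_contDiffAt_fnInChart {f : M → ℝ} {x0 : M}
    (hf : ∀ᶠ x in 𝓝 x0, ContMDiffAt 𝓘(ℝ, E) 𝓘(ℝ, ℝ) ∞ f x) :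
    ∀ᶠ e in 𝓝 (extChartAt 𝓘(ℝ, E) x0 x0),
      ContDiffAt ℝ ∞ (fun e => f ((extChartAt 𝓘(ℝ, E) x0).symm e)) e := by
  filter_upwards [eventually_mem_chart_target (mem_extChartAt_source x0) hf] with e he
  have := contDiffAt_fnInChart ((extChartAt 𝓘(ℝ, E) x0).map_target he.1) he.2
  rwa [(extChartAt 𝓘(ℝ, E) x0).right_inv he.1] at this

lemma fderiv_fnInChart_ne_zero {y : M → ℝ} {x0 : M}
    (hy : MDifferentiableAt 𝓘(ℝ, E) 𝓘(ℝ, ℝ) y x0) (hdy : diffAt E y x0 ≠ 0) :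
    fderiv ℝ (fun e => y ((extChartAt 𝓘(ℝ, E) x0).symm e)) (extChartAt 𝓘(ℝ, E) x0 x0) ≠ 0 := by
  intro h
  rw [← diffAt_comp_chart_symm (mem_extChartAt_target (I := 𝓘(ℝ, E)) x0)
    (by rwa [extChartAt_to_inv]), extChartAt_to_inv] at h
  refine hdy (ContinuousLinearMap.ext fun v => ?_)
  have h3 := mfderiv_symm_comp_chart (mem_extChartAt_source (I := 𝓘(ℝ, E)) x0) v
  have h4 := DFunLike.congr_fun h (chartDeriv x0 x0 v)
  exact (congrArg (diffAt E y x0) h3).symm.trans h4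

/-- Hadamard's lemma on a manifold: a function vanishing on the hypersurface `y = 0` is locally
divisible by `y`. -/
lemma exists_eq_mul_function {g y : M → ℝ} {x0 : M}
    (hg : ∀ᶠ x in 𝓝 x0, ContMDiffAt 𝓘(ℝ, E) 𝓘(ℝ, ℝ) ∞ g x)
    (hy : ∀ᶠ x in 𝓝 x0, ContMDiffAt 𝓘(ℝ, E) 𝓘(ℝ, ℝ) ∞ y x)
    (hdy : diffAt E y x0 ≠ 0) (h0 : ∀ᶠ x in 𝓝 x0, y x = 0 → g x = 0) :
    ∃ h : M → ℝ, ∀ᶠ x in 𝓝 x0, ContMDiffAt 𝓘(ℝ, E) 𝓘(ℝ, ℝ) ∞ h x ∧ g x = y x * h x := by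
  obtain ⟨h, hh⟩ := exists_eq_mul_of_vanishing_on_zeroSet (eventually_contDiffAt_fnInChart hg)
    (eventually_contDiffAt_fnInChart hy)
    (fderiv_fnInChart_ne_zero (hy.self_of_nhds.mdifferentiableAt (by simp)) hdy)
    ((eventually_mem_chart_target (mem_extChartAt_source x0) h0).mono fun e he => he.2)
  refine ⟨h ∘ extChartAt 𝓘(ℝ, E) x0, ?_⟩
  filter_upwards [(continuousAt_extChartAt (I := 𝓘(ℝ, E)) x0).eventually hh,
    extChartAt_source_mem_nhds (I := 𝓘(ℝ, E)) x0] with x hx hxs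
  refine ⟨(contMDiffAt_iff_contDiffAt.2 hx.1).comp x (contMDiffAt_chart hxs), ?_⟩
  have := hx.2
  rwa [(extChartAt 𝓘(ℝ, E) x0).left_inv hxs] at this

end Division

/-! ### A retraction onto the hypersurface -/

section Retraction
variable {E M : Type*} [NormedAddCommGroup E] [NormedSpace ℝ E] [TopologicalSpace M]
  [ChartedSpace E M]

open Classical in
/-- The point reached from `x` at time `1` along the integral curve of `-y(x) X`. If `dy(X) = 1`
along this curve, then `y` vanishes at the endpoint. The value is `x` if there is no such curve. -/
def flowEndpoint (y : M → ℝ) (X : ∀ x : M, TangentSpace 𝓘(ℝ, E) x) (x : M) : M :=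
  if h : ∃ γ : ℝ → M, γ 0 = x ∧ IsMIntegralCurveOn γ (fun z => (-y x) • X z) (Ioo (-1) 2) then
    h.choose 1 else x

variable [IsManifold 𝓘(ℝ, E) ∞ M] [T2Space M] [FiniteDimensional ℝ E] {y : M → ℝ}
  {X : ∀ x : M, TangentSpace 𝓘(ℝ, E) x}

/-- The endpoint does not depend on the choice of the integral curve. -/
lemma flowEndpoint_eq (hX : ContMDiff 𝓘(ℝ, E) (𝓘(ℝ, E).prod 𝓘(ℝ, E)) ∞
      (fun y => (⟨y, X y⟩ : TangentBundle 𝓘(ℝ, E) M))) {x : M} {γ : ℝ → M} (h0 : γ 0 = x)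
    (hγ : IsMIntegralCurveOn γ (fun z => (-y x) • X z) (Ioo (-1) 2)) :
    flowEndpoint y X x = γ 1 := by
  have h : ∃ γ : ℝ → M, γ 0 = x ∧ IsMIntegralCurveOn γ (fun z => (-y x) • X z) (Ioo (-1) 2) :=
    ⟨γ, h0, hγ⟩
  rw [flowEndpoint, dif_pos h]
  have : CompleteSpace E := FiniteDimensional.complete ℝ E
  have : IsManifold 𝓘(ℝ, E) 1 M := .of_le (n := ∞) (by simp)
  have hs : ContMDiff 𝓘(ℝ, E) (𝓘(ℝ, E).prod 𝓘(ℝ, E)) 1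
      (fun z => (⟨z, (-y x) • X z⟩ : TangentBundle 𝓘(ℝ, E) M)) := fun z =>
    (ContMDiffAt.smul_section (contMDiffAt_const (c := -y x)) (hX z)).of_le (by simp)
  exact isMIntegralCurveOn_Ioo_eqOn_of_contMDiff_boundaryless (t₀ := 0) (by norm_num) hs
    h.choose_spec.2 hγ (h.choose_spec.1.trans h0.symm) (by norm_num)

/-- Points of the hypersurface are fixed: there the field `-y(x) X` is zero. -/
lemma flowEndpoint_eq_self (hX : ContMDiff 𝓘(ℝ, E) (𝓘(ℝ, E).prod 𝓘(ℝ, E)) ∞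
      (fun y => (⟨y, X y⟩ : TangentBundle 𝓘(ℝ, E) M))) {x : M} (hx : y x = 0) :
    flowEndpoint y X x = x := by
  refine flowEndpoint_eq (γ := fun _ => x) hX rfl fun t _ => ?_
  have h := hasMFDerivAt_const (I := 𝓘(ℝ, ℝ)) (I' := 𝓘(ℝ, E)) x t
  have h2 : ((1 : ℝ →L[ℝ] ℝ).smulRight ((-y x) • X x) : ℝ →L[ℝ] TangentSpace 𝓘(ℝ, E) x) = 0 := by
    rw [hx, neg_zero, zero_smul]
    ext
    exact smul_zero _
  rw [h2]
  exact h.hasMFDerivWithinAt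

/-- The flow endpoint is a smooth map near the hypersurface, with values in the hypersurface. -/
lemma eventually_flowEndpoint (hX : ContMDiff 𝓘(ℝ, E) (𝓘(ℝ, E).prod 𝓘(ℝ, E)) ∞
      (fun y => (⟨y, X y⟩ : TangentBundle 𝓘(ℝ, E) M))) (hy : ContMDiff 𝓘(ℝ, E) 𝓘(ℝ, ℝ) ∞ y)
    {z0 : M} (hz0 : y z0 = 0) (hyX : ∀ᶠ x in 𝓝 z0, diffAt E y x (X x) = 1) :
    ∀ᶠ x in 𝓝 z0, ContMDiffAt 𝓘(ℝ, E) 𝓘(ℝ, E) ∞ (flowEndpoint y X) x ∧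
      y (flowEndpoint y X x) = 0 := by
  have : CompleteSpace E := FiniteDimensional.complete ℝ E
  let φ := extChartAt 𝓘(ℝ, E) z0
  have hs := mem_extChartAt_source (I := 𝓘(ℝ, E)) z0
  have hVs : ∀ᶠ e in 𝓝 (φ z0), ContDiffAt ℝ ∞ (vecInChart X z0) e := by
    filter_upwards [(isOpen_extChartAt_target z0).mem_nhds (φ.map_source hs)] with e he
    have := contDiffAt_vecInChart (φ.map_target he) (hX (φ.symm e))
    rwa [φ.right_inv he] at this
  obtain ⟨V, hV, hVX, -⟩ := exists_contDiff_eventuallyEq (Q := fun _ => True)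
    (hVs.mono fun e he => ⟨he, trivial⟩)
  obtain ⟨G, hGc, hG0, hG⟩ := exists_smooth_flow hV (φ z0)
  obtain ⟨r, hr, hball⟩ := Metric.eventually_nhds_iff_ball.1
    (hVX.and (eventually_mem_chart_target hs hyX))
  have hqc : ContinuousAt (fun x => (φ x, -y x)) z0 :=
    (continuousAt_extChartAt z0).prodMk (hy.continuous.neg.continuousAt)
  have hq : Tendsto (fun x => (φ x, -y x)) (𝓝 z0) (𝓝 (φ z0, (0 : ℝ))) := by
    have := hqc.tendsto
    rwa [hz0, neg_zero] at this
  -- the curves stay in the ball where `V` is the expression of `X` and where `dy(X) = 1`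
  have hGball : ∀ᶠ q in 𝓝 (φ z0, (0 : ℝ)), ∀ t, extendTime (G q) t ∈ Metric.ball (φ z0) r := by
    filter_upwards [hGc (Metric.ball_mem_nhds _ hr)] with q hq t
    have h1 : dist (G q) (G (φ z0, 0)) < r := hq
    have h2 := (ContinuousMap.dist_apply_le_dist (projIcc (-1) 2 timeInterval_le t)).trans_lt h1
    rwa [hG0] at h2
  have key : ∀ᶠ x in 𝓝 z0, x ∈ φ.source ∧ ContDiffAt ℝ ∞ G (φ x, -y x) ∧
      extendTime (G (φ x, -y x)) 1 ∈ φ.target ∧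
      flowEndpoint y X x = φ.symm (extendTime (G (φ x, -y x)) 1) ∧ y (flowEndpoint y X x) = 0 := by
    filter_upwards [extChartAt_source_mem_nhds (I := 𝓘(ℝ, E)) z0, hq.eventually hG,
      hq.eventually hGball] with x hx hGx hGb
    let c : ℝ → E := extendTime (G (φ x, -y x))
    have hc0 : φ.symm (c 0) = x := by
      have : c 0 = φ x := hGx.2.1
      rw [this, φ.left_inv hx]
    have hγ : ∀ t ∈ Ioo (-1 : ℝ) 2, HasMFDerivAt 𝓘(ℝ, ℝ) 𝓘(ℝ, E) (φ.symm ∘ c) t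
        ((1 : ℝ →L[ℝ] ℝ).smulRight ((-y x) • X (φ.symm (c t)))) := by
      intro t ht
      have hct := hball _ (hGb t)
      have h1 := (mdifferentiableAt_chart_symm hct.2.1).hasMFDerivAt.comp t
        (hGx.2.2 t ht).hasFDerivAt.hasMFDerivAt
      refine HasMFDerivAt.congr_mfderiv h1 (ContinuousLinearMap.ext fun s => ?_)
      have h2 := mfderiv_symm_comp_chart (φ.map_target hct.2.1) (X (φ.symm (c t)))
      rw [φ.right_inv hct.2.1] at h2
      have h3 : ∀ s : ℝ, symmDeriv z0 (c t) (s • (-y x) • V (c t)) =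
          s • (-y x) • symmDeriv z0 (c t) (vecInChart X z0 (c t)) := fun s => by
        rw [map_smul, map_smul, hct.1]
      exact (h3 s).trans (congrArg (fun v : E => (id s : ℝ) • (-y x) • v) h2)
    have hend : flowEndpoint y X x = φ.symm (c 1) :=
      flowEndpoint_eq (γ := φ.symm ∘ c) hX hc0 fun t ht => (hγ t ht).hasMFDerivWithinAt
    refine ⟨hx, hGx.1, (hball _ (hGb 1)).2.1, hend, ?_⟩
    -- `y` has the constant derivative `-y x` along the curve, hence is zero at time `1`
    have hd : ∀ t ∈ uIcc (0 : ℝ) 1, HasDerivAt (fun s => y (φ.symm (c s))) (-y x) t := by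
      intro t ht
      rw [uIcc_of_le zero_le_one] at ht
      have hct := hball _ (hGb t)
      have h1 := ((hy (φ.symm (c t))).mdifferentiableAt (by simp)).hasMFDerivAt.comp t
        (hγ t ⟨by linarith [ht.1], by linarith [ht.2]⟩)
      let v : E := X (φ.symm (c t))
      have h2 : HasFDerivAt (fun s => y (φ.symm (c s))) ((diffAt E y (φ.symm (c t))).comp
          ((1 : ℝ →L[ℝ] ℝ).smulRight ((-y x) • v))) t := hasMFDerivAt_iff_hasFDerivAt.1 h1
      have h3 : diffAt E y (φ.symm (c t)) v = 1 := hct.2.2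
      refine h2.hasDerivAt.congr_deriv ?_
      simp [h3]
    have h5 := intervalIntegral.integral_eq_sub_of_hasDerivAt hd (by simp)
    rw [intervalIntegral.integral_const, hc0, sub_zero, one_smul] at h5
    rw [hend]
    linarith
  filter_upwards [key.eventually_nhds] with x hx
  refine ⟨?_, hx.self_of_nhds.2.2.2.2⟩
  have h1 : ContMDiffAt 𝓘(ℝ, E) 𝓘(ℝ, E × ℝ) ∞ (fun x => (φ x, -y x)) x :=
    (contMDiffAt_chart hx.self_of_nhds.1).prodMk_space (hy x).neg
  let ev : C(TimeInterval, E) →L[ℝ] E :=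
    ContinuousMap.evalCLM ℝ (⟨1, by norm_num, by norm_num⟩ : TimeInterval)
  have h2 : ContMDiffAt 𝓘(ℝ, E) 𝓘(ℝ, E) ∞ (fun x => ev (G (φ x, -y x))) x :=
    ContMDiffAt.comp x (g := fun q => ev (G q))
      (contMDiffAt_iff_contDiffAt.2 ((ev.contDiff.contDiffAt).comp _ hx.self_of_nhds.2.1)) h1
  have hev : ∀ q, ev (G q) = extendTime (G q) 1 := fun q =>
    (extendTime_coe (G q) ⟨1, by norm_num, by norm_num⟩).symm
  refine ContMDiffAt.congr_of_eventuallyEq (ContMDiffAt.comp x (g := φ.symm) ?_ h2) ?_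
  · rw [hev]
    exact contMDiffAt_chart_symm hx.self_of_nhds.2.2.1
  · filter_upwards [hx] with x' hx'
    rw [hx'.2.2.2.1, Function.comp_apply, hev]

end Retraction

section EmbeddedRetraction
variable {E M F Z : Type*} [NormedAddCommGroup E] [NormedSpace ℝ E] [TopologicalSpace M]
  [ChartedSpace E M] [IsManifold 𝓘(ℝ, E) ∞ M] [T2Space M] [SigmaCompactSpace M]
  [FiniteDimensional ℝ E] [NormedAddCommGroup F] [NormedSpace ℝ F] [TopologicalSpace Z]
  [ChartedSpace F Z] [IsManifold 𝓘(ℝ, F) ∞ Z]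

/-- A map into `Z` is smooth if it is smooth as a map into the ambient manifold. -/
lemma contMDiffAt_of_comp_embedding {incl : Z → M}
    (hi : Manifold.IsSmoothEmbedding 𝓘(ℝ, F) 𝓘(ℝ, E) ∞ incl) {f : M → Z} {x : M}
    (hf : ContMDiffAt 𝓘(ℝ, E) 𝓘(ℝ, E) ∞ (incl ∘ f) x) :
    ContMDiffAt 𝓘(ℝ, E) 𝓘(ℝ, F) ∞ f x :=
  (ContMDiffAt.iff_comp_isImmersionAt (hi.isImmersion.isImmersionAt (f x))).2
    ⟨hi.isEmbedding.isInducing.continuousAt_iff.2 hf.continuousAt, hf⟩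

/-- A closed hypersurface with a defining function has a neighbourhood with a smooth retraction. -/
lemma exists_smooth_retraction [Nonempty Z] {incl : Z → M}
    (hi : Manifold.IsSmoothEmbedding 𝓘(ℝ, F) 𝓘(ℝ, E) ∞ incl)
    {y : M → ℝ} (hy : ContMDiff 𝓘(ℝ, E) 𝓘(ℝ, ℝ) ∞ y) {X : ∀ x : M, TangentSpace 𝓘(ℝ, E) x}
    (hX : ContMDiff 𝓘(ℝ, E) (𝓘(ℝ, E).prod 𝓘(ℝ, E)) ∞
      (fun y => (⟨y, X y⟩ : TangentBundle 𝓘(ℝ, E) M)))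
    (h : ∀ z, ∀ᶠ x in 𝓝 (incl z), diffAt E y x (X x) = 1 ∧ (y x = 0 ↔ x ∈ range incl)) :
    ∃ π : M → Z, (∀ z, π (incl z) = z) ∧
      ∀ z, ∀ᶠ x in 𝓝 (incl z), ContMDiffAt 𝓘(ℝ, E) 𝓘(ℝ, F) ∞ π x := by
  have hy0 : ∀ z, y (incl z) = 0 := fun z => (h z).self_of_nhds.2.2 ⟨z, rfl⟩
  -- near `Z` the endpoint lies in the range of `incl`, elsewhere the value does not matter
  let π : M → Z := fun x => Function.invFun incl (flowEndpoint y X x)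
  have hπ : ∀ z, π (incl z) = z := fun z => by
    simp only [π]
    rw [flowEndpoint_eq_self hX (hy0 z)]
    exact Function.leftInverse_invFun hi.isEmbedding.injective z
  refine ⟨π, hπ, fun z => ?_⟩
  have h1 := eventually_flowEndpoint hX hy (hy0 z) ((h z).mono fun x hx => hx.1)
  have h2 : Tendsto (flowEndpoint y X) (𝓝 (incl z)) (𝓝 (incl z)) := by
    have := h1.self_of_nhds.1.continuousAt.tendsto
    rwa [flowEndpoint_eq_self hX (hy0 z)] at this
  filter_upwards [h1.eventually_nhds, (h2.eventually (h z)).eventually_nhds] with x hx hx'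
  refine contMDiffAt_of_comp_embedding hi (hx.self_of_nhds.1.congr_of_eventuallyEq ?_)
  filter_upwards [hx, hx'] with x' h3 h4
  exact Function.invFun_eq (h4.2.1 h3.2)

end EmbeddedRetraction

/-! ### Extension of forms from their values on vector fields -/

section Evaluation
variable {E M : Type*} [NormedAddCommGroup E] [NormedSpace ℝ E] [TopologicalSpace M]
  [ChartedSpace E M] {p : ℕ} {A : Set M}

/-- The form on the domain of the preferred chart at `x0` with a given expression in this chart. -/
def ofChart (x0 : M) (η : E → E [⋀^Fin p]→L[ℝ] ℝ) : FormField E M p where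
  toFun x := (η (extChartAt 𝓘(ℝ, E) x0 x)).compContinuousLinearMap (chartDeriv x0 x)

variable [IsManifold 𝓘(ℝ, E) ∞ M]

lemma inChart_ofChart {x0 : M} (η : E → E [⋀^Fin p]→L[ℝ] ℝ) {e : E}
    (he : e ∈ (extChartAt 𝓘(ℝ, E) x0).target) : inChart (ofChart x0 η) x0 e = η e := by
  ext v
  have h : η (extChartAt 𝓘(ℝ, E) x0 ((extChartAt 𝓘(ℝ, E) x0).symm e)) = η e := by
    rw [(extChartAt 𝓘(ℝ, E) x0).right_inv he]
  exact (congrArg (η _) (funext fun i => mfderiv_chart_comp_symm he (v i))).trans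
    (DFunLike.congr_fun h v)

lemma smoothAt_ofChart [FiniteDimensional ℝ E] {x0 x : M} {η : E → E [⋀^Fin p]→L[ℝ] ℝ}
    (hx : x ∈ (extChartAt 𝓘(ℝ, E) x0).source)
    (hη : ContDiffAt ℝ ∞ η (extChartAt 𝓘(ℝ, E) x0 x)) : SmoothAt (ofChart x0 η) x := by
  rw [smoothAt_iff hx]
  refine hη.congr_of_eventuallyEq ?_
  filter_upwards [(isOpen_extChartAt_target x0).mem_nhds ((extChartAt 𝓘(ℝ, E) x0).map_source hx)]
    with e he
  exact inChart_ofChart η he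

lemma ofChart_inChart {x0 x : M} (σ : FormField E M p)
    (hx : x ∈ (extChartAt 𝓘(ℝ, E) x0).source) : ofChart x0 (inChart σ x0) x = σ x := by
  ext v
  have h : σ ((extChartAt 𝓘(ℝ, E) x0).symm (extChartAt 𝓘(ℝ, E) x0 x)) = σ x := by
    rw [(extChartAt 𝓘(ℝ, E) x0).left_inv hx]
  exact (congrArg (σ _) (funext fun i => mfderiv_symm_comp_chart hx (v i))).trans
    (DFunLike.congr_fun h v)

/-- The coefficients of a form in a chart are its values on the constant fields of the chart. -/
lemma inChart_apply_eq {x0 x : M} (σ : FormField E M p)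
    (hx : x ∈ (extChartAt 𝓘(ℝ, E) x0).source) (v : Fin p → E) :
    inChart σ x0 (extChartAt 𝓘(ℝ, E) x0 x) v = σ x (fun i => constField x0 (v i) x) := by
  have h : σ ((extChartAt 𝓘(ℝ, E) x0).symm (extChartAt 𝓘(ℝ, E) x0 x)) = σ x := by
    rw [(extChartAt 𝓘(ℝ, E) x0).left_inv hx]
  exact DFunLike.congr_fun h _

lemma ExtendsAt.of_notMem (hA : IsClosed A) {σ : FormField E M p} {x : M} (hx : x ∉ A)
    (hσ : ∀ y ∉ A, SmoothAt σ y) : ExtendsAt A σ x :=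
  ⟨σ, by filter_upwards [hA.isOpen_compl.mem_nhds hx] with y hy using ⟨hσ y hy, fun _ => rfl⟩⟩

variable [FiniteDimensional ℝ E]

/-- A form extends over `A` near `x0` if its values on the constant fields of a chart do. -/
lemma extendsAt_of_apply_constField {σ : FormField E M p} {x0 : M}
    (h : ∀ v : Fin p → E, ∃ g : M → ℝ, ∀ᶠ x in 𝓝 x0, ContMDiffAt 𝓘(ℝ, E) 𝓘(ℝ, ℝ) ∞ g x ∧
      (x ∉ A → g x = σ x (fun i => constField x0 (v i) x))) : ExtendsAt A σ x0 := by
  choose g hg using h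
  obtain ⟨ι, _, v, L, hL⟩ := exists_leftInverse_eval (E' := E) p
  have hall : ∀ᶠ x in 𝓝 x0, ∀ i, ContMDiffAt 𝓘(ℝ, E) 𝓘(ℝ, ℝ) ∞ (g (v i)) x ∧
      (x ∉ A → g (v i) x = σ x (fun j => constField x0 (v i j) x)) :=
    eventually_all.2 fun i => hg (v i)
  refine ⟨ofChart x0 fun e => L fun i => g (v i) ((extChartAt 𝓘(ℝ, E) x0).symm e), ?_⟩
  filter_upwards [hall, extChartAt_source_mem_nhds (I := 𝓘(ℝ, E)) x0] with x hx hxs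
  refine ⟨smoothAt_ofChart hxs ?_, fun hxA => ?_⟩
  · exact L.contDiff.contDiffAt.comp _ (contDiffAt_pi.2 fun i => contDiffAt_fnInChart hxs (hx i).1)
  · rw [← ofChart_inChart σ hxs]
    have h2 : (L fun i => g (v i) ((extChartAt 𝓘(ℝ, E) x0).symm (extChartAt 𝓘(ℝ, E) x0 x))) =
        inChart σ x0 (extChartAt 𝓘(ℝ, E) x0 x) := by
      rw [(extChartAt 𝓘(ℝ, E) x0).left_inv hxs, ← hL (inChart σ x0 (extChartAt 𝓘(ℝ, E) x0 x))]
      refine congrArg L (funext fun i => ?_)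
      rw [(hx i).2 hxA, inChart_apply_eq σ hxs]
    exact congrArg (fun β : E [⋀^Fin p]→L[ℝ] ℝ => β.compContinuousLinearMap (chartDeriv x0 x)) h2

lemma contMDiffAt_apply_constField {τ : FormField E M p} {x0 x : M} (v : Fin p → E)
    (hx : x ∈ (extChartAt 𝓘(ℝ, E) x0).source) (hτ : SmoothAt τ x) :
    ContMDiffAt 𝓘(ℝ, E) 𝓘(ℝ, ℝ) ∞ (fun x => τ x (fun i => constField x0 (v i) x)) x :=
  SmoothAt.apply (v := fun i => constField x0 (v i)) (fun i => contMDiffAt_constField hx (v i)) hτ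

/-- Division of forms: if `yσ` extends to a smooth form that vanishes where `y` does, then `σ`
extends. -/
lemma extendsAt_of_fnSmul {y : M → ℝ} {σ τ : FormField E M p} {x0 : M}
    (hτ : ∀ᶠ x in 𝓝 x0, SmoothAt τ x)
    (hy : ∀ᶠ x in 𝓝 x0, ContMDiffAt 𝓘(ℝ, E) 𝓘(ℝ, ℝ) ∞ y x)
    (hdy : diffAt E y x0 ≠ 0) (h0 : ∀ᶠ x in 𝓝 x0, y x = 0 → τ x = 0)
    (h1 : ∀ᶠ x in 𝓝 x0, x ∉ A → y x ≠ 0 ∧ τ x = y x • σ x) : ExtendsAt A σ x0 := by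
  refine extendsAt_of_apply_constField fun v => ?_
  obtain ⟨h, hh⟩ := exists_eq_mul_function (x0 := x0)
    (g := fun x => τ x (fun i => constField x0 (v i) x)) (by
      filter_upwards [hτ, extChartAt_source_mem_nhds (I := 𝓘(ℝ, E)) x0] with x hx hxs
      exact contMDiffAt_apply_constField v hxs hx) hy hdy
    (h0.mono fun x hx hyx => by rw [hx hyx]; rfl)
  refine ⟨h, ?_⟩
  filter_upwards [hh, h1] with x h2 h3
  refine ⟨h2.1, fun hxA => ?_⟩
  obtain ⟨h4, h5⟩ := h3 hxA
  have h6 := h2.2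
  rw [h5] at h6
  exact (mul_left_cancel₀ h4 h6).symm

end Evaluation

/-! ### Defining functions with a transverse vector field -/

section Collar
variable {k : ℕ} {E F M Z : Type*}
  [NormedAddCommGroup E] [NormedSpace ℝ E] [NormedAddCommGroup F] [NormedSpace ℝ F]
  [TopologicalSpace M] [ChartedSpace E M] [IsManifold 𝓘(ℝ, E) ∞ M]
  [TopologicalSpace Z] [ChartedSpace F Z]

/-- A defining function `y` in the jet class, with a vector field `X` such that `dy(X) = 1` near the
hypersurface. -/
structure Collar (B : BkManifold k E F M Z) where
  /-- the defining function -/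
  y : C^∞⟮𝓘(ℝ, E), M; ℝ⟯
  /-- the transverse vector field -/
  X : Cₛ^∞⟮𝓘(ℝ, E); E, (TangentSpace 𝓘(ℝ, E) : M → Type _)⟯
  mk_y : Ideal.Quotient.mk _ y = B.jet
  eventually_y : ∀ z, ∀ᶠ x in 𝓝 (B.incl z),
    diffAt E y x (X x) = 1 ∧ (y x = 0 ↔ x ∈ range B.incl)

/-- The defining function represents the jet, and the transverse field exists since `dy` does not
vanish on the closed set `Z`. -/
lemma exists_collar [FiniteDimensional ℝ E] [T2Space M] [SigmaCompactSpace M]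
    (B : BkManifold k E F M Z) : Nonempty (Collar B) := by
  obtain ⟨y, ⟨⟨W, hWo, hW, hyW⟩, hdy⟩, hyj⟩ := B.exists_rep
  obtain ⟨X, hX⟩ := exists_transverse_vectorField y.contMDiff B.isClosed_range (by
    rintro _ ⟨z, rfl⟩
    exact hdy z)
  refine ⟨⟨y, X, hyj, fun z => ?_⟩⟩
  filter_upwards [hX.filter_mono (nhds_le_nhdsSet (mem_range_self z)),
    hWo.mem_nhds (hW (mem_range_self z))] with x h1 h2
  exact ⟨h1, hyW x h2⟩

namespace Collar
variable {B : BkManifold k E F M Z} (C : Collar B)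

lemma y_incl (z : Z) : C.y (B.incl z) = 0 := (C.eventually_y z).self_of_nhds.2.2 ⟨z, rfl⟩

lemma diffAt_ne_zero (z : Z) : diffAt E C.y (B.incl z) ≠ 0 := fun h => by
  have h1 := (C.eventually_y z).self_of_nhds.1
  rw [h] at h1
  exact zero_ne_one h1

lemma smooth_y : ContMDiff 𝓘(ℝ, E) 𝓘(ℝ, ℝ) ∞ C.y := C.y.contMDiff

lemma smooth_X : ContMDiff 𝓘(ℝ, E) (𝓘(ℝ, E).prod 𝓘(ℝ, E)) ∞
    (fun x => (⟨x, C.X x⟩ : TangentBundle 𝓘(ℝ, E) M)) := C.X.contMDiff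

include C in
/-- The complement of the hypersurface is dense, because `dy` does not vanish there. -/
lemma dense_compl : Dense (range B.incl)ᶜ := by
  rw [← interior_eq_empty_iff_dense_compl]
  refine eq_empty_iff_forall_notMem.2 fun x hx => ?_
  obtain ⟨z, rfl⟩ := interior_subset hx
  have h : (C.y : M → ℝ) =ᶠ[𝓝 (B.incl z)] fun _ => 0 := by
    filter_upwards [mem_interior_iff_mem_nhds.1 hx] with x hx
    obtain ⟨z', rfl⟩ := hx
    exact C.y_incl z'
  refine C.diffAt_ne_zero z ?_
  have h2 : diffAt E C.y (B.incl z) = diffAt E (fun _ : M => (0 : ℝ)) (B.incl z) := h.mfderiv_eq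
  rw [h2]
  exact mfderiv_const

lemma eventually_ne_zero (z : Z) : ∀ᶠ x in 𝓝 (B.incl z), x ∉ range B.incl → C.y x ≠ 0 :=
  (C.eventually_y z).mono fun _ hx hxA h => hxA (hx.2.1 h)

end Collar
end Collar

/-! ### The filtration by the order of the pole -/

section ExteriorDerivative
variable {E M : Type*} [NormedAddCommGroup E] [NormedSpace ℝ E] [TopologicalSpace M]
  [ChartedSpace E M] {p : ℕ} {U : TopologicalSpace.Opens M}

lemma smoothAt_of_mem {σ : FormField E M p} (hσ : σ ∈ smoothForms U p) {x : M} (hx : x ∈ U) :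
    SmoothAt σ x := hσ.1 x hx

lemma eventually_smoothAt_of_mem {σ : FormField E M p} (hσ : σ ∈ smoothForms U p) {x : M}
    (hx : x ∈ U) : ∀ᶠ y in 𝓝 x, SmoothAt σ y := by
  filter_upwards [U.isOpen.mem_nhds hx] with y hy using hσ.1 y hy

lemma d_apply_of_mem (σ : smoothForms (E := E) U p) {x : M} (hx : x ∈ U) :
    d U p σ x = extDerivField σ.1 x := if_pos hx

lemma d_apply_of_notMem (σ : smoothForms (E := E) U p) {x : M} (hx : x ∉ U) :
    d U p σ x = 0 := if_neg hx

variable [IsManifold 𝓘(ℝ, E) ∞ M] [FiniteDimensional ℝ E]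

lemma d_mem_smoothForms (σ : smoothForms (E := E) U p) : d U p σ ∈ smoothForms U (p + 1) := by
  refine ⟨fun x hx => ?_, fun x hx => d_apply_of_notMem σ hx⟩
  refine (SmoothAt.extDerivField (eventually_smoothAt_of_mem σ.2 hx)).congr ?_
  filter_upwards [U.isOpen.mem_nhds hx] with y hy
  exact (d_apply_of_mem σ hy).symm

end ExteriorDerivative

section Differential
variable {E M : Type*} [NormedAddCommGroup E] [NormedSpace ℝ E] [TopologicalSpace M]
  [ChartedSpace E M]

/-- The differential of `f ^ j` is `j f ^ (j - 1) df`; for `j = 0` both sides are zero. -/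
lemma diffAt_pow {f : M → ℝ} {x : M} (hf : MDifferentiableAt 𝓘(ℝ, E) 𝓘(ℝ, ℝ) f x) (j : ℕ) :
    diffAt E (fun x => f x ^ j) x = ((j : ℝ) * f x ^ (j - 1)) • diffAt E f x := by
  have h1 : HasMFDerivAt 𝓘(ℝ, ℝ) 𝓘(ℝ, ℝ) (fun t : ℝ => t ^ j) (f x)
      ((1 : ℝ →L[ℝ] ℝ).smulRight ((j : ℝ) * f x ^ (j - 1))) :=
    (hasDerivAt_pow j (f x)).hasFDerivAt.hasMFDerivAt
  have h2 := (h1.comp x hf.hasMFDerivAt).mfderiv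
  refine ContinuousLinearMap.ext fun v => (DFunLike.congr_fun h2 v).trans ?_
  exact mul_comm (diffAt E f x v) _

end Differential

namespace Collar
variable {k : ℕ} {E F M Z : Type*}
  [NormedAddCommGroup E] [NormedSpace ℝ E] [NormedAddCommGroup F] [NormedSpace ℝ F]
  [TopologicalSpace M] [ChartedSpace E M] [IsManifold 𝓘(ℝ, E) ∞ M] [FiniteDimensional ℝ E]
  [TopologicalSpace Z] [ChartedSpace F Z]
variable {B : BkManifold k E F M Z} (C : Collar B) {p : ℕ}

/-- The transverse vector field, with values in the model space. -/
def vec : M → E := C.X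

lemma eventually_vec (z : Z) : ∀ᶠ x in 𝓝 (B.incl z),
    diffAt E C.y x (C.vec x) = 1 ∧ (C.y x = 0 ↔ x ∈ range B.incl) := C.eventually_y z

lemma smoothAt_contract_vec {α : FormField E M (p + 1)} {x : M} (hα : SmoothAt α x) :
    SmoothAt (contract C.vec α) x := hα.contract (C.smooth_X x)

/-- The forms `σ` off `Z` with a pole of order at most `j` in the direction of `dy` only: `y ^ j σ`
and `dy ∧ σ` extend smoothly over `Z`. -/
def filt (j p : ℕ) : Submodule ℝ (FormField E M p) where
  carrier := {σ | σ ∈ smoothForms B.compl p ∧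
    ExtendsOver (range B.incl) (fnSmul (fun x => C.y x ^ j) σ) ∧
    ExtendsOver (range B.incl) (dWedge C.y σ)}
  zero_mem' := by
    refine ⟨Submodule.zero_mem _, ?_, ?_⟩
    · exact (ExtendsOver.of_smoothAt (σ := (0 : FormField E M p)) smoothAt_zero).congr
        fun x _ => (smul_zero _).symm
    · exact (ExtendsOver.of_smoothAt (σ := (0 : FormField E M (p + 1))) smoothAt_zero).congr
        fun x _ => (wedge_zero _).symm
  add_mem' := fun h1 h2 => ⟨Submodule.add_mem _ h1.1 h2.1, by
    rw [fnSmul_add]; exact h1.2.1.add h2.2.1, by rw [dWedge_add]; exact h1.2.2.add h2.2.2⟩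
  smul_mem' := fun c σ h => ⟨Submodule.smul_mem _ c h.1, by
    rw [fnSmul_smul]; exact h.2.1.smul c, by rw [dWedge_smul]; exact h.2.2.smul c⟩

lemma smooth_pow (j : ℕ) : ContMDiff 𝓘(ℝ, E) 𝓘(ℝ, ℝ) ∞ (fun x => C.y x ^ j) := C.smooth_y.pow j

lemma filt_le_smoothForms (j p : ℕ) : C.filt j p ≤ smoothForms B.compl p := fun _ h => h.1

lemma filt_mono (j p : ℕ) : C.filt j p ≤ C.filt (j + 1) p := fun σ h => by
  refine ⟨h.1, (h.2.1.fnSmul C.smooth_y).congr fun x _ => ?_, h.2.2⟩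
  rw [fnSmul_apply, fnSmul_apply, fnSmul_apply, smul_smul, pow_succ']

/-- A smooth form off `Z` that extends over `Z` belongs to every step of the filtration. -/
lemma mem_filt_of_extendsOver {σ : FormField E M p} (h : σ ∈ smoothForms B.compl p)
    (hσ : ExtendsOver (range B.incl) σ) (j : ℕ) : σ ∈ C.filt j p :=
  ⟨h, hσ.fnSmul (C.smooth_pow j), hσ.dWedge C.smooth_y⟩

lemma extendsOver_of_mem_filt_zero {σ : FormField E M p} (h : σ ∈ C.filt 0 p) :
    ExtendsOver (range B.incl) σ := h.2.1.congr fun x _ => by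
  rw [fnSmul_apply, pow_zero, one_smul]

lemma extendsOver_of_forall_incl {σ : FormField E M p} (h : ∀ x ∉ range B.incl, SmoothAt σ x)
    (h' : ∀ z, ExtendsAt (range B.incl) σ (B.incl z)) : ExtendsOver (range B.incl) σ := fun x => by
  by_cases hx : x ∈ range B.incl
  · obtain ⟨z, rfl⟩ := hx
    exact h' z
  · exact ExtendsAt.of_notMem B.isClosed_range hx h

/-- In degree zero, the filtration is constant: `σ = ι_X (dy ∧ σ)` near `Z`. -/
lemma extendsOver_of_mem_filt_degree_zero {j : ℕ} {σ : FormField E M 0} (h : σ ∈ C.filt j 0) :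
    ExtendsOver (range B.incl) σ := by
  refine extendsOver_of_forall_incl (fun x hx => smoothAt_of_mem h.1 hx) fun z => ?_
  obtain ⟨τ, hτ⟩ := h.2.2 (B.incl z)
  refine ⟨contract C.vec τ, ?_⟩
  filter_upwards [hτ, C.eventually_vec z] with x h1 h2
  refine ⟨C.smoothAt_contract_vec h1.1, fun hx => ?_⟩
  rw [contract_apply, h1.2 hx, dWedge_apply, curryLeft_wedge_of_degree_zero, h2.1, one_smul]

lemma filt_degree_zero (j : ℕ) : C.filt j 0 = C.filt 0 0 :=
  le_antisymm (fun _ h => C.mem_filt_of_extendsOver h.1 (C.extendsOver_of_mem_filt_degree_zero h) 0)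
    (fun _ h => C.mem_filt_of_extendsOver h.1 (C.extendsOver_of_mem_filt_zero h) j)

/-- The filtration consists of subcomplexes, because `y^j dσ = d(y^j σ) - j y^{j-1} dy ∧ σ` and `dy
∧ dσ = -d(dy ∧ σ)`. -/
lemma d_mem_filt {j : ℕ} (σ : smoothForms (E := E) B.compl p) (h : σ.1 ∈ C.filt j p) :
    d B.compl p σ ∈ C.filt j (p + 1) := by
  refine ⟨d_mem_smoothForms σ, ?_, ?_⟩
  · have h1 := (h.2.1.extDerivField B.isClosed_range).add
      (((h.2.2.fnSmul (C.smooth_pow (j - 1))).smul (-j : ℝ)))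
    refine h1.congr fun x hx => ?_
    rw [FormField.add_apply, FormField.smul_apply, extDerivField_fnSmul (C.smooth_pow j x)
      (smoothAt_of_mem σ.2 hx), fnSmul_apply, fnSmul_apply, d_apply_of_mem σ hx, dWedge_apply,
      dWedge_apply, diffAt_pow (C.smooth_y.mdifferentiable (by simp) x), smul_wedge, smul_smul,
      add_right_comm, ← add_smul]
    rw [neg_mul, add_neg_cancel, zero_smul, zero_add]
  · refine ((h.2.2.extDerivField B.isClosed_range).smul (-1 : ℝ)).congr fun x hx => ?_
    rw [FormField.smul_apply, extDerivField_dWedge (C.smooth_y x) (smoothAt_of_mem σ.2 hx),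
      dWedge_apply, dWedge_apply, d_apply_of_mem σ hx, smul_neg, ← neg_smul, neg_neg, one_smul]

end Collar

/-! ### Restriction of forms to the hypersurface -/

section RestrictedForms
variable {E F : Type*} [NormedAddCommGroup E] [NormedSpace ℝ E]
  [NormedAddCommGroup F] [NormedSpace ℝ F] {p : ℕ}

/-- If `θ(X) = 1` and `D` takes its values in the kernel of `θ`, then the restriction of `ψ` along
`D` is recovered from `θ ∧ ψ`. -/
lemma curryLeft_wedge_comp {θ : E →L[ℝ] ℝ} {X : E} (hX : θ X = 1) {D : F →L[ℝ] E}
    (hD : θ ∘L D = 0) (ψ : E [⋀^Fin p]→L[ℝ] ℝ) :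
    ((wedge θ ψ).curryLeft X).compContinuousLinearMap D = ψ.compContinuousLinearMap D := by
  cases p with
  | zero => rw [curryLeft_wedge_of_degree_zero, hX, one_smul]
  | succ p =>
    rw [curryLeft_wedge, hX, one_smul]
    have h : (ψ - wedge θ (ψ.curryLeft X)).compContinuousLinearMap D =
      ψ.compContinuousLinearMap D - (wedge θ (ψ.curryLeft X)).compContinuousLinearMap D := rfl
    rw [h, wedge_compContinuousLinearMap, hD, zero_wedge, sub_zero]

/-- A form `σ` with `θ ∧ σ = 0` is determined by the restriction of `ι_X σ` to the kernel of `θ`. -/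
lemma eq_zero_of_wedge_eq_zero {θ : E →L[ℝ] ℝ} {X : E} (hX : θ X = 1) {D : F →L[ℝ] E}
    (hD : ∀ v, θ v = 0 → ∃ w, D w = v) {σ : E [⋀^Fin (p + 1)]→L[ℝ] ℝ} (h : wedge θ σ = 0)
    (hβ : (σ.curryLeft X).compContinuousLinearMap D = 0) : σ = 0 := by
  have hP : θ ∘L kerProj θ X = 0 := by
    ext v; exact apply_kerProj hX v
  have h1 : σ = wedge θ (σ.curryLeft X) := by
    have h2 := curryLeft_wedge θ σ X
    rw [h, hX, one_smul] at h2
    have h3 : (0 : E [⋀^Fin (p + 1 + 1)]→L[ℝ] ℝ).curryLeft X = 0 := rfl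
    rw [h3] at h2
    exact sub_eq_zero.1 h2.symm
  have h4 : σ.compContinuousLinearMap (kerProj θ X) = 0 := by
    rw [h1, wedge_compContinuousLinearMap, hP, zero_wedge]
  have h5 : (σ.curryLeft X).compContinuousLinearMap (kerProj θ X) = 0 := by
    ext v
    choose w hw using fun i => hD _ (apply_kerProj hX (v i))
    have h6 := DFunLike.congr_fun hβ w
    refine Eq.trans ?_ h6
    exact congrArg (σ.curryLeft X) (funext fun i => (hw i).symm)
  rw [eq_kerProj_add_wedge hX σ, h4, h5, wedge_zero, add_zero]

end RestrictedForms

/-! ### Polar forms and residues -/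

/-- A primitive of `t ^ (-j)`. -/
lemma exists_primitive_inv_pow (j : ℕ) : ∃ φ : ℝ → ℝ, ∀ t ≠ 0,
    ContDiffAt ℝ ∞ φ t ∧ HasDerivAt φ (t ^ j)⁻¹ t := by
  by_cases hj : j = 1
  · subst hj
    refine ⟨Real.log, fun t ht => ⟨Real.contDiffAt_log.2 ht, ?_⟩⟩
    simpa using Real.hasDerivAt_log ht
  · have hm : ((1 - j : ℤ) : ℝ) ≠ 0 := by
      rw [Int.cast_ne_zero]; omega
    refine ⟨fun t => ((1 - j : ℤ) : ℝ)⁻¹ * t ^ (1 - j : ℤ), fun t ht => ⟨?_, ?_⟩⟩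
    · exact contDiffAt_const.mul (AnalyticAt.contDiffAt (analyticAt_id.zpow ht))
    · refine ((hasDerivAt_zpow (1 - j : ℤ) t (Or.inl ht)).const_mul _).congr_deriv ?_
      rw [← mul_assoc, inv_mul_cancel₀ hm, one_mul, show (1 - j - 1 : ℤ) = -j by ring, zpow_neg,
        zpow_natCast]

/-- A primitive of `t ^ (-j)`, away from `0`. -/
def primitiveInvPow (j : ℕ) : ℝ → ℝ := (exists_primitive_inv_pow j).choose

lemma contDiffAt_primitiveInvPow (j : ℕ) {t : ℝ} (ht : t ≠ 0) :
    ContDiffAt ℝ ∞ (primitiveInvPow j) t := ((exists_primitive_inv_pow j).choose_spec t ht).1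

lemma hasDerivAt_primitiveInvPow (j : ℕ) {t : ℝ} (ht : t ≠ 0) :
    HasDerivAt (primitiveInvPow j) (t ^ j)⁻¹ t := ((exists_primitive_inv_pow j).choose_spec t ht).2

section Pullback
variable {E M F Z : Type*} [NormedAddCommGroup E] [NormedSpace ℝ E] [TopologicalSpace M]
  [ChartedSpace E M] [NormedAddCommGroup F] [NormedSpace ℝ F] [TopologicalSpace Z]
  [ChartedSpace F Z] {p : ℕ}

/-- `incl^* π^* α = α` at a point, for a retraction `π`. -/
lemma pullback_pullback_of_leftInverse {incl : Z → M} {π : M → Z} (h : ∀ z, π (incl z) = z) {z : Z}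
    (hi : MDifferentiableAt 𝓘(ℝ, F) 𝓘(ℝ, E) incl z)
    (hπ : MDifferentiableAt 𝓘(ℝ, E) 𝓘(ℝ, F) π (incl z)) (α : FormField F Z p) :
    pullback (E' := F) incl (pullback (E' := E) π α) z = α z := by
  have h1 := mfderiv_comp z hπ hi
  have h2 : π ∘ incl = id := funext h
  rw [h2, mfderiv_id] at h1
  have h3 : α (π (incl z)) = α z := by rw [h]
  ext v
  refine Eq.trans ?_ (DFunLike.congr_fun h3 v)
  exact congrArg (α (π (incl z))) (funext fun i => (DFunLike.congr_fun h1 (v i)).symm)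

end Pullback

section Tube
variable {k : ℕ} {E F M Z : Type*}
  [NormedAddCommGroup E] [NormedSpace ℝ E] [NormedAddCommGroup F] [NormedSpace ℝ F]
  [TopologicalSpace M] [ChartedSpace E M] [IsManifold 𝓘(ℝ, E) ∞ M] [FiniteDimensional ℝ E]
  [TopologicalSpace Z] [ChartedSpace F Z] {B : BkManifold k E F M Z}

/-- A smooth retraction `π` of a neighbourhood of the hypersurface, and a cutoff function `χ` that
is `1` near the hypersurface and supported in this neighbourhood. -/
structure Tube (C : Collar B) where
  /-- the retraction -/
  π : M → Z
  π_incl : ∀ z, π (B.incl z) = z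
  smooth_π : ∀ z, ∀ᶠ x in 𝓝 (B.incl z), ContMDiffAt 𝓘(ℝ, E) 𝓘(ℝ, F) ∞ π x
  /-- the cutoff function -/
  χ : C^∞⟮𝓘(ℝ, E), M; ℝ⟯
  χ_one : ∀ z, ∀ᶠ x in 𝓝 (B.incl z), χ x = 1
  χ_support : ∀ x, (∀ᶠ x' in 𝓝 x, χ x' = 0) ∨
    (ContMDiffAt 𝓘(ℝ, E) 𝓘(ℝ, F) ∞ π x ∧ (x ∉ range B.incl → C.y x ≠ 0))

/-- The cutoff exists because `Z` is closed and has a neighbourhood on which the retraction is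
smooth. -/
lemma exists_tube [Nonempty Z] [T2Space M] [SigmaCompactSpace M] [IsManifold 𝓘(ℝ, F) ∞ Z]
    (C : Collar B) : Nonempty (Tube C) := by
  have := normalSpace_of_manifold E M
  obtain ⟨π, hπ, hπs⟩ := exists_smooth_retraction B.isSmoothEmbedding C.smooth_y C.smooth_X
    C.eventually_y
  let O : Set M := interior {x | ContMDiffAt 𝓘(ℝ, E) 𝓘(ℝ, F) ∞ π x ∧
    (x ∉ range B.incl → C.y x ≠ 0)}
  have hO : range B.incl ⊆ O := by
    rintro _ ⟨z, rfl⟩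
    exact mem_interior_iff_mem_nhds.2 ((hπs z).and (C.eventually_ne_zero z))
  obtain ⟨χ, h0, h1, -⟩ := exists_contMDiffMap_zero_one_nhds_of_isClosed (n := (⊤ : ℕ∞)) 𝓘(ℝ, E)
    (s := Oᶜ) (t := range B.incl) isOpen_interior.isClosed_compl B.isClosed_range
    (disjoint_compl_left_iff_subset.2 hO)
  refine ⟨⟨π, hπ, hπs, χ, fun z => h1.filter_mono (nhds_le_nhdsSet (mem_range_self z)),
    fun x => ?_⟩⟩
  by_cases hx : x ∈ O
  · have h2 : x ∈ {x | ContMDiffAt 𝓘(ℝ, E) 𝓘(ℝ, F) ∞ π x ∧ (x ∉ range B.incl → C.y x ≠ 0)} :=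
      interior_subset hx
    exact Or.inr h2
  · exact Or.inl (h0.filter_mono (nhds_le_nhdsSet hx))

end Tube

section Restriction
variable {k : ℕ} {E F M Z : Type*}
  [NormedAddCommGroup E] [NormedSpace ℝ E] [NormedAddCommGroup F] [NormedSpace ℝ F]
  [TopologicalSpace M] [ChartedSpace E M] [IsManifold 𝓘(ℝ, E) ∞ M] [FiniteDimensional ℝ E]
  [TopologicalSpace Z] [ChartedSpace F Z] {B : BkManifold k E F M Z} {C : Collar B}

lemma contMDiff_incl [IsManifold 𝓘(ℝ, F) ∞ Z] (B : BkManifold k E F M Z) :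
    ContMDiff 𝓘(ℝ, F) 𝓘(ℝ, E) ∞ B.incl := B.isSmoothEmbedding.contMDiff

/-- The differential of the inclusion of the hypersurface. -/
def inclDeriv (B : BkManifold k E F M Z) (z : Z) : F →L[ℝ] E :=
  mfderiv 𝓘(ℝ, F) 𝓘(ℝ, E) B.incl z

variable [IsManifold 𝓘(ℝ, F) ∞ Z]

/-- The restriction of `dy` to the hypersurface vanishes. -/
lemma diffAt_comp_inclDeriv (C : Collar B) (z : Z) :
    diffAt E C.y (B.incl z) ∘L inclDeriv B z = 0 := by
  have h := mfderiv_comp z (C.smooth_y.mdifferentiable (by simp) (B.incl z))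
    ((contMDiff_incl B).mdifferentiable (by simp) z)
  have h2 : C.y ∘ B.incl = fun _ => (0 : ℝ) := funext C.y_incl
  rw [h2] at h
  exact h.symm.trans mfderiv_const

/-- The tangent space of the hypersurface is the kernel of `dy`, for reasons of dimension. -/
lemma exists_inclDeriv_eq (T : Tube C) (hdim : Module.finrank ℝ E = Module.finrank ℝ F + 1) (z : Z)
    {v : E} (hv : diffAt E C.y (B.incl z) v = 0) : ∃ w, inclDeriv B z w = v := by
  have h := mfderiv_comp z ((T.smooth_π z).self_of_nhds.mdifferentiableAt (by simp))
    ((contMDiff_incl B).mdifferentiable (by simp) z)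
  have h2 : T.π ∘ B.incl = id := funext T.π_incl
  rw [h2, mfderiv_id] at h
  have hinj : Function.Injective (inclDeriv B z) := fun w w' hw => by
    have h3 := DFunLike.congr_fun h w
    have h4 := DFunLike.congr_fun h w'
    exact h3.trans ((congrArg (mfderiv 𝓘(ℝ, E) 𝓘(ℝ, F) T.π (B.incl z)) hw).trans h4.symm)
  let θ : E →ₗ[ℝ] ℝ := (diffAt E C.y (B.incl z) : E →L[ℝ] ℝ)
  let D : F →ₗ[ℝ] E := (inclDeriv B z : F →L[ℝ] E)
  have hle : LinearMap.range D ≤ LinearMap.ker θ := by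
    rintro _ ⟨w, rfl⟩
    exact DFunLike.congr_fun (diffAt_comp_inclDeriv C z) w
  have hr : Module.finrank ℝ (LinearMap.range D) = Module.finrank ℝ F :=
    LinearMap.finrank_range_of_inj hinj
  have hθ : θ ≠ 0 := fun h0 => C.diffAt_ne_zero z (ContinuousLinearMap.coe_injective h0)
  have hk := Module.Dual.finrank_ker_add_one_of_ne_zero (f := θ) hθ
  have heq : LinearMap.range D = LinearMap.ker θ :=
    Submodule.eq_of_le_of_finrank_eq hle (by omega)
  have hv' : v ∈ LinearMap.ker θ := hv
  rw [← heq] at hv'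
  exact hv'

end Restriction

namespace Tube
variable {k : ℕ} {E F M Z : Type*}
  [NormedAddCommGroup E] [NormedSpace ℝ E] [NormedAddCommGroup F] [NormedSpace ℝ F]
  [TopologicalSpace M] [ChartedSpace E M] [IsManifold 𝓘(ℝ, E) ∞ M] [FiniteDimensional ℝ E]
  [TopologicalSpace Z] [ChartedSpace F Z] {B : BkManifold k E F M Z} {C : Collar B} (T : Tube C)
  {p : ℕ}

/-- A function on `M ∖ Z` that is a primitive of `y ^ (-j) dy` near `Z`. -/
def polarFn (j : ℕ) (x : M) : ℝ := T.χ x * primitiveInvPow j (C.y x)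

/-- Off `Z`, either the cutoff makes the function vanish near `x`, or both it and the retraction are
smooth at `x`. -/
lemma polarFn_cases (j : ℕ) {x : M} (hx : x ∉ range B.incl) :
    (∀ᶠ x' in 𝓝 x, T.polarFn j x' = 0) ∨ (ContMDiffAt 𝓘(ℝ, E) 𝓘(ℝ, F) ∞ T.π x ∧
      ContMDiffAt 𝓘(ℝ, E) 𝓘(ℝ, ℝ) ∞ (T.polarFn j) x) := by
  rcases T.χ_support x with h | h
  · exact Or.inl (h.mono fun x' hx' => by rw [polarFn, hx', zero_mul])
  · refine Or.inr ⟨h.1, (T.χ.contMDiff x).mul ?_⟩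
    exact (contDiffAt_primitiveInvPow j (h.2 hx)).contMDiffAt.comp x (C.smooth_y x)

lemma eventually_diffAt_polarFn (j : ℕ) (z : Z) : ∀ᶠ x in 𝓝 (B.incl z), x ∉ range B.incl →
    diffAt E (T.polarFn j) x = (C.y x ^ j)⁻¹ • diffAt E C.y x := by
  filter_upwards [(T.χ_one z).eventually_nhds, C.eventually_ne_zero z] with x h1 h2 hx
  have h3 : T.polarFn j =ᶠ[𝓝 x] fun x => primitiveInvPow j (C.y x) :=
    h1.mono fun x' hx' => by rw [polarFn, hx', one_mul]
  have h4 : diffAt E (T.polarFn j) x = diffAt E (fun x => primitiveInvPow j (C.y x)) x :=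
    h3.mfderiv_eq
  have h5 : HasMFDerivAt 𝓘(ℝ, ℝ) 𝓘(ℝ, ℝ) (primitiveInvPow j) (C.y x)
      ((1 : ℝ →L[ℝ] ℝ).smulRight ((C.y x ^ j)⁻¹ : ℝ)) :=
    (hasDerivAt_primitiveInvPow j (h2 hx)).hasFDerivAt.hasMFDerivAt
  have h6 := (h5.comp x (C.smooth_y.mdifferentiable (by simp) x).hasMFDerivAt).mfderiv
  rw [h4]
  refine ContinuousLinearMap.ext fun v => (DFunLike.congr_fun h6 v).trans ?_
  exact mul_comm (diffAt E C.y x v) _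

open Classical in
/-- The form `y ^ (-j) dy ∧ π^* α` near `Z`, extended to `M ∖ Z` with a cutoff in such a way that
it anticommutes with the exterior derivative. -/
def polar (j : ℕ) : FormField F Z p →ₗ[ℝ] FormField E M (p + 1) where
  toFun α := ⟨fun x => if x ∈ B.compl then dWedge (T.polarFn j) (pullback T.π α) x else 0⟩
  map_add' α β := by
    ext1; funext x
    by_cases hx : x ∈ B.compl
    · simp only [FormField.add_apply, if_pos hx, pullback_add, dWedge_add]
    · simp [FormField.add_apply, hx]
  map_smul' c α := by
    ext1; funext x
    by_cases hx : x ∈ B.compl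
    · simp only [FormField.smul_apply, if_pos hx, pullback_smul, dWedge_smul,
        RingHom.id_apply]
    · simp [FormField.smul_apply, hx]

lemma polar_apply (j : ℕ) (α : FormField F Z p) {x : M} (hx : x ∉ range B.incl) :
    T.polar j α x = dWedge (T.polarFn j) (pullback T.π α) x := if_pos hx

lemma polar_apply_of_mem (j : ℕ) (α : FormField F Z p) {x : M} (hx : x ∈ range B.incl) :
    T.polar j α x = 0 := if_neg fun h => h hx

variable [IsManifold 𝓘(ℝ, F) ∞ Z] [FiniteDimensional ℝ F]

lemma polar_mem_smoothForms (j : ℕ) {α : FormField F Z p} (hα : ∀ z, SmoothAt α z) :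
    T.polar j α ∈ smoothForms B.compl (p + 1) := by
  refine ⟨fun x hx => ?_, fun x hx => if_neg hx⟩
  have hev : ∀ᶠ x' in 𝓝 x, x' ∉ range B.incl := B.compl.isOpen.mem_nhds hx
  rcases T.polarFn_cases j hx with h | h
  · refine (smoothAt_zero x).congr ?_
    filter_upwards [h.eventually_nhds, hev] with x' h1 h2
    rw [T.polar_apply j α h2, dWedge_of_eventually_zero h1]
    rfl
  · refine ((SmoothAt.pullback h.1 (hα _)).dWedge h.2).congr ?_
    filter_upwards [hev] with x' h2
    exact (T.polar_apply j α h2).symm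

/-- Polar forms anticommute with the exterior derivative: `d(df ∧ π^* α) = -df ∧ π^* dα`. -/
lemma d_polar (j : ℕ) (α : smoothForms (E := F) (⊤ : TopologicalSpace.Opens Z) p)
    (h : T.polar j α.1 ∈ smoothForms B.compl (p + 1)) :
    d B.compl (p + 1) ⟨T.polar j α.1, h⟩ = -T.polar j (d ⊤ p α) := by
  ext1; funext x
  have hneg : (-T.polar j (d ⊤ p α)) x = -(T.polar j (d ⊤ p α) x) := rfl
  rw [hneg]
  by_cases hx : x ∈ B.compl
  · have hev : ∀ᶠ x' in 𝓝 x, x' ∉ range B.incl := B.compl.isOpen.mem_nhds hx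
    rw [d_apply_of_mem _ hx, T.polar_apply j _ hx]
    rcases T.polarFn_cases j hx with h1 | h1
    · rw [dWedge_of_eventually_zero h1, neg_zero]
      have h3 : extDerivField (T.polar j α.1) x =
          extDerivField (0 : FormField E M (p + 1)) x := by
        refine extDerivField_congr ?_
        filter_upwards [h1.eventually_nhds, hev] with x' h4 h5
        rw [T.polar_apply j α.1 h5, dWedge_of_eventually_zero h4]
        rfl
      refine h3.trans ?_
      have h6 := extDerivField_smul (α := (0 : FormField E M (p + 1))) (x := x) 0
      rwa [zero_smul, zero_smul] at h6
    · have h3 : extDerivField (T.polar j α.1) x =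
          extDerivField (dWedge (T.polarFn j) (pullback T.π α.1)) x := by
        refine extDerivField_congr ?_
        filter_upwards [hev] with x' h5
        exact T.polar_apply j α.1 h5
      have hα : SmoothAt α.1 (T.π x) := smoothAt_of_mem α.2 trivial
      refine h3.trans ?_
      rw [extDerivField_dWedge h1.2 (SmoothAt.pullback h1.1 hα), dWedge_apply, dWedge_apply,
        extDerivField_pullback h1.1 hα, pullback_apply, pullback_apply, d_apply_of_mem α trivial]
  · rw [d_apply_of_notMem _ hx, T.polar_apply_of_mem j _ (not_not.1 hx), neg_zero]

/-- Near `Z`, the polar form of order `j` is `y^{-j} dy ∧ π^* α`. -/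
lemma eventually_pow_smul_polar (j : ℕ) (z : Z) (α : FormField F Z p) :
    ∀ᶠ x in 𝓝 (B.incl z), x ∉ range B.incl →
      C.y x ^ j • T.polar j α x = dWedge C.y (pullback T.π α) x ∧
      dWedge C.y (T.polar j α) x = 0 := by
  filter_upwards [T.eventually_diffAt_polarFn j z, C.eventually_ne_zero z] with x h1 h2 hx
  have h3 := pow_ne_zero j (h2 hx)
  constructor
  · rw [T.polar_apply j α hx, dWedge_apply, h1 hx, smul_wedge, smul_smul, mul_inv_cancel₀ h3,
      one_smul, dWedge_apply]
  · rw [dWedge_apply, T.polar_apply j α hx, dWedge_apply, h1 hx, smul_wedge, wedge_smul,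
      wedge_wedge_self, smul_zero]

lemma eventually_smoothAt_pullback {α : FormField F Z p} (hα : ∀ z, SmoothAt α z) (z : Z) :
    ∀ᶠ x in 𝓝 (B.incl z), SmoothAt (pullback T.π α : FormField E M p) x :=
  (T.smooth_π z).mono fun _ hx => SmoothAt.pullback hx (hα _)

lemma pullback_incl_pullback (α : FormField F Z p) (z : Z) :
    (pullback (E' := E) T.π α (B.incl z)).compContinuousLinearMap (inclDeriv B z) = α z :=
  pullback_pullback_of_leftInverse T.π_incl ((contMDiff_incl B).mdifferentiable (by simp) z)
    ((T.smooth_π z).self_of_nhds.mdifferentiableAt (by simp)) α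

/-- The polar forms of order `j` lie in the step `j` of the filtration, since `y^j σ = dy ∧ π^* α`
and `dy ∧ σ = 0` near `Z`. -/
lemma polar_mem_filt (j : ℕ) {α : FormField F Z p} (hα : ∀ z, SmoothAt α z) :
    T.polar j α ∈ C.filt j (p + 1) := by
  have hs := T.polar_mem_smoothForms j hα
  refine ⟨hs, Collar.extendsOver_of_forall_incl (fun x hx => ?_) fun z => ?_,
    Collar.extendsOver_of_forall_incl (fun x hx => ?_) fun z => ?_⟩
  · exact (smoothAt_of_mem hs hx).fnSmul (C.smooth_pow j x)
  · refine ⟨dWedge C.y (pullback T.π α), ?_⟩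
    filter_upwards [T.eventually_pow_smul_polar j z α, T.eventually_smoothAt_pullback hα z]
      with x h1 h2
    exact ⟨h2.dWedge (C.smooth_y x), fun hx => (h1 hx).1.symm⟩
  · exact (smoothAt_of_mem hs hx).dWedge (C.smooth_y x)
  · refine ⟨0, ?_⟩
    filter_upwards [T.eventually_pow_smul_polar j z α] with x h1
    exact ⟨smoothAt_zero x, fun hx => (h1 hx).2.symm⟩

include T in
/-- The polar part of a form is determined by the form. -/
lemma eq_zero_of_polar_mem_filt (j : ℕ) {α : FormField F Z p} (hα : ∀ z, SmoothAt α z)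
    (h : T.polar (j + 1) α ∈ C.filt j (p + 1)) : α = 0 := by
  ext1; funext z
  obtain ⟨η, hη⟩ := h.2.1 (B.incl z)
  have h1 : dWedge C.y (pullback T.π α) (B.incl z) = fnSmul C.y η (B.incl z) := by
    refine SmoothAt.eq_of_eventually_off C.dense_compl
      ((T.eventually_smoothAt_pullback hα z).self_of_nhds.dWedge (C.smooth_y _))
      (hη.self_of_nhds.1.fnSmul (C.smooth_y _)) ?_
    filter_upwards [hη, T.eventually_pow_smul_polar (j + 1) z α] with x h2 h3 hx
    rw [← (h3 hx).1, fnSmul_apply, h2.2 hx, fnSmul_apply, smul_smul, pow_succ']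
  rw [fnSmul_apply, C.y_incl, zero_smul, dWedge_apply] at h1
  have h4 := curryLeft_wedge_comp (C.eventually_vec z).self_of_nhds.1 (diffAt_comp_inclDeriv C z)
    (pullback (E' := E) T.π α (B.incl z))
  rw [h1, T.pullback_incl_pullback] at h4
  exact h4.symm

include T in
/-- Every form with a pole of order `j + 1` is the sum of a polar form and a form with a pole of
order `j`. The polar part is given by the residue of the form along `Z`. -/
lemma exists_sub_polar_mem_filt [T2Space M]
    (hdim : Module.finrank ℝ E = Module.finrank ℝ F + 1) (j : ℕ) {σ : FormField E M (p + 1)}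
    (hσ : σ ∈ C.filt (j + 1) (p + 1)) :
    ∃ α : FormField F Z p, (∀ z, SmoothAt α z) ∧ σ - T.polar (j + 1) α ∈ C.filt j (p + 1) := by
  obtain ⟨τ, hτ, hτσ⟩ := hσ.2.1.exists_smooth C.dense_compl
  -- the residue
  let α : FormField F Z p := pullback B.incl (contract C.vec τ)
  have hα : ∀ z, SmoothAt α z := fun z =>
    SmoothAt.pullback (contMDiff_incl B z) (C.smoothAt_contract_vec (hτ _))
  have hmem : σ - T.polar (j + 1) α ∈ C.filt (j + 1) (p + 1) :=
    Submodule.sub_mem _ hσ (T.polar_mem_filt (j + 1) hα)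
  refine ⟨α, hα, hmem.1, Collar.extendsOver_of_forall_incl (fun x hx => ?_) fun z => ?_, hmem.2.2⟩
  · exact (smoothAt_of_mem hmem.1 hx).fnSmul (C.smooth_pow j x)
  let τ' : FormField E M (p + 1) := τ - dWedge C.y (pullback T.π α)
  have hsub : ∀ (σ₁ σ₂ : FormField E M (p + 1)) x, (σ₁ - σ₂) x = σ₁ x - σ₂ x := fun _ _ _ => rfl
  have hτ's : ∀ z, ∀ᶠ x in 𝓝 (B.incl z), SmoothAt τ' x := fun z => by
    filter_upwards [T.eventually_smoothAt_pullback hα z] with x hx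
    exact (hτ x).sub (hx.dWedge (C.smooth_y x))
  have hτ'σ : ∀ z, ∀ᶠ x in 𝓝 (B.incl z), x ∉ range B.incl →
      τ' x = C.y x ^ (j + 1) • (σ - T.polar (j + 1) α) x := fun z => by
    filter_upwards [T.eventually_pow_smul_polar (j + 1) z α] with x h1 hx
    have h2 : C.y x ^ (j + 1) • (σ x - T.polar (j + 1) α x) =
        C.y x ^ (j + 1) • σ x - C.y x ^ (j + 1) • T.polar (j + 1) α x := smul_sub _ _ _
    rw [hsub, hsub, h2, (h1 hx).1, hτσ x hx, fnSmul_apply]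
  -- the restriction of `y ^ (j + 1) (σ - polar)` to `Z` vanishes
  have hzero : ∀ z, τ' (B.incl z) = 0 := fun z => by
    obtain ⟨η, hη⟩ := hmem.2.2 (B.incl z)
    have h1 : dWedge C.y τ' (B.incl z) = fnSmul (fun x => C.y x ^ (j + 1)) η (B.incl z) := by
      refine SmoothAt.eq_of_eventually_off C.dense_compl
        ((hτ's z).self_of_nhds.dWedge (C.smooth_y _))
        (hη.self_of_nhds.1.fnSmul (C.smooth_pow (j + 1) _)) ?_
      filter_upwards [hη, hτ'σ z] with x h2 h3 hx
      rw [dWedge_apply, h3 hx, wedge_smul, fnSmul_apply, h2.2 hx, dWedge_apply]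
    rw [fnSmul_apply, C.y_incl, zero_pow j.succ_ne_zero, zero_smul, dWedge_apply] at h1
    have hX := (C.eventually_vec z).self_of_nhds.1
    refine eq_zero_of_wedge_eq_zero hX (fun v hv => exists_inclDeriv_eq T hdim z hv) h1 ?_
    have h4 := curryLeft_wedge_comp hX (diffAt_comp_inclDeriv C z)
      (pullback (E' := E) T.π α (B.incl z))
    rw [T.pullback_incl_pullback] at h4
    have h5 : ((τ' (B.incl z)).curryLeft (C.vec (B.incl z))).compContinuousLinearMap
        (inclDeriv B z) = α z - ((wedge (diffAt E C.y (B.incl z))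
          (pullback (E' := E) T.π α (B.incl z))).curryLeft
            (C.vec (B.incl z))).compContinuousLinearMap (inclDeriv B z) := rfl
    rw [h5, h4, sub_self]
  refine extendsAt_of_fnSmul (y := C.y) (hτ's z) (Eventually.of_forall C.smooth_y)
    (C.diffAt_ne_zero z) ?_ ?_
  · filter_upwards [C.eventually_y z] with x hx hyx
    obtain ⟨z', rfl⟩ := hx.2.1 hyx
    exact hzero z'
  · filter_upwards [hτ'σ z, C.eventually_ne_zero z] with x h1 h2 hx
    refine ⟨h2 hx, ?_⟩
    rw [h1 hx, fnSmul_apply, smul_smul, pow_succ']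

end Tube

/-! ### `b^k`-vector fields -/

section LieDerivative
variable {E M : Type*} [NormedAddCommGroup E] [NormedSpace ℝ E] [TopologicalSpace M]
  [ChartedSpace E M] [IsManifold 𝓘(ℝ, E) ∞ M]

/-- The derivative of a smooth function along a smooth vector field. -/
def lieFn (v : Cₛ^∞⟮𝓘(ℝ, E); E, (TangentSpace 𝓘(ℝ, E) : M → Type _)⟯)
    (f : C^∞⟮𝓘(ℝ, E), M; ℝ⟯) : C^∞⟮𝓘(ℝ, E), M; ℝ⟯ :=
  ⟨fun x => diffAt E f x (v x), fun x => contMDiffAt_diffAt (f.contMDiff x) (v.contMDiff x)⟩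

variable (v : Cₛ^∞⟮𝓘(ℝ, E); E, (TangentSpace 𝓘(ℝ, E) : M → Type _)⟯)

lemma mdifferentiableAt_smoothMap (f : C^∞⟮𝓘(ℝ, E), M; ℝ⟯) (x : M) :
    MDifferentiableAt 𝓘(ℝ, E) 𝓘(ℝ, ℝ) f x := (f.contMDiff x).mdifferentiableAt (by simp)

lemma lieFn_add (f g : C^∞⟮𝓘(ℝ, E), M; ℝ⟯) : lieFn v (f + g) = lieFn v f + lieFn v g := by
  ext x
  have h := mfderiv_add (mdifferentiableAt_smoothMap f x) (mdifferentiableAt_smoothMap g x)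
  exact DFunLike.congr_fun h (v x)

lemma lieFn_mul (f g : C^∞⟮𝓘(ℝ, E), M; ℝ⟯) :
    lieFn v (f * g) = f * lieFn v g + g * lieFn v f := by
  ext x
  have h := ((mdifferentiableAt_smoothMap f x).hasMFDerivAt.mul
    (mdifferentiableAt_smoothMap g x).hasMFDerivAt).mfderiv
  exact DFunLike.congr_fun h (v x)

/-- A derivation that preserves an ideal preserves its powers. -/
lemma lieFn_mem_pow {I : Ideal C^∞⟮𝓘(ℝ, E), M; ℝ⟯} (h : ∀ f ∈ I, lieFn v f ∈ I) (k : ℕ) :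
    ∀ f ∈ I ^ k, lieFn v f ∈ I ^ k := by
  induction k with
  | zero => intro f _; simp
  | succ k ih =>
    intro f hf
    rw [pow_succ] at hf ⊢
    refine Submodule.mul_induction_on hf (fun m hm n hn => ?_) fun f g hf hg => ?_
    · rw [lieFn_mul]
      exact Ideal.add_mem _ (Ideal.mul_mem_mul hm (h n hn))
        (by rw [mul_comm n]; exact Ideal.mul_mem_mul (ih m hm) hn)
    · rw [lieFn_add]
      exact Ideal.add_mem _ hf hg

end LieDerivative

namespace Collar
variable {k : ℕ} {E F M Z : Type*}
  [NormedAddCommGroup E] [NormedSpace ℝ E] [NormedAddCommGroup F] [NormedSpace ℝ F]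
  [TopologicalSpace M] [ChartedSpace E M] [IsManifold 𝓘(ℝ, E) ∞ M] [FiniteDimensional ℝ E]
  [TopologicalSpace Z] [ChartedSpace F Z] {B : BkManifold k E F M Z} (C : Collar B) {p : ℕ}

lemma y_mem : C.y ∈ vanishingIdeal B.incl := C.y_incl

/-- The elements of `I_Z ^ j` are locally divisible by `y ^ j`. -/
lemma exists_eq_pow_mul (j : ℕ) {f : C^∞⟮𝓘(ℝ, E), M; ℝ⟯} (hf : f ∈ vanishingIdeal B.incl ^ j)
    (z : Z) : ∃ h : M → ℝ, ∀ᶠ x in 𝓝 (B.incl z),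
      ContMDiffAt 𝓘(ℝ, E) 𝓘(ℝ, ℝ) ∞ h x ∧ f x = C.y x ^ j * h x := by
  induction j generalizing f with
  | zero =>
    exact ⟨f, Eventually.of_forall fun x => ⟨f.contMDiff x, by rw [pow_zero, one_mul]⟩⟩
  | succ j ih =>
    rw [pow_succ] at hf
    refine Submodule.mul_induction_on hf (fun m hm n hn => ?_) fun f g hf hg => ?_
    · obtain ⟨h1, hh1⟩ := ih hm
      obtain ⟨h2, hh2⟩ := exists_eq_mul_function (g := n) (y := C.y) (x0 := B.incl z)
        (Eventually.of_forall n.contMDiff) (Eventually.of_forall C.smooth_y)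
        (C.diffAt_ne_zero z) (by
          filter_upwards [C.eventually_y z] with x hx hyx
          obtain ⟨z', rfl⟩ := hx.2.1 hyx
          exact hn z')
      refine ⟨fun x => h1 x * h2 x, ?_⟩
      filter_upwards [hh1, hh2] with x h3 h4
      refine ⟨h3.1.mul h4.1, ?_⟩
      have h5 : (m * n) x = m x * n x := rfl
      rw [h5, h3.2, h4.2]
      ring
    · obtain ⟨h1, hh1⟩ := hf
      obtain ⟨h2, hh2⟩ := hg
      refine ⟨fun x => h1 x + h2 x, ?_⟩
      filter_upwards [hh1, hh2] with x h3 h4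
      refine ⟨h3.1.add h4.1, ?_⟩
      have h5 : (f + g) x = f x + g x := rfl
      rw [h5, h3.2, h4.2]
      ring

variable [T2Space M] [SigmaCompactSpace M]

/-- Functions that vanish near `Z` belong to every power of `I_Z`. -/
lemma mem_pow_of_eventually_zero (j : ℕ) {f : C^∞⟮𝓘(ℝ, E), M; ℝ⟯}
    (hf : ∀ z, ∀ᶠ x in 𝓝 (B.incl z), f x = 0) : f ∈ vanishingIdeal B.incl ^ j := by
  obtain ⟨ψ, h0, h1, -⟩ := exists_contMDiffMap_zero_one_of_isClosed (n := (⊤ : ℕ∞)) 𝓘(ℝ, E)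
    (s := range B.incl) (t := tsupport f) B.isClosed_range (isClosed_tsupport f) (by
      rw [disjoint_left]
      rintro _ ⟨z, rfl⟩
      exact notMem_tsupport_iff_eventuallyEq.2 (hf z))
  -- `ψ` vanishes on `Z` and is `1` on the support of `f`
  have h2 : f = ψ ^ j * f := by
    ext x
    change f x = ψ x ^ j * f x
    by_cases hx : x ∈ tsupport f
    · have h3 : ψ x = 1 := h1 hx
      rw [h3, one_pow, one_mul]
    · rw [image_eq_zero_of_notMem_tsupport hx, mul_zero]
  have h4 : ψ ∈ vanishingIdeal B.incl := fun z => h0 (mem_range_self z)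
  rw [h2]
  exact Ideal.mul_mem_right _ _ (Ideal.pow_mem_pow h4 j)

/-- For a field `v` with `dy(v) ∈ I_Z^k`, tangency to `Z` follows as `k ≥ 1`. Tangency implies that
the derivative along `v` preserves `I_Z`, hence `I_Z^k`, so that the condition on `y` passes to
every representative of the jet. -/
lemma isBkVectorField_iff [IsManifold 𝓘(ℝ, F) ∞ Z]
    (hdim : Module.finrank ℝ E = Module.finrank ℝ F + 1)
    (v : Cₛ^∞⟮𝓘(ℝ, E); E, (TangentSpace 𝓘(ℝ, E) : M → Type _)⟯) (hk : 1 ≤ k) :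
    B.IsBkVectorField v ↔ lieFn v C.y ∈ vanishingIdeal B.incl ^ k := by
  constructor
  · intro h
    obtain ⟨g, hg, hgv⟩ := h.2 C.y C.mk_y
    have : lieFn v C.y = g := by
      ext x
      exact (hgv x).symm
    rwa [this]
  · intro h
    have htan : ∀ z, ∃ w, inclDeriv B z w = v (B.incl z) := fun z => by
      have : Nonempty Z := ⟨z⟩
      obtain ⟨T⟩ := exists_tube C
      exact exists_inclDeriv_eq T hdim z (Ideal.pow_le_self (by omega) h z)
    refine ⟨htan, fun f hf => ⟨lieFn v f, ?_, fun x => rfl⟩⟩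
    have h1 : f - C.y ∈ vanishingIdeal B.incl ^ k := by
      rw [← Ideal.Quotient.eq, hf, C.mk_y]
    have h2 : lieFn v (f - C.y) ∈ vanishingIdeal B.incl ^ k := by
      refine lieFn_mem_pow v (I := vanishingIdeal B.incl) (fun g hg z => ?_) k _ h1
      obtain ⟨w, hw⟩ := htan z
      have h3 := mfderiv_comp z (mdifferentiableAt_smoothMap g (B.incl z))
        ((contMDiff_incl B).mdifferentiable (by simp) z)
      have h4 : g ∘ B.incl = fun _ => (0 : ℝ) := funext hg
      rw [h4] at h3
      have h5 := DFunLike.congr_fun (h3.symm.trans mfderiv_const) w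
      exact (congrArg (diffAt E g (B.incl z)) hw.symm).trans h5
    have h6 := lieFn_add v (f - C.y) C.y
    rw [sub_add_cancel] at h6
    rw [h6]
    exact Ideal.add_mem _ h2 h

end Collar

/-! ### `b^k`-forms as forms with poles -/

section Projection
variable {E : Type*} [NormedAddCommGroup E] [NormedSpace ℝ E] {p : ℕ}

/-- The exterior product with `θ` only depends on the part of the form that does not contain `θ`. -/
lemma wedge_eq_wedge_kerProj {θ : E →L[ℝ] ℝ} {X : E} (h : θ X = 1) (σ : E [⋀^Fin p]→L[ℝ] ℝ) :
    wedge θ σ = wedge θ (σ.compContinuousLinearMap (kerProj θ X)) := by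
  have hP : θ ∘L kerProj θ X = 0 := by
    ext v; exact apply_kerProj h v
  conv_lhs => rw [eq_kerProj_add_wedge h (wedge θ σ)]
  rw [wedge_compContinuousLinearMap, hP, zero_wedge, zero_add, curryLeft_wedge_comp h hP]

/-- `σ = ι_X (θ ∧ σ) + θ ∧ ι_X σ` when `θ(X) = 1`. -/
lemma eq_curryLeft_wedge_add {θ : E →L[ℝ] ℝ} {X : E} (h : θ X = 1)
    (σ : E [⋀^Fin (p + 1)]→L[ℝ] ℝ) :
    σ = (wedge θ σ).curryLeft X + wedge θ (σ.curryLeft X) := by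
  rw [curryLeft_wedge, h, one_smul, sub_add_cancel]

lemma form_apply_eq_curryLeft_wedge_add {θ : E →L[ℝ] ℝ} {X : E} (h : θ X = 1)
    (σ : E [⋀^Fin (p + 1)]→L[ℝ] ℝ) (v : Fin (p + 1) → E) :
    σ v = (wedge θ σ).curryLeft X v + ∑ i : Fin (p + 1), (-1 : ℝ) ^ (i : ℕ) *
      (θ (v i) * σ.curryLeft X (fun j => v (i.succAbove j))) := by
  conv_lhs => rw [eq_curryLeft_wedge_add h σ]
  rw [ContinuousAlternatingMap.add_apply, wedge_apply]
  rfl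

lemma form_apply_eq_kerProj_add {θ : E →L[ℝ] ℝ} {X : E} (h : θ X = 1)
    (σ : E [⋀^Fin (p + 1)]→L[ℝ] ℝ) (v : Fin (p + 1) → E) :
    σ v = σ (fun i => kerProj θ X (v i)) + ∑ i : Fin (p + 1), (-1 : ℝ) ^ (i : ℕ) *
      (θ (v i) * σ.curryLeft X (fun j => kerProj θ X (v (i.succAbove j)))) := by
  conv_lhs => rw [eq_kerProj_add_wedge h σ]
  rw [ContinuousAlternatingMap.add_apply, wedge_apply]
  rfl

lemma wedge_apply_eq_kerProj {θ : E →L[ℝ] ℝ} {X : E} (h : θ X = 1)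
    (σ : E [⋀^Fin p]→L[ℝ] ℝ) (v : Fin (p + 1) → E) :
    wedge θ σ v = ∑ i : Fin (p + 1), (-1 : ℝ) ^ (i : ℕ) *
      (θ (v i) * σ (fun j => kerProj θ X (v (i.succAbove j)))) := by
  rw [wedge_eq_wedge_kerProj h, wedge_apply]
  rfl

end Projection

namespace Collar
variable {k : ℕ} {E F M Z : Type*}
  [NormedAddCommGroup E] [NormedSpace ℝ E] [NormedAddCommGroup F] [NormedSpace ℝ F]
  [TopologicalSpace M] [ChartedSpace E M] [IsManifold 𝓘(ℝ, E) ∞ M] [FiniteDimensional ℝ E]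
  [TopologicalSpace Z] [ChartedSpace F Z] {B : BkManifold k E F M Z} (C : Collar B) {p : ℕ}
  [T2Space M] [SigmaCompactSpace M] [IsManifold 𝓘(ℝ, F) ∞ Z]

/-- The values of a smooth form on smooth vector fields. -/
lemma contMDiffAt_form_apply {τ : FormField E M p} {x : M}
    (v : Fin p → Cₛ^∞⟮𝓘(ℝ, E); E, (TangentSpace 𝓘(ℝ, E) : M → Type _)⟯) (hτ : SmoothAt τ x) :
    ContMDiffAt 𝓘(ℝ, E) 𝓘(ℝ, ℝ) ∞ (fun x => τ x (fun i => v i x)) x :=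
  SmoothAt.apply (v := fun i => v i) (fun i => (v i).contMDiff x) hτ

/-- Near `Z`, `σ = ι_X (dy ∧ σ) + y ^ (-k) dy ∧ ι_X (y ^ k σ)`, and `dy` takes values divisible by
`y ^ k` on the `b^k`-vector fields. -/
lemma filt_le_bkForms (hk : 1 ≤ k) (hdim : Module.finrank ℝ E = Module.finrank ℝ F + 1) (p : ℕ) :
    C.filt k p ≤ B.bkForms p := by
  intro σ hσ
  refine ⟨hσ.1, fun v hv => ?_⟩
  refine (exists_smooth_function (f := fun x => σ x (fun i => v i x)) C.dense_compl
    fun x0 => ?_).imp fun g hg x hx => (hg x hx).symm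
  by_cases hx0 : x0 ∈ range B.incl
  swap
  · refine ⟨fun x => σ x (fun i => v i x), ?_⟩
    filter_upwards [B.isClosed_range.isOpen_compl.mem_nhds hx0] with x hx
    exact ⟨contMDiffAt_form_apply v (smoothAt_of_mem hσ.1 hx), fun _ => rfl⟩
  obtain ⟨z, rfl⟩ := hx0
  cases p with
  | zero =>
    obtain ⟨τ, hτ⟩ := C.extendsOver_of_mem_filt_degree_zero hσ (B.incl z)
    refine ⟨fun x => τ x (fun i => v i x), ?_⟩
    filter_upwards [hτ] with x hx
    exact ⟨contMDiffAt_form_apply v hx.1, fun hxA => by rw [hx.2 hxA]⟩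
  | succ p =>
    obtain ⟨τ, hτ⟩ := hσ.2.1 (B.incl z)
    obtain ⟨η, hη⟩ := hσ.2.2 (B.incl z)
    choose h hh using fun i =>
      C.exists_eq_pow_mul k ((C.isBkVectorField_iff hdim (v i) hk).1 (hv i)) z
    refine ⟨fun x => contract C.vec η x (fun i => v i x) + ∑ i : Fin (p + 1), (-1 : ℝ) ^ (i : ℕ) *
      (h i x * contract C.vec τ x (fun j => v (i.succAbove j) x)), ?_⟩
    filter_upwards [hτ, hη, eventually_all.2 hh, C.eventually_vec z] with x h1 h2 h3 h4
    constructor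
    · refine (contMDiffAt_form_apply v (C.smoothAt_contract_vec h2.1)).add
        (contMDiffAt_finsetSum fun i _ => contMDiffAt_const.mul ((h3 i).1.mul ?_))
      exact contMDiffAt_form_apply (fun j => v (i.succAbove j)) (C.smoothAt_contract_vec h1.1)
    · intro hx
      refine Eq.trans ?_ (form_apply_eq_curryLeft_wedge_add h4.1 (σ x) (fun i => v i x)).symm
      refine congrArg₂ (fun a b : ℝ => a + b) ?_ (Finset.sum_congr rfl fun i _ =>
        congrArg (fun a : ℝ => (-1 : ℝ) ^ (i : ℕ) * a) ?_)
      · have h5 := h2.2 hx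
        exact congrArg (fun β : E [⋀^Fin (p + 1 + 1)]→L[ℝ] ℝ =>
          β.curryLeft (C.vec x) (fun i => v i x)) h5
      · have h6 : diffAt E C.y x (v i x) = C.y x ^ k * h i x := (h3 i).2
        have h7 := congrArg (fun β : E [⋀^Fin (p + 1)]→L[ℝ] ℝ =>
          β.curryLeft (C.vec x) (fun j => v (i.succAbove j) x)) (h1.2 hx)
        have h8 : ∀ a b c : ℝ, a * (b * c) = b * a * c := fun a b c => by ring
        refine (congrArg (fun a : ℝ => h i x * a) h7).trans ((h8 _ _ _).trans ?_)
        rw [← h6]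
        rfl

/-- The vector field `u - dy(u) X`. -/
def tangentPart (u : Cₛ^∞⟮𝓘(ℝ, E); E, (TangentSpace 𝓘(ℝ, E) : M → Type _)⟯) :
    Cₛ^∞⟮𝓘(ℝ, E); E, (TangentSpace 𝓘(ℝ, E) : M → Type _)⟯ :=
  ⟨fun x => u x - lieFn u C.y x • C.X x, fun x =>
    (u.contMDiff x).sub_section (((lieFn u C.y).contMDiff x).smul_section (C.smooth_X x))⟩

/-- The vector field `y ^ k X`. -/
def powField : Cₛ^∞⟮𝓘(ℝ, E); E, (TangentSpace 𝓘(ℝ, E) : M → Type _)⟯ :=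
  ⟨fun x => C.y x ^ k • C.X x, fun x => (C.smooth_pow k x).smul_section (C.smooth_X x)⟩

/-- Near `Z`, the function `dy(u - dy(u) X)` is zero. -/
lemma isBkVectorField_tangentPart (hk : 1 ≤ k)
    (hdim : Module.finrank ℝ E = Module.finrank ℝ F + 1)
    (u : Cₛ^∞⟮𝓘(ℝ, E); E, (TangentSpace 𝓘(ℝ, E) : M → Type _)⟯) :
    B.IsBkVectorField (C.tangentPart u) := by
  rw [C.isBkVectorField_iff hdim _ hk]
  refine mem_pow_of_eventually_zero k fun z => ?_
  filter_upwards [C.eventually_vec z] with x hx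
  exact apply_kerProj (θ := diffAt E C.y x) (X := C.vec x) hx.1 (u x)

/-- `dy(y ^ k X) = y ^ k dy(X)`. -/
lemma isBkVectorField_powField (hk : 1 ≤ k)
    (hdim : Module.finrank ℝ E = Module.finrank ℝ F + 1) :
    B.IsBkVectorField C.powField := by
  rw [C.isBkVectorField_iff hdim _ hk]
  have h : lieFn C.powField C.y = C.y ^ k * lieFn C.X C.y := by
    ext x
    exact (diffAt E C.y x).map_smul (C.y x ^ k) (C.vec x)
  rw [h]
  exact Ideal.mul_mem_right _ _ (Ideal.pow_mem_pow C.y_mem k)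

/-- With `u_i` the constant fields of a chart, and `u_i' = u_i - dy(u_i) X`, the value of `y^k σ` on
the `u_i` is a combination with smooth coefficients of the values of `σ` on the `b^k`-vector fields
`u_i'` and `y^k X`. -/
lemma extendsOver_pow_of_mem_bkForms (hk : 1 ≤ k)
    (hdim : Module.finrank ℝ E = Module.finrank ℝ F + 1) {σ : FormField E M p}
    (hσ : σ ∈ B.bkForms p) : ExtendsOver (range B.incl) (fnSmul (fun x => C.y x ^ k) σ) := by
  refine extendsOver_of_forall_incl
    (fun x hx => (smoothAt_of_mem hσ.1 hx).fnSmul (C.smooth_pow k x)) fun z => ?_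
  refine extendsAt_of_apply_constField fun e => ?_
  cases p with
  | zero =>
    obtain ⟨g, hg⟩ := hσ.2 (fun i => i.elim0) (fun i => i.elim0)
    refine ⟨fun x => C.y x ^ k * g x, Eventually.of_forall fun x =>
      ⟨(C.smooth_pow k x).mul (g.contMDiff x), fun hx => ?_⟩⟩
    refine (congrArg (fun a : ℝ => C.y x ^ k * a) (hg x hx).symm).trans ?_
    exact congrArg (fun v => C.y x ^ k * σ x v) (Subsingleton.elim _ _)
  | succ p =>
    have hs := extChartAt_source_mem_nhds (I := 𝓘(ℝ, E)) (B.incl z)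
    choose u hu using fun i => exists_section_eventuallyEq (x0 := B.incl z)
      (u := constField (B.incl z) (e i))
      (Filter.mem_of_superset hs fun x hx => contMDiffAt_constField hx (e i))
    obtain ⟨g, hg⟩ := hσ.2 (fun i => C.tangentPart (u i))
      (fun i => C.isBkVectorField_tangentPart hk hdim (u i))
    choose g' hg' using fun i : Fin (p + 1) => hσ.2
      (Matrix.vecCons C.powField fun j => C.tangentPart (u (i.succAbove j)))
      (Fin.cases (C.isBkVectorField_powField hk hdim)
        fun j => C.isBkVectorField_tangentPart hk hdim (u (i.succAbove j)))
    refine ⟨fun x => C.y x ^ k * g x + ∑ i : Fin (p + 1), (-1 : ℝ) ^ (i : ℕ) *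
      (lieFn (u i) C.y x * g' i x), ?_⟩
    filter_upwards [eventually_all.2 hu, C.eventually_vec z] with x h1 h2
    constructor
    · exact ((C.smooth_pow k x).mul (g.contMDiff x)).add
        (contMDiffAt_finsetSum fun i _ => contMDiffAt_const.mul
          (((lieFn (u i) C.y).contMDiff x).mul ((g' i).contMDiff x)))
    · intro hx
      have h3 : (fun i => constField (B.incl z) (e i) x) = fun i => u i x :=
        funext fun i => (h1 i).symm
      rw [h3]
      have h4 := form_apply_eq_kerProj_add h2.1 (σ x) (fun i => u i x)
      refine Eq.trans ?_ (congrArg (fun a : ℝ => C.y x ^ k * a) h4).symm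
      refine Eq.trans ?_ (mul_add (C.y x ^ k) _ _).symm
      refine congrArg₂ (fun a b : ℝ => a + b) (congrArg (fun a : ℝ => C.y x ^ k * a)
        (hg x hx).symm) ?_
      rw [Finset.mul_sum]
      refine Finset.sum_congr rfl fun i _ => ?_
      have h6 : ((σ x).curryLeft (C.y x ^ k • C.vec x))
          (fun j => C.tangentPart (u (i.succAbove j)) x) = C.y x ^ k *
          ((σ x).curryLeft (C.vec x)) (fun j => C.tangentPart (u (i.succAbove j)) x) := by
        rw [map_smul]
        rfl
      have h7 : g' i x = C.y x ^ k *
          ((σ x).curryLeft (C.vec x)) (fun j => C.tangentPart (u (i.succAbove j)) x) := by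
        refine (hg' i x hx).symm.trans (Eq.trans ?_ h6)
        refine congrArg (σ x) (funext fun j => ?_)
        refine Fin.cases rfl (fun j => rfl) j
      have h8 : ∀ a b c e : ℝ, a * (b * (c * e)) = c * (a * (b * e)) := fun a b c e => by ring
      rw [h7]
      exact h8 _ _ _ _

/-- The value of `dy ∧ σ` on vector fields `u_i` is a combination, with coefficients `± dy(u_i)`, of
values of `σ` on the `b^k`-vector fields `u_j - dy(u_j) X`. -/
lemma extendsOver_dWedge_of_mem_bkForms (hk : 1 ≤ k)
    (hdim : Module.finrank ℝ E = Module.finrank ℝ F + 1) {σ : FormField E M p}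
    (hσ : σ ∈ B.bkForms p) : ExtendsOver (range B.incl) (dWedge C.y σ) := by
  refine extendsOver_of_forall_incl
    (fun x hx => (smoothAt_of_mem hσ.1 hx).dWedge (C.smooth_y x)) fun z => ?_
  refine extendsAt_of_apply_constField fun e => ?_
  have hs := extChartAt_source_mem_nhds (I := 𝓘(ℝ, E)) (B.incl z)
  choose u hu using fun i => exists_section_eventuallyEq (x0 := B.incl z)
    (u := constField (B.incl z) (e i))
    (Filter.mem_of_superset hs fun x hx => contMDiffAt_constField hx (e i))
  choose g hg using fun i : Fin (p + 1) => hσ.2 (fun j => C.tangentPart (u (i.succAbove j)))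
    (fun j => C.isBkVectorField_tangentPart hk hdim (u (i.succAbove j)))
  refine ⟨fun x => ∑ i : Fin (p + 1), (-1 : ℝ) ^ (i : ℕ) * (lieFn (u i) C.y x * g i x), ?_⟩
  filter_upwards [eventually_all.2 hu, C.eventually_vec z] with x h1 h2
  constructor
  · exact contMDiffAt_finsetSum fun i _ => contMDiffAt_const.mul
      (((lieFn (u i) C.y).contMDiff x).mul ((g i).contMDiff x))
  · intro hx
    have h3 : (fun i => constField (B.incl z) (e i) x) = fun i => u i x :=
      funext fun i => (h1 i).symm
    rw [h3]
    refine Eq.trans ?_ (wedge_apply_eq_kerProj h2.1 (σ x) (fun i => u i x)).symm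
    refine Finset.sum_congr rfl fun i _ => congrArg (fun a : ℝ => (-1 : ℝ) ^ (i : ℕ) * a) ?_
    exact congrArg (fun a : ℝ => diffAt E C.y x (u i x) * a) (hg i x hx).symm

/-- The `b^k`-forms are the forms with poles of order at most `k` in the direction of `dy`. -/
lemma filt_eq_bkForms (hk : 1 ≤ k) (hdim : Module.finrank ℝ E = Module.finrank ℝ F + 1) (p : ℕ) :
    C.filt k p = B.bkForms p :=
  le_antisymm (C.filt_le_bkForms hk hdim p) fun _ h =>
    ⟨h.1, C.extendsOver_pow_of_mem_bkForms hk hdim h, C.extendsOver_dWedge_of_mem_bkForms hk hdim h⟩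

end Collar

/-! ### Cohomology of a complex extended by polar forms -/

section Quotients
variable {A A' V : Type*} [AddCommGroup A] [Module ℝ A] [AddCommGroup A'] [Module ℝ A']
  [AddCommGroup V] [Module ℝ V]

/-- A linear map that identifies two quotients. -/
lemma nonempty_quotient_equiv {N : Submodule ℝ A} {N' : Submodule ℝ V} (L : A →ₗ[ℝ] V)
    (h : ∀ a, L a ∈ N' ↔ a ∈ N) (hs : ∀ b, ∃ a, b - L a ∈ N') :
    Nonempty ((A ⧸ N) ≃ₗ[ℝ] V ⧸ N') := by
  refine ⟨LinearEquiv.ofBijective (N.mapQ N' L fun a ha => (h a).2 ha) ⟨?_, ?_⟩⟩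
  · rw [← LinearMap.ker_eq_bot, LinearMap.ker_eq_bot']
    intro a ha
    obtain ⟨a, rfl⟩ := N.mkQ_surjective a
    rw [Submodule.mkQ_apply, Submodule.mapQ_apply, Submodule.Quotient.mk_eq_zero] at ha
    rw [Submodule.mkQ_apply, Submodule.Quotient.mk_eq_zero]
    exact (h a).1 ha
  · intro b
    obtain ⟨b, rfl⟩ := N'.mkQ_surjective b
    obtain ⟨a, ha⟩ := hs b
    refine ⟨N.mkQ a, ?_⟩
    rw [Submodule.mkQ_apply, Submodule.mkQ_apply, Submodule.mapQ_apply]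
    exact ((Submodule.Quotient.eq N').2 ha).symm

/-- Two linear maps that identify a quotient with a product of quotients. -/
lemma nonempty_quotient_equiv_prod {N : Submodule ℝ A} {N₂ : Submodule ℝ A'} {N' : Submodule ℝ V}
    (L : A →ₗ[ℝ] V) (L₂ : A' →ₗ[ℝ] V) (h : ∀ a a₂, L a + L₂ a₂ ∈ N' ↔ a ∈ N ∧ a₂ ∈ N₂)
    (hs : ∀ b, ∃ a a₂, b - (L a + L₂ a₂) ∈ N') :
    Nonempty ((V ⧸ N') ≃ₗ[ℝ] (A ⧸ N) × (A' ⧸ N₂)) := by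
  have h1 : ∀ a ∈ N, L a ∈ N' := fun a ha => by
    have := (h a 0).2 ⟨ha, N₂.zero_mem⟩
    rwa [map_zero, add_zero] at this
  have h2 : ∀ a ∈ N₂, L₂ a ∈ N' := fun a ha => by
    have := (h 0 a).2 ⟨N.zero_mem, ha⟩
    rwa [map_zero, zero_add] at this
  refine ⟨(LinearEquiv.ofBijective ((N.mapQ N' L h1).coprod (N₂.mapQ N' L₂ h2)) ⟨?_, ?_⟩).symm⟩
  · rw [← LinearMap.ker_eq_bot, LinearMap.ker_eq_bot']
    rintro ⟨a, a₂⟩ ha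
    obtain ⟨a, rfl⟩ := N.mkQ_surjective a
    obtain ⟨a₂, rfl⟩ := N₂.mkQ_surjective a₂
    rw [LinearMap.coprod_apply, Submodule.mkQ_apply, Submodule.mkQ_apply, Submodule.mapQ_apply,
      Submodule.mapQ_apply, ← Submodule.Quotient.mk_add, Submodule.Quotient.mk_eq_zero] at ha
    rw [Prod.mk_eq_zero, Submodule.mkQ_apply, Submodule.mkQ_apply, Submodule.Quotient.mk_eq_zero,
      Submodule.Quotient.mk_eq_zero]
    exact (h a a₂).1 ha
  · intro b
    obtain ⟨b, rfl⟩ := N'.mkQ_surjective b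
    obtain ⟨a, a₂, ha⟩ := hs b
    refine ⟨(N.mkQ a, N₂.mkQ a₂), ?_⟩
    rw [LinearMap.coprod_apply, Submodule.mkQ_apply, Submodule.mkQ_apply, Submodule.mkQ_apply,
      Submodule.mapQ_apply, Submodule.mapQ_apply, ← Submodule.Quotient.mk_add]
    exact ((Submodule.Quotient.eq N').2 ha).symm

end Quotients

section Complexes
variable {E M F Z : Type*} [NormedAddCommGroup E] [NormedSpace ℝ E] [TopologicalSpace M]
  [ChartedSpace E M] [NormedAddCommGroup F] [NormedSpace ℝ F] [TopologicalSpace Z]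
  [ChartedSpace F Z] {U : TopologicalSpace.Opens M} {C C' : ∀ p : ℕ, Submodule ℝ (FormField E M p)}
  {p : ℕ}

lemma mem_closedForms {σ : FormField E M p} : σ ∈ closedForms U C p ↔
    σ ∈ C p ∧ ∃ h : σ ∈ smoothForms U p, d U p ⟨σ, h⟩ = 0 := by
  refine and_congr Iff.rfl ⟨?_, ?_⟩
  · rintro ⟨τ, hτ, rfl⟩
    exact ⟨τ.2, hτ⟩
  · rintro ⟨h, hd⟩
    exact ⟨⟨σ, h⟩, hd, rfl⟩

lemma mem_exactForms_succ {σ : FormField E M (p + 1)} : σ ∈ exactForms U C (p + 1) ↔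
    σ ∈ C (p + 1) ∧ ∃ τ : smoothForms (E := E) U p, τ.1 ∈ C p ∧ d U p τ = σ := Iff.rfl

lemma mem_exactForms_zero {σ : FormField E M 0} : σ ∈ exactForms U C 0 ↔ σ = 0 := Iff.rfl

/-- The cohomology in degree zero depends only on the forms of degree zero. -/
lemma nonempty_cohomology_zero_equiv (h : C 0 = C' 0) :
    Nonempty (Cohomology U C 0 ≃ₗ[ℝ] Cohomology U C' 0) := by
  have h1 : closedForms U C 0 = closedForms U C' 0 := by rw [closedForms, closedForms, h]
  refine nonempty_quotient_equiv (LinearEquiv.ofEq _ _ h1).toLinearMap (fun a => Iff.rfl)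
    fun b => ⟨(LinearEquiv.ofEq _ _ h1).symm b, ?_⟩
  rw [LinearEquiv.coe_coe, LinearEquiv.apply_symm_apply, sub_self]
  exact Submodule.zero_mem _

/-- If a complex `C` is the sum of a subcomplex `C'` and the image of the de Rham complex of `Z`
under an injective operator `S` of degree one that anticommutes with `d`, then the cohomology
of `C` is the sum of those of `C'` and `Z`. -/
lemma nonempty_cohomology_equiv_prod (hC : ∀ p, C p ≤ smoothForms U p) (hC' : ∀ p, C' p ≤ C p)
    (hd : ∀ p (σ : smoothForms (E := E) U p), σ.1 ∈ C' p → d U p σ ∈ C' (p + 1))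
    (S : ∀ p, FormField F Z p →ₗ[ℝ] FormField E M (p + 1))
    (hdZ : ∀ p (α : smoothForms (E := F) (⊤ : TopologicalSpace.Opens Z) p),
      d ⊤ p α ∈ smoothForms (E := F) (⊤ : TopologicalSpace.Opens Z) (p + 1))
    (hS : ∀ p, ∀ α ∈ smoothForms (E := F) (⊤ : TopologicalSpace.Opens Z) p, S p α ∈ C (p + 1))
    (hSd : ∀ p (α : smoothForms (E := F) (⊤ : TopologicalSpace.Opens Z) p)
      (h : S p α.1 ∈ smoothForms U (p + 1)), d U (p + 1) ⟨S p α.1, h⟩ = -S (p + 1) (d ⊤ p α))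
    (hinj : ∀ p, ∀ α ∈ smoothForms (E := F) (⊤ : TopologicalSpace.Opens Z) p,
      S p α ∈ C' (p + 1) → α = 0)
    (hsurj : ∀ p, ∀ σ ∈ C (p + 1), ∃ α ∈ smoothForms (E := F) (⊤ : TopologicalSpace.Opens Z) p,
      σ - S p α ∈ C' (p + 1))
    (h0 : C 0 = C' 0) (p : ℕ) :
    Nonempty (Cohomology U C (p + 1) ≃ₗ[ℝ] Cohomology U C' (p + 1) × DeRhamCohomology F Z p) := by
  have hcl : ∀ q, closedForms U C' q ≤ closedForms U C q := fun q =>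
    inf_le_inf_right _ (hC' q)
  have hdS : ∀ q (α : smoothForms (E := F) (⊤ : TopologicalSpace.Opens Z) q), d ⊤ q α = 0 →
      S q α.1 ∈ closedForms U C (q + 1) := fun q α hα => by
    refine mem_closedForms.2 ⟨hS q _ α.2, hC _ (hS q _ α.2), ?_⟩
    rw [hSd, hα, map_zero, neg_zero]
  have hclS : ∀ α ∈ closedForms (⊤ : TopologicalSpace.Opens Z) (smoothForms (E := F) ⊤) p,
      S p α ∈ closedForms U C (p + 1) := fun α hα => by
    obtain ⟨h1, h2, h3⟩ := mem_closedForms.1 hα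
    exact hdS p ⟨α, h2⟩ h3
  refine nonempty_quotient_equiv_prod (Submodule.inclusion (hcl (p + 1)))
    ((S p).restrict hclS) ?_ ?_
  · rintro ⟨σ', hσ'⟩ ⟨α, hα⟩
    obtain ⟨hσ'C, -⟩ := mem_closedForms.1 hσ'
    obtain ⟨-, hαs, hαd⟩ := mem_closedForms.1 hα
    change σ' + S p α ∈ exactForms U C (p + 1) ↔ σ' ∈ exactForms U C' (p + 1) ∧
      α ∈ exactForms ⊤ (smoothForms (E := F) ⊤) p
    constructor
    · intro h
      obtain ⟨-, τ, hτC, hτ⟩ := mem_exactForms_succ.1 h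
      cases p with
      | zero =>
        rw [h0] at hτC
        have h1 : S 0 α = d U 0 τ - σ' := by rw [hτ]; abel
        have h2 : α = 0 := hinj 0 α hαs (by rw [h1]; exact Submodule.sub_mem _ (hd 0 τ hτC) hσ'C)
        rw [h2, map_zero, add_zero] at hτ
        exact ⟨mem_exactForms_succ.2 ⟨hσ'C, τ, hτC, hτ⟩, mem_exactForms_zero.2 h2⟩
      | succ q =>
        -- split a primitive `τ` into `τ'` in `C'` and `S β`, and compare the two components of
        -- `d τ = σ' + S α`
        obtain ⟨β, hβ, hτ'⟩ := hsurj q τ.1 hτC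
        have hSβ := hC _ (hS q β hβ)
        let τ' : smoothForms (E := E) U (q + 1) := τ - ⟨S q β, hSβ⟩
        have h1 : d U (q + 1) τ' = d U (q + 1) τ + S (q + 1) (d ⊤ q ⟨β, hβ⟩) := by
          rw [map_sub, hSd q ⟨β, hβ⟩ hSβ, sub_neg_eq_add]
        have h2 : S (q + 1) (α + d ⊤ q ⟨β, hβ⟩) = d U (q + 1) τ' - σ' := by
          rw [h1, hτ, map_add]; abel
        have h3 : α + d ⊤ q ⟨β, hβ⟩ = 0 :=
          hinj (q + 1) _ (Submodule.add_mem _ hαs (hdZ q _))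
            (by rw [h2]; exact Submodule.sub_mem _ (hd _ τ' hτ') hσ'C)
        have h4 : d U (q + 1) τ' = σ' := by
          rw [h3, map_zero] at h2
          exact (sub_eq_zero.1 h2.symm)
        refine ⟨mem_exactForms_succ.2 ⟨hσ'C, τ', hτ', h4⟩,
          mem_exactForms_succ.2 ⟨hαs, -⟨β, hβ⟩, Submodule.neg_mem _ hβ, ?_⟩⟩
        rw [map_neg]
        exact (eq_neg_of_add_eq_zero_left h3).symm
    · rintro ⟨h, h'⟩
      refine Submodule.add_mem _ ?_ ?_
      · obtain ⟨-, τ, hτC, hτ⟩ := mem_exactForms_succ.1 h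
        exact mem_exactForms_succ.2 ⟨hC' _ hσ'C, τ, hC' _ hτC, hτ⟩
      · cases p with
        | zero =>
          rw [mem_exactForms_zero.1 h', map_zero]
          exact Submodule.zero_mem _
        | succ q =>
          obtain ⟨-, β, -, hβ⟩ := mem_exactForms_succ.1 h'
          refine mem_exactForms_succ.2 ⟨hS _ _ hαs, -⟨S q β.1, hC _ (hS q _ β.2)⟩,
            Submodule.neg_mem _ (hS q _ β.2), ?_⟩
          rw [map_neg, hSd, hβ, neg_neg]
  · rintro ⟨σ, hσ⟩
    obtain ⟨hσC, hσs, hσd⟩ := mem_closedForms.1 hσ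
    obtain ⟨α, hα, hσ'⟩ := hsurj p σ hσC
    have hSα := hC _ (hS p α hα)
    let σ' : smoothForms (E := E) U (p + 1) := ⟨σ, hσs⟩ - ⟨S p α, hSα⟩
    have h1 : d U (p + 1) σ' = S (p + 1) (d ⊤ p ⟨α, hα⟩) := by
      rw [map_sub, hσd, hSd p ⟨α, hα⟩ hSα, sub_neg_eq_add, zero_add]
    have h2 : d ⊤ p ⟨α, hα⟩ = 0 := hinj (p + 1) _ (hdZ p _) (by rw [← h1]; exact hd _ σ' hσ')
    have h3 : σ'.1 ∈ closedForms U C' (p + 1) :=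
      mem_closedForms.2 ⟨hσ', σ'.2, by rw [h2, map_zero] at h1; exact h1⟩
    refine ⟨⟨σ'.1, h3⟩, ⟨α, mem_closedForms.2 ⟨hα, hα, h2⟩⟩, ?_⟩
    have h4 : σ - (σ'.1 + S p α) = 0 := by
      change σ - (σ - S p α + S p α) = 0
      abel
    change σ - (σ'.1 + S p α) ∈ exactForms U C (p + 1)
    rw [h4]
    exact Submodule.zero_mem _

end Complexes

/-! ### Restriction to a dense open set -/

section Restriction
variable {E M : Type*} [NormedAddCommGroup E] [NormedSpace ℝ E] [TopologicalSpace M]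
  [ChartedSpace E M] {p : ℕ} (U : TopologicalSpace.Opens M)

open Classical in
/-- The restriction of a field of forms to an open set, extended by zero. -/
def restrictForm (p : ℕ) : FormField E M p →ₗ[ℝ] FormField E M p where
  toFun σ := ⟨fun x => if x ∈ U then σ x else 0⟩
  map_add' σ τ := by
    ext1; funext x
    by_cases hx : x ∈ U
    · simp [FormField.add_apply, hx]
    · simp [FormField.add_apply, hx]
  map_smul' c σ := by
    ext1; funext x
    by_cases hx : x ∈ U
    · simp [FormField.smul_apply, hx]
    · simp [FormField.smul_apply, hx]

variable {U}

lemma restrictForm_of_mem (σ : FormField E M p) {x : M} (hx : x ∈ U) :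
    restrictForm U p σ x = σ x := if_pos hx

lemma restrictForm_of_notMem (σ : FormField E M p) {x : M} (hx : x ∉ U) :
    restrictForm U p σ x = 0 := if_neg hx

variable [IsManifold 𝓘(ℝ, E) ∞ M]

lemma restrictForm_mem_smoothForms {σ : FormField E M p} (hσ : σ ∈ smoothForms (E := E) ⊤ p) :
    restrictForm U p σ ∈ smoothForms U p := by
  refine ⟨fun x hx => ?_, fun x hx => restrictForm_of_notMem σ hx⟩
  refine (smoothAt_of_mem hσ (U := ⊤) (x := x) trivial).congr ?_
  filter_upwards [U.isOpen.mem_nhds hx] with x' hx'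
  exact (restrictForm_of_mem σ hx').symm

lemma d_restrictForm (σ : smoothForms (E := E) (⊤ : TopologicalSpace.Opens M) p)
    (h : restrictForm U p σ.1 ∈ smoothForms U p) :
    d U p ⟨restrictForm U p σ.1, h⟩ = restrictForm U (p + 1) (d ⊤ p σ) := by
  ext1; funext x
  by_cases hx : x ∈ U
  · rw [d_apply_of_mem _ hx, restrictForm_of_mem _ hx, d_apply_of_mem σ trivial]
    refine extDerivField_congr ?_
    filter_upwards [U.isOpen.mem_nhds hx] with x' hx'
    exact restrictForm_of_mem _ hx'
  · rw [d_apply_of_notMem _ hx, restrictForm_of_notMem _ hx]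

/-- A smooth form is determined by its restriction to a dense open set. -/
lemma eq_of_restrictForm_eq (hU : Dense (U : Set M)) {σ τ : FormField E M p}
    (hσ : σ ∈ smoothForms (E := E) ⊤ p) (hτ : τ ∈ smoothForms (E := E) ⊤ p)
    (h : restrictForm U p σ = restrictForm U p τ) : σ = τ := by
  ext1; funext x
  refine SmoothAt.eq_of_eventually_off (A := (U : Set M)ᶜ) (by rwa [compl_compl])
    (smoothAt_of_mem hσ trivial) (smoothAt_of_mem hτ trivial) (Eventually.of_forall fun y hy => ?_)
  have hy' : y ∈ U := not_not.1 hy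
  rw [← restrictForm_of_mem σ hy', h, restrictForm_of_mem τ hy']

/-- The cohomology of `M` is the cohomology of the complex of restrictions of smooth forms to a
dense open subset. -/
lemma nonempty_deRham_equiv_of_restrict [FiniteDimensional ℝ E] (hU : Dense (U : Set M))
    {C : ∀ p : ℕ, Submodule ℝ (FormField E M p)}
    (hC : ∀ p, C p = (smoothForms (E := E) ⊤ p).map (restrictForm U p)) (p : ℕ) :
    Nonempty (DeRhamCohomology E M p ≃ₗ[ℝ] Cohomology U C p) := by
  have hmem : ∀ {q} {σ : FormField E M q}, σ ∈ smoothForms (E := E) ⊤ q →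
      restrictForm U q σ ∈ C q := fun {q σ} hσ => by
    rw [hC]; exact Submodule.mem_map_of_mem hσ
  have hcl : ∀ σ ∈ closedForms (⊤ : TopologicalSpace.Opens M) (smoothForms (E := E) ⊤) p,
      restrictForm U p σ ∈ closedForms U C p := fun σ hσ => by
    obtain ⟨-, h1, h2⟩ := mem_closedForms.1 hσ
    refine mem_closedForms.2 ⟨hmem h1, restrictForm_mem_smoothForms h1, ?_⟩
    rw [d_restrictForm ⟨σ, h1⟩, h2, map_zero]
  refine nonempty_quotient_equiv ((restrictForm U p).restrict hcl) ?_ ?_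
  · rintro ⟨σ, hσ⟩
    obtain ⟨-, hσs, -⟩ := mem_closedForms.1 hσ
    change restrictForm U p σ ∈ exactForms U C p ↔ σ ∈ exactForms ⊤ (smoothForms (E := E) ⊤) p
    cases p with
    | zero =>
      rw [mem_exactForms_zero, mem_exactForms_zero]
      refine ⟨fun h => eq_of_restrictForm_eq hU hσs (Submodule.zero_mem _) ?_, fun h => ?_⟩
      · rw [h, map_zero]
      · rw [h, map_zero]
    | succ p =>
      rw [mem_exactForms_succ, mem_exactForms_succ]
      constructor
      · rintro ⟨-, ⟨τ', hτ's⟩, hτ', hd⟩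
        rw [hC] at hτ'
        obtain ⟨τ, hτ, rfl⟩ := hτ'
        rw [d_restrictForm ⟨τ, hτ⟩] at hd
        exact ⟨hσs, ⟨τ, hτ⟩, hτ, eq_of_restrictForm_eq hU (d_mem_smoothForms _) hσs hd⟩
      · rintro ⟨-, τ, hτ, hd⟩
        refine ⟨hmem hσs, ⟨restrictForm U p τ.1, restrictForm_mem_smoothForms τ.2⟩, hmem τ.2, ?_⟩
        rw [d_restrictForm τ, hd]
  · rintro ⟨b, hb⟩
    obtain ⟨hbC, hbs, hbd⟩ := mem_closedForms.1 hb
    rw [hC] at hbC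
    obtain ⟨σ, hσ, rfl⟩ := hbC
    rw [d_restrictForm ⟨σ, hσ⟩] at hbd
    have h1 : d ⊤ p ⟨σ, hσ⟩ = 0 := eq_of_restrictForm_eq hU (d_mem_smoothForms _)
      (Submodule.zero_mem _) (by rw [hbd, map_zero])
    refine ⟨⟨σ, mem_closedForms.2 ⟨hσ, hσ, h1⟩⟩, ?_⟩
    change restrictForm U p σ - restrictForm U p σ ∈ exactForms U C p
    rw [sub_self]
    exact Submodule.zero_mem _

end Restriction

/-! ### Cohomology of the filtration -/

namespace Collar
variable {k : ℕ} {E F M Z : Type*}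
  [NormedAddCommGroup E] [NormedSpace ℝ E] [NormedAddCommGroup F] [NormedSpace ℝ F]
  [TopologicalSpace M] [ChartedSpace E M] [IsManifold 𝓘(ℝ, E) ∞ M] [FiniteDimensional ℝ E]
  [TopologicalSpace Z] [ChartedSpace F Z] {B : BkManifold k E F M Z} (C : Collar B)

/-- The forms without poles are the restrictions of the smooth forms on `M`. -/
lemma filt_zero_eq_map (p : ℕ) :
    C.filt 0 p = (smoothForms (E := E) ⊤ p).map (restrictForm B.compl p) := by
  ext σ
  constructor
  · intro h
    obtain ⟨τ, hτ, hτσ⟩ := (C.extendsOver_of_mem_filt_zero h).exists_smooth C.dense_compl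
    refine ⟨τ, ⟨fun x _ => hτ x, fun x hx => absurd trivial hx⟩, ?_⟩
    ext1; funext x
    by_cases hx : x ∈ B.compl
    · rw [restrictForm_of_mem τ hx, hτσ x hx]
    · rw [restrictForm_of_notMem τ hx, h.1.2 x hx]
  · rintro ⟨τ, hτ, rfl⟩
    refine C.mem_filt_of_extendsOver (restrictForm_mem_smoothForms hτ) ?_ 0
    exact (ExtendsOver.of_smoothAt (A := range B.incl) fun x => smoothAt_of_mem hτ trivial).congr
      fun x hx => (restrictForm_of_mem τ (U := B.compl) hx).symm

variable [T2Space M] [SigmaCompactSpace M] [IsManifold 𝓘(ℝ, F) ∞ Z] [FiniteDimensional ℝ F]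

/-- One more order of poles adds one copy of the cohomology of the hypersurface. -/
lemma nonempty_cohomology_filt_succ (hdim : Module.finrank ℝ E = Module.finrank ℝ F + 1)
    (j p : ℕ) : Nonempty (Cohomology B.compl (C.filt (j + 1)) (p + 1) ≃ₗ[ℝ]
      Cohomology B.compl (C.filt j) (p + 1) × DeRhamCohomology F Z p) := by
  have hd : ∀ q (σ : smoothForms (E := E) B.compl q), σ.1 ∈ C.filt j q →
      d B.compl q σ ∈ C.filt j (q + 1) := fun q σ => C.d_mem_filt σ
  have h0 : C.filt (j + 1) 0 = C.filt j 0 := by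
    rw [C.filt_degree_zero (j + 1), C.filt_degree_zero j]
  -- without a hypersurface there is no retraction, and the zero operator serves as `polar`
  rcases isEmpty_or_nonempty Z with hZ | hZ
  · have : ∀ q, Subsingleton (FormField F Z q) := fun q => FormField.equivFun.subsingleton
    refine nonempty_cohomology_equiv_prod (C.filt_le_smoothForms (j + 1)) (C.filt_mono j) hd
      (fun q => 0) (fun q => d_mem_smoothForms) (fun q α _ => Submodule.zero_mem _) ?_
      (fun q α _ _ => Subsingleton.elim _ _) (fun q σ hσ => ⟨0, Submodule.zero_mem _, ?_⟩) h0 p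
    · intro q α h
      have h1 : (⟨(0 : FormField F Z q →ₗ[ℝ] FormField E M (q + 1)) α.1, h⟩ :
        smoothForms (E := E) B.compl (q + 1)) = 0 := rfl
      rw [h1, map_zero, LinearMap.zero_apply, neg_zero]
    · rw [map_zero, sub_zero]
      refine C.mem_filt_of_extendsOver hσ.1 ?_ j
      exact extendsOver_of_forall_incl (fun x hx => smoothAt_of_mem hσ.1 hx) fun z => isEmptyElim z
  · obtain ⟨T⟩ := exists_tube C
    have hs : ∀ {q} {α : FormField F Z q}, α ∈ smoothForms (E := F) ⊤ q → ∀ z, SmoothAt α z :=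
      fun hα z => smoothAt_of_mem hα trivial
    refine nonempty_cohomology_equiv_prod (C.filt_le_smoothForms (j + 1)) (C.filt_mono j) hd
      (fun q => T.polar (j + 1)) (fun q => d_mem_smoothForms)
      (fun q α hα => T.polar_mem_filt (j + 1) (hs hα)) (fun q α h => T.d_polar (j + 1) α h)
      (fun q α hα h => T.eq_zero_of_polar_mem_filt j (hs hα) h) (fun q σ hσ => ?_) h0 p
    obtain ⟨α, hα, h⟩ := T.exists_sub_polar_mem_filt hdim j hσ
    exact ⟨α, ⟨fun z _ => hα z, fun z hz => absurd trivial hz⟩, h⟩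

/-- Each of the `j` orders of poles contributes one copy of the cohomology of the hypersurface. -/
lemma nonempty_cohomology_filt (hdim : Module.finrank ℝ E = Module.finrank ℝ F + 1) (p j : ℕ) :
    Nonempty (Cohomology B.compl (C.filt j) (p + 1) ≃ₗ[ℝ]
      DeRhamCohomology E M (p + 1) × (Fin j → DeRhamCohomology F Z p)) := by
  induction j with
  | zero =>
    obtain ⟨e⟩ := nonempty_deRham_equiv_of_restrict C.dense_compl C.filt_zero_eq_map (p + 1)
    exact ⟨e.symm.trans (LinearEquiv.prodUnique (R := ℝ)).symm⟩
  | succ j ih =>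
    obtain ⟨e⟩ := C.nonempty_cohomology_filt_succ hdim j p
    obtain ⟨e'⟩ := ih
    exact ⟨e.trans (((e'.prodCongr (LinearEquiv.refl ℝ _)).trans
      (LinearEquiv.prodAssoc ℝ _ _ _)).trans ((LinearEquiv.refl ℝ _).prodCongr
        ((LinearEquiv.prodComm ℝ _ _).trans
          (Fin.consLinearEquiv ℝ fun _ => DeRhamCohomology F Z p))))⟩

lemma nonempty_cohomology_filt_degree_zero (j : ℕ) :
    Nonempty (Cohomology B.compl (C.filt j) 0 ≃ₗ[ℝ] DeRhamCohomology E M 0) := by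
  obtain ⟨e⟩ := nonempty_deRham_equiv_of_restrict C.dense_compl C.filt_zero_eq_map 0
  obtain ⟨e'⟩ := nonempty_cohomology_zero_equiv (U := B.compl) (C.filt_degree_zero j)
  exact ⟨e'.trans e.symm⟩

end Collar

end BkGeometry

end

theorem mainTheorem1 (n k : ℕ) (hk : 1 ≤ k)
    {M : Type*} [TopologicalSpace M] [T2Space M] [SecondCountableTopology M]
    [ChartedSpace (EuclideanSpace ℝ (Fin (n + 1))) M]
    [IsManifold (modelWithCornersSelf ℝ (EuclideanSpace ℝ (Fin (n + 1)))) ∞ M]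
    {Z : Type*} [TopologicalSpace Z]
    [ChartedSpace (EuclideanSpace ℝ (Fin n)) Z]
    [IsManifold (modelWithCornersSelf ℝ (EuclideanSpace ℝ (Fin n))) ∞ Z]
    (B : BkGeometry.BkManifold k (EuclideanSpace ℝ (Fin (n + 1))) (EuclideanSpace ℝ (Fin n)) M Z) :
    Nonempty (B.BkCohomology 0 ≃ₗ[ℝ]
      BkGeometry.DeRhamCohomology (EuclideanSpace ℝ (Fin (n + 1))) M 0) ∧
    ∀ p : ℕ, Nonempty (B.BkCohomology (p + 1) ≃ₗ[ℝ]
      BkGeometry.DeRhamCohomology (EuclideanSpace ℝ (Fin (n + 1))) M (p + 1) ×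
        (Fin k → BkGeometry.DeRhamCohomology (EuclideanSpace ℝ (Fin n)) Z p)) := by
  have : LocallyCompactSpace M := Manifold.locallyCompact_of_finiteDimensional
    (modelWithCornersSelf ℝ (EuclideanSpace ℝ (Fin (n + 1))))
  obtain ⟨C⟩ := BkGeometry.exists_collar B
  have hdim : Module.finrank ℝ (EuclideanSpace ℝ (Fin (n + 1))) =
      Module.finrank ℝ (EuclideanSpace ℝ (Fin n)) + 1 := by
    rw [finrank_euclideanSpace_fin, finrank_euclideanSpace_fin]
  have hB : B.bkForms = C.filt k := funext fun p => (C.filt_eq_bkForms hk hdim p).symm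
  constructor
  · have h := C.nonempty_cohomology_filt_degree_zero k
    rwa [← hB] at h
  · intro p
    have h := C.nonempty_cohomology_filt hdim p k
    rwa [← hB] at h
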